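/- Let $n\ge 1$ and let $p$ be a prime; write $t=p^{-s}$. **Notation.** For $I=\{i_1<\dots<i_m\}\subseteq\{1,\dots,h-1\}$ put $\binom{h}{I}_Y=\binom{h}{i_m}_Y\binom{i_m}{i_{m-1}}_Y\cdots\binom{i_2}{i_1}_Y$ (Gaussian binomials), $\binom hI=\binom hI_1$, and $$I_h(Y;X_1,\dots,X_h)=\frac1{1-X_h}\sum_{I\subseteq\{1,\dots,h-1\}}\binom hI_Y\prod_{i\in I}\frac{X_i}{1-X_i},\qquad I_h^\circ(Y;X_1,\dots,X_h)=X_h\,I_h(Y;X_1,\dots,X_h).$$ Every Dyck word $w$ of length $2n$ (in the letters $0,1$, no initial segment containing more ones than zeros) is uniquely $w=\prod_{i=1}^r 0^{L_i-L_{i-1}}1^{M_i-M_{i-1}}$ with $0=L_0<L_1<\dots<L_r=n$ and $0=M_0<M_1<\dots<M_r=n$. For partitions $\mu\le\lambda$ (that is, $\mu_i\le\lambda_i$ for all $i$) with $n$ non-negative parts, $w(\mu,\lambda)$ is the Dyck word for which $$\lambda_1\ge\dots\ge\lambda_{L_1}\ge\mu_1\ge\dots\ge\mu_{M_1}>\lambda_{L_1+1}\ge\dots\ge\lambda_{L_2}\ge\mu_{M_1+1}\ge\dots\ge\mu_{M_2}>\cdots>\lambda_{L_{r-1}+1}\ge\dots\ge\lambda_n\ge\mu_{M_{r-1}+1}\ge\dots\ge\mu_n.$$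 Let $\alpha(\lambda,\mu;p)$ be the number of subgroups of type $\mu$ in an abelian $p$-group of type $\lambda$, and for $\ell\in\mathbb N_0^n$ let $\lambda(\ell)$ be its non-ascending rearrangement. For a Dyck word $w$ of length $2n$ set $$D^{\mathbf 1}_w(p,t)=\sum_{\mu\le\lambda,\;w(\mu,\lambda)=w}\alpha(\lambda,\mu;p)\,(p^{2n}t)^{\sum_i\mu_i}\sum_{\ell\in\mathbb N_0^n,\;\lambda(\ell)=\lambda}t^{2\sum_i\ell_i}$$ (here all of $\mathbb N_0^n$ is admissible, as is the case for totally split primes). For a group $G$ let $a^{\triangleleft}_m(G)$ be the number of its normal subgroups of index $m$, let $\zeta^{\triangleleft}_{G,p}(s)=\sum_{k\ge0}a^{\triangleleft}_{p^k}(G)p^{-ks}$, and let $H(R)$ be the Heisenberg group of upper unitriangular $3\times3$ matrices over a commutative ring $R$. **Theorem.** (i) For every Dyck word $w$ of length $2n$, with $L_i,M_i$ as above and $\mathcal L=\{L_1,\dots,L_{r-1}\}$, the sum defining $D^{\mathbf 1}_w(p,t)$ converges absolutely for $\operatorname{Re}(s)>2n/3$ and $$D^{\mathbf 1}_w(p,t)=\binom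 n{\mathcal L}\prod_{i=1}^r\binom{L_i-M_{i-1}}{L_i-M_i}_{p^{-1}}\prod_{i=1}^r I_{L_i-L_{i-1}}(1;y_{L_{i-1}+1},\dots,y_{L_i})\cdot\prod_{i=1}^{r-1}I^\circ_{M_i-M_{i-1}}(p^{-1};x_{M_{i-1}+1},\dots,x_{M_i})\cdot I_{n-M_{r-1}}(p^{-1};x_{M_{r-1}+1},\dots,x_n),$$ where $$x_j=p^{j(2n+L_i-j)}t^{2L_i+j}\ \ (M_{i-1}<j\le M_i),\qquad y_j=p^{(2n-M_{i-1}+j)M_{i-1}}t^{2j+M_{i-1}}\ \ (L_{i-1}<j\le L_i).$$ (ii) Let $D_w(X,Y)\in\mathbb Q(X,Y)$ be the right-hand side with $p$ replaced by $X$ and $t$ by $Y$, and put $$W_{\mathbf 1,\mathbf 1}(X,Y)=(1-Y^2)^n\prod_{i=0}^{2n-1}\frac1{1-X^iY}\sum_{w}D_w(X,Y),$$ the sum over all Dyck words of length $2n$. Then for $\operatorname{Re}(s)>2n-1$ the series $\zeta^{\triangleleft}_{H(\mathcal O_K),p}(s)$ converges absolutely with value $W_{\mathbf 1,\mathbf 1}(p,p^{-s})$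 for every number field $K$ of degree $n$ in which $p$ splits totally, and likewise $\zeta^{\triangleleft}_{H(\mathbb Z)^n,p}(s)=W_{\mathbf 1,\mathbf 1}(p,p^{-s})$. -/

import Mathlib

noncomputable section

namespace HeisenbergZeta

/-! ### Gaussian binomials and Igusa functions -/

/-- The Gaussian polynomial `binom a b` in `ℤ[Y]`, by the `q`-Pascal rule; `gaussBinom_mul` below
identifies it with `∏_{i=a-b+1}^a (1-Y^i) / ∏_{i=1}^b (1-Y^i)`. -/
def gaussBinom : ℕ → ℕ → Polynomial ℤ
  | _, 0 => 1
  | 0, _ + 1 => 0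
  | a + 1, b + 1 => gaussBinom a b + Polynomial.X ^ (b + 1) * gaussBinom a (b + 1)

theorem gaussBinom_mul (a b : ℕ) (h : b ≤ a) :
    gaussBinom a b * ∏ i ∈ Finset.Icc 1 b, (1 - Polynomial.X ^ i) =
      ∏ i ∈ Finset.Icc (a - b + 1) a, (1 - Polynomial.X ^ i : Polynomial ℤ) := by
  have h0 : ∀ a b : ℕ, a < b → gaussBinom a b = 0 := by
    intro a
    induction a with
    | zero =>
      intro b hb
      obtain ⟨b, rfl⟩ : ∃ c, b = c + 1 := ⟨b - 1, by omega⟩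
      rfl
    | succ a ih =>
      intro b hb
      obtain ⟨b, rfl⟩ : ∃ c, b = c + 1 := ⟨b - 1, by omega⟩
      rw [gaussBinom, ih b (by omega), ih (b + 1) (by omega)]
      simp
  induction a generalizing b with
  | zero =>
    obtain rfl : b = 0 := by omega
    simp [gaussBinom]
  | succ a ih =>
    rcases b with _ | b
    · simp [gaussBinom]
    · have e1 : a + 1 - (b + 1) + 1 = a - b + 1 := by omega
      have h1 := ih b (by omega)
      rw [e1, gaussBinom, Finset.prod_Icc_succ_top (by omega : 1 ≤ b + 1),
        Finset.prod_Icc_succ_top (by omega : a - b + 1 ≤ a + 1), ← h1]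
      rcases Nat.lt_or_ge a (b + 1) with hlt | hge
      · obtain rfl : a = b := by omega
        rw [h0 a (a + 1) (by omega)]
        ring
      · have h2 := ih (b + 1) hge
        rw [Finset.prod_Icc_succ_top (by omega : 1 ≤ b + 1)] at h2
        have e2 : Finset.Icc (a - (b + 1) + 1) a =
            insert (a - b) (Finset.Icc (a - b + 1) a) := by
          ext x
          simp only [Finset.mem_Icc, Finset.mem_insert]
          omega
        rw [e2, Finset.prod_insert (by simp), ← h1] at h2
        have e3 : (Polynomial.X : Polynomial ℤ) ^ (a + 1) =
            Polynomial.X ^ (b + 1) * Polynomial.X ^ (a - b) := by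
          rw [← pow_add]
          congr 1
          omega
        rw [e3]
        linear_combination Polynomial.X ^ (b + 1) * h2

/-- `chainProd c a [i_m, …, i_1] = c a i_m * c i_m i_{m-1} * ⋯ * c i_2 i_1`. -/
def chainProd {R : Type*} [MulOneClass R] (c : ℕ → ℕ → R) : ℕ → List ℕ → R
  | _, [] => 1
  | a, b :: l => c a b * chainProd c b l

/-- The Gaussian multinomial `binom n I` in `ℤ[Y]`. -/
def gaussMultinomial (n : ℕ) (I : Finset ℕ) : Polynomial ℤ :=
  chainProd gaussBinom n (I.sort (· ≥ ·))

/-- The multinomial `binom n I`. -/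
def multinomial (n : ℕ) (I : Finset ℕ) : ℕ :=
  chainProd Nat.choose n (I.sort (· ≥ ·))

/-- The sum over `I ⊆ [h-1]` common to the two Igusa functions. -/
def igusaSum {F : Type*} [Field F] (h : ℕ) (Y : F) (X : ℕ → F) : F :=
  ∑ I ∈ (Finset.Icc 1 (h - 1)).powerset,
    Polynomial.aeval Y (gaussMultinomial h I) * ∏ i ∈ I, X i / (1 - X i)

/-- The Igusa function `I_h(Y; X_1, …, X_h)`, evaluated at elements of a field. -/
def igusa {F : Type*} [Field F] (h : ℕ) (Y : F) (X : ℕ → F) : F :=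
  1 / (1 - X h) * igusaSum h Y X

/-- The Igusa function `I_h°(Y; X_1, …, X_h)`, evaluated at elements of a field. -/
def igusaCirc {F : Type*} [Field F] (h : ℕ) (Y : F) (X : ℕ → F) : F :=
  X h / (1 - X h) * igusaSum h Y X

/-! ### Partitions and Dyck words -/

/-- The `j`-th entry (`1 ≤ j ≤ n`) of an `n`-tuple, indexed from `1`; zero for other `j`. -/
def part {n : ℕ} (v : Fin n → ℕ) (j : ℕ) : ℕ :=
  if h : 1 ≤ j ∧ j ≤ n then v ⟨j - 1, by omega⟩ else 0

/-- `w = ∏_{i=1}^r 0^{L_i - L_{i-1}} 1^{M_i - M_{i-1}}` with `0 = L_0 < L_1 < ⋯ < L_r = n` and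
`0 = M_0 < M_1 < ⋯ < M_r = n`; the letters `0` and `1` are `DyckStep.U` and `DyckStep.D`. -/
structure IsBlockForm (n : ℕ) (w : DyckWord) (r : ℕ) (L M : ℕ → ℕ) : Prop where
  L_zero : L 0 = 0
  M_zero : M 0 = 0
  L_last : L r = n
  M_last : M r = n
  L_lt : ∀ i < r, L i < L (i + 1)
  M_lt : ∀ i < r, M i < M (i + 1)
  word_eq : w.toList = (List.range r).flatMap fun i =>
    List.replicate (L (i + 1) - L i) DyckStep.U ++ List.replicate (M (i + 1) - M i) DyckStep.D

/-- `w(μ, λ) = w`: for partitions `μ ≤ λ` with `n` parts,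
`λ_1 ≥ ⋯ ≥ λ_{L_1} ≥ μ_1 ≥ ⋯ ≥ μ_{M_1} > λ_{L_1+1} ≥ ⋯ ≥ λ_{L_2} ≥ μ_{M_1+1} ≥ ⋯ ≥ μ_{M_2} > ⋯`,
where `L_i`, `M_i` are the integers determined by `w`. -/
def HasOverlap {n : ℕ} (mu lam : Fin n → ℕ) (w : DyckWord) : Prop :=
  ∃ (r : ℕ) (L M : ℕ → ℕ), IsBlockForm n w r L M ∧
    (∀ i < r, part mu (M i + 1) ≤ part lam (L (i + 1))) ∧
    (∀ i, 1 ≤ i → i < r → part lam (L i + 1) < part mu (M i))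

/-- The pairs `(μ, λ)` of partitions with `n` parts such that `μ ≤ λ` and `w(μ, λ) = w`. -/
def overlapPairs (n : ℕ) (w : DyckWord) : Set ((Fin n → ℕ) × (Fin n → ℕ)) :=
  {x | Antitone x.1 ∧ Antitone x.2 ∧ x.1 ≤ x.2 ∧ HasOverlap x.1 x.2 w}

/-- `λ(ℓ)`: the entries of `ℓ` in non-ascending order. -/
def sortDesc {n : ℕ} (l : Fin n → ℕ) : Fin n → ℕ := fun j => l (Tuple.sort l j.rev)

/-- `α(λ, μ; p)`: the number of subgroups of type `μ` in an abelian `p`-group of type `λ`. -/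
def alpha {n : ℕ} (lam mu : Fin n → ℕ) (p : ℕ) : ℕ :=
  Nat.card {H : AddSubgroup (∀ i, ZMod (p ^ lam i)) // Nonempty (H ≃+ ∀ i, ZMod (p ^ mu i))}

/-- Admissibility of an `n`-tuple for `(e, f)`. With `C_i = ∑_{j ≤ i} e_j f_j`: within the `i`-th
block of positions `]C_{i-1}, C_i]` all entries are equal, except that the first `δ_i f_i` of them
are larger by one, for some `0 ≤ δ_i < e_i`. -/
def IsAdm {n g : ℕ} (e f : Fin g → ℕ) (l : Fin n → ℕ) : Prop :=
  ∀ i : Fin g, ∃ δ < e i, ∃ m : ℕ, ∀ j : Fin n,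
    let C : ℕ := ∑ k ∈ Finset.univ.filter (· < i), e k * f k
    C ≤ j ∧ (j : ℕ) < C + e i * f i → l j = if (j : ℕ) < C + δ * f i then m + 1 else m

/-- The summand of `D_w^{e,f}(p,t)` at a pair `(μ, λ)`. -/
def dyckTerm {n g : ℕ} (e f : Fin g → ℕ) (p : ℕ) (t : ℂ) (x : (Fin n → ℕ) × (Fin n → ℕ)) : ℂ :=
  (alpha x.2 x.1 p : ℂ) * ((p : ℂ) ^ (2 * n) * t) ^ (∑ i, x.1 i) *
    ∑ᶠ l ∈ {l : Fin n → ℕ | IsAdm e f l ∧ sortDesc l = x.2}, t ^ (2 * ∑ i, l i)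

/-- `D_w^{e,f}(p,t)`, the sum over all partitions `μ ≤ λ` with `w(μ, λ) = w`. -/
def dyckSum (n : ℕ) {g : ℕ} (e f : Fin g → ℕ) (w : DyckWord) (p : ℕ) (t : ℂ) : ℂ :=
  ∑' x : overlapPairs n w, dyckTerm e f p t x.1

/-! ### The explicit rational functions -/

/-- `x_j = X^{j(2n+L_i-j)} Y^{2L_i+j}`, for `j ∈ ]M_{i-1}, M_i]`. -/
def numX {F : Type*} [Field F] (n : ℕ) (L : ℕ → ℕ) (X Y : F) (i j : ℕ) : F :=
  X ^ (j * (2 * n + L i - j)) * Y ^ (2 * L i + j)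

/-- `y_j = X^{(2n-M_{i-1}+j)M_{i-1}} Y^{2j+M_{i-1}}`, for `j ∈ ]L_{i-1}, L_i]`. -/
def numY {F : Type*} [Field F] (n : ℕ) (M : ℕ → ℕ) (X Y : F) (i j : ℕ) : F :=
  X ^ ((2 * n - M (i - 1) + j) * M (i - 1)) * Y ^ (2 * j + M (i - 1))

/-- The product of binomials and Igusa functions attached to the block data `r`, `L`, `M` of a
Dyck word, with `X` in place of `p` and `Y` in place of `t`. -/
def splitProduct {F : Type*} [Field F] (n r : ℕ) (L M : ℕ → ℕ) (X Y : F) : F :=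
  (multinomial n ((Finset.Icc 1 (r - 1)).image L) : F) *
  (∏ i ∈ Finset.Icc 1 r,
    Polynomial.aeval X⁻¹ (gaussBinom (L i - M (i - 1)) (L i - M i))) *
  (∏ i ∈ Finset.Icc 1 r,
    igusa (L i - L (i - 1)) 1 fun k => numY n M X Y i (L (i - 1) + k)) *
  (∏ i ∈ Finset.Icc 1 (r - 1),
    igusaCirc (M i - M (i - 1)) X⁻¹ fun k => numX n L X Y i (M (i - 1) + k)) *
  igusa (n - M (r - 1)) X⁻¹ fun k => numX n L X Y r (M (r - 1) + k)

/-- Dyck words of length `2n`. -/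
abbrev DyckWords (n : ℕ) : Type := {w : DyckWord // w.semilength = n}

/-- `W_{1,1}(X,Y) = (1-Y²)^n ∏_{i=0}^{2n-1} (1-X^i Y)⁻¹ ∑_w D_w(X,Y)`, the sum over Dyck words `w`
of length `2n` with block data `r w`, `L w`, `M w`. -/
def normalW {F : Type*} [Field F] (n : ℕ) (r : DyckWords n → ℕ) (L M : DyckWords n → ℕ → ℕ)
    (X Y : F) : F :=
  (1 - Y ^ 2) ^ n * (1 / ∏ i ∈ Finset.range (2 * n), (1 - X ^ i * Y)) *
    ∑ w : DyckWords n, splitProduct n (r w) (L w) (M w) X Y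

/-! ### Heisenberg groups and normal zeta functions -/

/-- The Heisenberg group `H(R)` of upper unitriangular `3 × 3` matrices. -/
def heisenberg (R : Type*) [CommRing R] : Subgroup (Matrix.GeneralLinearGroup (Fin 3) R) where
  carrier := {A | ∃ a b c : R, A.val = !![1, a, c; 0, 1, b; 0, 0, 1]}
  one_mem' := ⟨0, 0, 0, by simp [Matrix.one_fin_three]⟩
  mul_mem' := by
    rintro A B ⟨a, b, c, hA⟩ ⟨a', b', c', hB⟩
    refine ⟨a + a', b + b', c' + a * b' + c, ?_⟩
    rw [Units.val_mul, hA, hB]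
    ext i j
    fin_cases i <;> fin_cases j <;> simp [Matrix.mul_apply, Fin.sum_univ_three] <;> ring
  inv_mem' := by
    rintro A ⟨a, b, c, hA⟩
    refine ⟨-a, -b, a * b - c, ?_⟩
    refine Units.inv_eq_of_mul_eq_one_right ?_
    rw [hA]
    ext i j
    fin_cases i <;> fin_cases j <;> simp [Matrix.mul_apply, Fin.sum_univ_three] <;> ring

/-- `a_m^◁(G)`: the number of normal subgroups of `G` of index `m`. -/
def normalCount (G : Type*) [Group G] (m : ℕ) : ℕ :=
  Nat.card {N : Subgroup G // N.Normal ∧ N.index = m}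

/-- `z = ∑_{k ≥ 0} a_{p^k}^◁(G) p^{-ks}`, the series being absolutely convergent. -/
def HasLocalNormalZeta (G : Type*) [Group G] (p : ℕ) (s z : ℂ) : Prop :=
  HasSum (fun k : ℕ => (normalCount G (p ^ k) : ℂ) * ((p ^ k : ℕ) : ℂ) ^ (-s)) z

/-- `p` has decomposition type `(e, f)` in `K`. -/
def HasDecompositionType (K : Type*) [Field K] [NumberField K] (p : ℕ) {g : ℕ}
    (e f : Fin g → ℕ) : Prop :=
  ∃ P : Fin g → Ideal (NumberField.RingOfIntegers K), Function.Injective P ∧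
    (∀ i, (P i).IsPrime) ∧
    Ideal.span {(p : NumberField.RingOfIntegers K)} = ∏ i, P i ^ e i ∧
    ∀ i, (P i).inertiaDeg ℤ = f i

end HeisenbergZeta

end

/-! Part (ii) reduces to part (i) by lattice counting. A normal subgroup of `H(R)` has the same
underlying set and index as an additive subgroup `N` of `R × R × R` that contains `(0, 0, ac)` and
`(0, 0, bc)` whenever `(a, b, z) ∈ N` (`HeisCoord.normalCount_eq`). A subgroup of index `m` contains
all `m`-th multiples, so only `R/mR` matters (`heisCount_congr_of_surjective`). For `m = p^k` this
quotient is `(ℤ/p^k)^n` both for `R = ℤ^n` and for the integers of a field in which `p` splits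
totally, and `H(ℤ)^n = H(ℤ^n)`. Hence everything happens over `ℤ^n`.

There `N` is given by its projection `S ⊆ ℤ^{2n}`, its intersection `S' ⊆ ℤ^n` with the centre, and
a homomorphism `S → ℤ^n/S'`, for which there are `|ℤ^n : S'|^{2n}` choices. The ideal condition says
`S ⊆ C × C`, where `C = ∏ p^{c_i} ℤ` is the largest ideal inside `S'` (`isHeisIdeal_iff`). As `C ×
C` is free of rank `2n`, the sum over `S` gives `t^{2∑c_i} ∏_{i<2n} (1 - p^i t)⁻¹`. In the remaining
sum over `S'`, replacing `c` by all `ℓ ≥ c` costs a factor `(1 - t²)^{-n}`, and the pairs `(S', ℓ)`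
are the subgroups of the groups `∏ ℤ/p^{ℓ_i}` (`bijective_latticePair`). Duality turns the index of
the subgroup into its order. Sorting by the type `μ` of the subgroup and by `λ(ℓ)` yields `∑_w D_w`,
because each pair `μ ≤ λ` has exactly one overlap word.

For part (i), both counts in the summand are explicit. Dividing injective homomorphisms by
automorphisms gives `α(λ, μ; p)` as a product over the parts of `μ` (`alpha_eq`); orbit-stabilizer
gives the number of rearrangements of `λ`, the analogue with `k` in place of `1 - p^{-k}`
(`card_sortDesc_eq`). Merging `λ` and `μ` along the lattice path of `w` produces one non-ascending
sequence of length `2n`. Its consecutive drops are free non-negative integers, except that the drops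
at the valleys must be positive (`bijective_mergedPair`, `IsBlocks.valleyPos_iff`). In these
coordinates the powers of `p` and `t` become a monomial, and the summand factors over the runs of
the path, up to a constant depending on `w` alone (`IsBlocks.dyckTerm_mergedPair`). The constant
supplies the binomials. The sum over one run is an Igusa function (`hasSum_igusaSum`): for a fixed
support of the drops the denominators are constant and amount to a Gaussian multinomial, and what is
left is a product of geometric series. They all converge because every numerical datum has norm less
than `1` when `Re(s) > 2n/3` (`norm_weight_lt_one`). -/

noncomputable section
namespace HeisenbergZeta

/-! ### Injective homomorphisms between finite abelian `p`-groups -/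

/-- Homomorphisms out of `H × ℤ/N` are pairs of a homomorphism and an `N`-torsion element. -/
def homProdZModEquiv (H G : Type*) [AddCommGroup H] [AddCommGroup G] (N : ℕ) :
    (H × ZMod N →+ G) ≃ (H →+ G) × (nsmulAddMonoidHom N : G →+ G).ker where
  toFun f := (f.comp (AddMonoidHom.inl H (ZMod N)), ⟨f (0, 1), by
    have : N • ((0 : H), (1 : ZMod N)) = 0 := by ext <;> simp
    rw [AddMonoidHom.mem_ker, nsmulAddMonoidHom_apply, ← map_nsmul, this, map_zero]⟩)
  invFun x := x.1.coprod (ZMod.lift N ⟨zmultiplesHom G x.2.1, by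
    have := x.2.2
    rw [AddMonoidHom.mem_ker, nsmulAddMonoidHom_apply] at this
    simpa using this⟩)
  left_inv f := by
    apply AddMonoidHom.ext
    rintro ⟨h, a⟩
    obtain ⟨a, rfl⟩ := ZMod.intCast_surjective a
    have : f (h, (a : ZMod N)) = f (h, 0) + a • f (0, 1) := by
      rw [← map_zsmul, ← map_add]
      congr 1
      ext <;> simp
    rw [this, AddMonoidHom.coprod_apply, ZMod.lift_coe]
    simp
  right_inv x := by
    refine Prod.ext (AddMonoidHom.ext fun h => by simp) (Subtype.ext ?_)
    have := ZMod.lift_coe N (⟨zmultiplesHom G x.2.1, by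
      have := x.2.2
      rw [AddMonoidHom.mem_ker, nsmulAddMonoidHom_apply] at this
      simpa using this⟩ : {f : ℤ →+ G // f N = 0}) 1
    simpa using this

/-- Every nonzero subgroup of `ℤ/p^k` contains `p^(k-1)`. So a kernel element with nonzero second
coordinate can be multiplied until that coordinate is `p^(k-1)`, which puts `p^(k-1) x` into the
image of `g`. -/
theorem injective_homProdZModEquiv_symm {H G : Type*} [AddCommGroup H] [AddCommGroup G] {p : ℕ}
    (hp : p.Prime) (k : ℕ) (g : H →+ G) (x : (nsmulAddMonoidHom (p ^ k) : G →+ G).ker) :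
    Function.Injective ((homProdZModEquiv H G (p ^ k)).symm (g, x)) ↔
      Function.Injective g ∧ (k ≠ 0 → p ^ (k - 1) • (x : G) ∉ g.range) := by
  set f := (homProdZModEquiv H G (p ^ k)).symm (g, x) with hf
  have hx : p ^ k • (x : G) = 0 := by
    have := x.2
    rwa [AddMonoidHom.mem_ker, nsmulAddMonoidHom_apply] at this
  have hf1 : ∀ h, f (h, 0) = g h := fun h => by simp [hf, homProdZModEquiv]
  have hf2 : ∀ (h : H) (a : ℤ), f (h, (a : ZMod (p ^ k))) = g h + a • (x : G) := fun h a => by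
    simp [hf, homProdZModEquiv, ZMod.lift_coe]
  constructor
  · intro hinj
    refine ⟨fun a b hab => ?_, fun hk ⟨h, hh⟩ => ?_⟩
    · have : f (a, 0) = f (b, 0) := by rw [hf1, hf1, hab]
      exact (Prod.ext_iff.1 (hinj this)).1
    · have h1 : f (h, 0) = f (0, (((p ^ (k - 1) : ℕ) : ℤ) : ZMod (p ^ k))) := by
        rw [hf1, hf2, hh, map_zero, zero_add, natCast_zsmul]
      have h2 := (Prod.ext_iff.1 (hinj h1)).2
      simp only [Int.cast_natCast] at h2
      have h3 := (ZMod.natCast_eq_zero_iff _ _).1 h2.symm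
      have := (Nat.pow_dvd_pow_iff_le_right hp.one_lt).1 h3
      omega
  · rintro ⟨hg, hk⟩
    rw [injective_iff_map_eq_zero]
    rintro ⟨h, a⟩ h0
    obtain ⟨a, rfl⟩ := ZMod.intCast_surjective a
    rw [hf2] at h0
    by_cases ha : ((a : ZMod (p ^ k))) = 0
    · have h1 : a • (x : G) = 0 := by
        rw [ZMod.intCast_zmod_eq_zero_iff_dvd] at ha
        obtain ⟨c, rfl⟩ := ha
        rw [mul_comm, mul_smul, natCast_zsmul, hx, smul_zero]
      rw [h1, add_zero] at h0
      rw [ha, (injective_iff_map_eq_zero g).1 hg h h0]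
      rfl
    · exfalso
      rw [ZMod.intCast_zmod_eq_zero_iff_dvd] at ha
      have hk0 : k ≠ 0 := by
        rintro rfl
        simp at ha
      apply hk hk0
      -- By Bézout, `p^v = gcd(a, p^k)` is a multiple of `a` modulo `p^k`. Hence `p^v x` is a
      -- multiple of `a x = -g h` and lies in the image of `g`, and so does `p^(k-1) x` since `v <
      -- k`.
      obtain ⟨v, hv, hgcd⟩ : ∃ v ≤ k, Int.gcd a ((p ^ k : ℕ) : ℤ) = p ^ v :=
        (Nat.dvd_prime_pow hp).1 (by
          have := Int.gcd_dvd_right a ((p ^ k : ℕ) : ℤ)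
          exact_mod_cast this)
      have hvk : v < k := by
        rcases hv.lt_or_eq with h | h
        · exact h
        · exfalso
          apply ha
          rw [← h, ← hgcd]
          exact Int.gcd_dvd_left a _
      have hbez := Int.gcd_eq_gcd_ab a ((p ^ k : ℕ) : ℤ)
      rw [hgcd] at hbez
      have h4 : p ^ v • (x : G) ∈ g.range := by
        have : ((p ^ v : ℕ) : ℤ) • (x : G) = Int.gcdA a ((p ^ k : ℕ) : ℤ) • (a • (x : G)) := by
          rw [hbez, add_smul, mul_comm a, mul_smul, mul_comm ((p ^ k : ℕ) : ℤ), mul_smul,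
            natCast_zsmul _ (p ^ k), hx, smul_zero, add_zero]
        rw [natCast_zsmul] at this
        rw [this]
        refine AddSubgroup.zsmul_mem _ (AddMonoidHom.mem_range.2 ⟨-h, ?_⟩) _
        rw [map_neg]
        exact neg_eq_of_add_eq_zero_right h0
      have h5 : p ^ (k - 1) • (x : G) = p ^ (k - 1 - v) • (p ^ v • (x : G)) := by
        rw [← mul_smul, ← pow_add]
        congr 2
        omega
      rw [h5]
      exact AddSubgroup.nsmul_mem _ h4 _

/-- The elements `x` of `p^(k+1)`-torsion with `p^k x` in the image of `g`. -/
theorem card_nsmul_mem_range {H G : Type*} [AddCommGroup H] [AddCommGroup G] [Finite G] {p : ℕ}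
    (k : ℕ) (g : H →+ G) (hg : Function.Injective g)
    (hH : ∀ h : H, p • h = 0 → ∃ h', p ^ k • h' = h) :
    Nat.card {x : (nsmulAddMonoidHom (p ^ (k + 1)) : G →+ G).ker // p ^ k • (x : G) ∈ g.range} =
      Nat.card (nsmulAddMonoidHom p : H →+ H).ker *
        Nat.card (nsmulAddMonoidHom (p ^ k) : G →+ G).ker := by
  let A : AddSubgroup G :=
    (nsmulAddMonoidHom (p ^ (k + 1)) : G →+ G).ker ⊓ g.range.comap (nsmulAddMonoidHom (p ^ k))
  have e1 : {x : (nsmulAddMonoidHom (p ^ (k + 1)) : G →+ G).ker // p ^ k • (x : G) ∈ g.range} ≃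
      A := ⟨fun x => ⟨x.1.1, x.1.2, x.2⟩, fun x => ⟨⟨x.1, x.2.1⟩, x.2.2⟩, fun _ => rfl, fun _ => rfl⟩
  -- Multiplication by `p^k` on `A` has kernel `G[p^k]`. Its image is `g(H[p])`; surjectivity onto
  -- this is where the divisibility hypothesis `hH` enters.
  let φ : A →+ G := (nsmulAddMonoidHom (p ^ k)).comp A.subtype
  have e2 : Nat.card φ.ker = Nat.card (nsmulAddMonoidHom (p ^ k) : G →+ G).ker := by
    refine Nat.card_congr ⟨fun x => ⟨x.1.1, x.2⟩, fun x => ⟨⟨x.1, ?_⟩, x.2⟩, fun x => rfl,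
      fun x => rfl⟩
    have hx := x.2
    rw [AddMonoidHom.mem_ker, nsmulAddMonoidHom_apply] at hx
    refine ⟨?_, ?_⟩
    · change p ^ (k + 1) • (x : G) = 0
      rw [pow_succ', mul_smul, hx, smul_zero]
    · change p ^ k • (x : G) ∈ g.range
      rw [hx]
      exact zero_mem _
  have e3 : φ.range = (nsmulAddMonoidHom p : H →+ H).ker.map g := by
    ext y
    constructor
    · rintro ⟨⟨x, hx1, hx2⟩, rfl⟩
      obtain ⟨h, hh⟩ := hx2
      refine ⟨h, ?_, hh⟩
      change p • h = 0
      apply hg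
      change p ^ (k + 1) • x = 0 at hx1
      change g h = p ^ k • x at hh
      rw [map_nsmul, hh, ← mul_smul, ← pow_succ', hx1, map_zero]
    · rintro ⟨h, hh, rfl⟩
      change p • h = 0 at hh
      obtain ⟨h', rfl⟩ := hH h hh
      refine ⟨⟨g h', ?_, ⟨p ^ k • h', ?_⟩⟩, ?_⟩
      · change p ^ (k + 1) • g h' = 0
        rw [← map_nsmul, pow_succ', mul_smul, hh, map_zero]
      · simp
      · simp [φ]
  have e4 : Nat.card φ.range = Nat.card (nsmulAddMonoidHom p : H →+ H).ker := by
    rw [e3]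
    exact (Nat.card_congr (AddSubgroup.equivMapOfInjective _ g hg).toEquiv).symm
  rw [Nat.card_congr e1, ← AddSubgroup.card_mul_index φ.ker, AddSubgroup.index_ker, e2, e4,
    mul_comm]

/-- An injective `g` on `H` extends by any `x ∈ G[p^k]` outside the set counted in
`card_nsmul_mem_range`. The number of choices does not depend on `g`, so the count is a product. -/
theorem card_injective_prod_zmod {H G : Type*} [AddCommGroup H] [AddCommGroup G] [Finite H]
    [Finite G] {p : ℕ} (hp : p.Prime) (k : ℕ)
    (hH : k ≠ 0 → ∀ h : H, p • h = 0 → ∃ h', p ^ (k - 1) • h' = h) :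
    (Nat.card {f : H × ZMod (p ^ k) →+ G // Function.Injective f} : ℤ) =
      Nat.card {g : H →+ G // Function.Injective g} *
        (Nat.card (nsmulAddMonoidHom (p ^ k) : G →+ G).ker - if k = 0 then 0 else
          Nat.card (nsmulAddMonoidHom p : H →+ H).ker *
            Nat.card (nsmulAddMonoidHom (p ^ (k - 1)) : G →+ G).ker) := by
  classical
  have e : {f : H × ZMod (p ^ k) →+ G // Function.Injective f} ≃
      Σ g : {g : H →+ G // Function.Injective g},
        {x : (nsmulAddMonoidHom (p ^ k) : G →+ G).ker //
          k ≠ 0 → p ^ (k - 1) • (x : G) ∉ g.1.range} := by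
    refine ((homProdZModEquiv H G (p ^ k)).symm.subtypeEquiv (p := fun y => Function.Injective y.1 ∧
      (k ≠ 0 → p ^ (k - 1) • (y.2 : G) ∉ y.1.range)) (fun y =>
        (injective_homProdZModEquiv_symm hp k y.1 y.2).symm)).symm.trans ?_
    exact ⟨fun y => ⟨⟨y.1.1, y.2.1⟩, ⟨y.1.2, y.2.2⟩⟩, fun y => ⟨(y.1.1, y.2.1), y.1.2, y.2.2⟩,
      fun _ => rfl, fun _ => rfl⟩
  have hfin : Finite (H →+ G) := Finite.of_injective _ DFunLike.coe_injective
  have := Fintype.ofFinite {g : H →+ G // Function.Injective g}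
  rw [Nat.card_congr e, Nat.card_sigma, Nat.cast_sum, Nat.card_eq_fintype_card,
    ← Finset.card_univ, ← nsmul_eq_mul]
  refine Finset.sum_eq_card_nsmul fun g _ => ?_
  rcases Nat.eq_zero_or_pos k with rfl | hk
  · simp
  · obtain ⟨k, rfl⟩ : ∃ l, k = l + 1 := ⟨k - 1, by omega⟩
    have h1 := card_nsmul_mem_range k g.1 g.2 (hH (by omega))
    have h2 := Nat.card_congr (Equiv.sumCompl
      fun x : (nsmulAddMonoidHom (p ^ (k + 1)) : G →+ G).ker => p ^ k • (x : G) ∈ g.1.range)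
    rw [Nat.card_sum, h1] at h2
    simp only [Nat.succ_ne_zero, ne_eq, not_false_eq_true, forall_const, if_false,
      Nat.add_sub_cancel]
    rw [← h2]
    push_cast
    ring

theorem card_torsion_pi_zmod {p : ℕ} (hp : p.Prime) {n : ℕ} (lam : Fin n → ℕ) (k : ℕ) :
    Nat.card (nsmulAddMonoidHom (p ^ k) : (∀ i, ZMod (p ^ lam i)) →+ ∀ i, ZMod (p ^ lam i)).ker =
      p ^ ∑ j, min k (lam j) := by
  have e : (nsmulAddMonoidHom (p ^ k) : (∀ i, ZMod (p ^ lam i)) →+ ∀ i, ZMod (p ^ lam i)).ker ≃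
      ∀ i, (nsmulAddMonoidHom (p ^ k) : ZMod (p ^ lam i) →+ ZMod (p ^ lam i)).ker :=
    ⟨fun x i => ⟨x.1 i, congrFun x.2 i⟩, fun x => ⟨fun i => (x i).1, funext fun i => (x i).2⟩,
      fun _ => rfl, fun _ => rfl⟩
  have : ∀ i, NeZero (p ^ lam i) := fun i => ⟨pow_ne_zero _ hp.ne_zero⟩
  rw [Nat.card_congr e, Nat.card_pi, ← Finset.prod_pow_eq_pow_sum]
  refine Finset.prod_congr rfl fun i _ => ?_
  rw [IsAddCyclic.card_nsmulAddMonoidHom_ker, Nat.card_zmod]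
  rcases le_total k (lam i) with h | h
  · rw [min_eq_left h, Nat.gcd_eq_right (pow_dvd_pow p h)]
  · rw [min_eq_right h, Nat.gcd_eq_left (pow_dvd_pow p h)]

/-- Splitting off the last coordinate. -/
def snocAddEquiv {m : ℕ} (A : Fin (m + 1) → Type*) [∀ i, AddCommGroup (A i)] :
    ((∀ i : Fin m, A i.castSucc) × A (Fin.last m)) ≃+ ∀ i, A i where
  toEquiv := (Equiv.prodComm _ _).trans (Fin.snocEquiv A)
  map_add' x y := by
    funext i
    refine Fin.lastCases ?_ (fun i => ?_) i <;> simp [Fin.snocEquiv]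

/-- The cyclic factors are added in non-ascending order. When the `i`-th nontrivial one is added,
the earlier factors have exponent at least `mu i`; hence their `p`-torsion has order `p^i` and is
divisible by `p^(mu i - 1)`, as the inductive step requires. -/
theorem card_injective_pi_zmod {G : Type*} [AddCommGroup G] [Finite G] {p : ℕ} (hp : p.Prime)
    {m : ℕ} (mu : Fin m → ℕ) (hmu : Antitone mu) :
    (Nat.card {f : (∀ i, ZMod (p ^ mu i)) →+ G // Function.Injective f} : ℤ) =
      ∏ i : Fin m, ((Nat.card (nsmulAddMonoidHom (p ^ mu i) : G →+ G).ker : ℤ) -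
        if mu i = 0 then 0 else
          (p : ℤ) ^ (i : ℕ) * Nat.card (nsmulAddMonoidHom (p ^ (mu i - 1)) : G →+ G).ker) := by
  induction m with
  | zero =>
    rw [Fin.prod_univ_zero, Nat.cast_eq_one, Nat.card_eq_one_iff_unique]
    refine ⟨⟨fun f g => Subtype.ext (AddMonoidHom.ext fun x => ?_)⟩,
      ⟨⟨0, Function.injective_of_subsingleton _⟩⟩⟩
    rw [Subsingleton.elim x 0, map_zero, map_zero]
  | succ m ih =>
    have : ∀ i, NeZero (p ^ mu i) := fun i => ⟨pow_ne_zero _ hp.ne_zero⟩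
    have hanti : Antitone fun i : Fin m => mu i.castSucc :=
      fun i j hij => hmu (Fin.castSucc_le_castSucc_iff.2 hij)
    let E := snocAddEquiv fun i => ZMod (p ^ mu i)
    have e : {f : (∀ i, ZMod (p ^ mu i)) →+ G // Function.Injective f} ≃
        {f : (∀ i : Fin m, ZMod (p ^ mu i.castSucc)) × ZMod (p ^ mu (Fin.last m)) →+ G //
          Function.Injective f} :=
      (E.symm.addMonoidHomCongrLeft.toEquiv).subtypeEquiv fun f => by
        exact (E.toEquiv.injective_comp f).symm
    rw [Nat.card_congr e, card_injective_prod_zmod hp, Fin.prod_univ_castSucc, ih _ hanti]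
    · congr 2
      by_cases h0 : mu (Fin.last m) = 0
      · simp [h0]
      · have h1 := card_torsion_pi_zmod hp (fun i : Fin m => mu i.castSucc) 1
        rw [pow_one] at h1
        rw [if_neg h0, if_neg h0, h1, Finset.sum_congr rfl (g := fun _ => 1)]
        · simp
        · intro i _
          have := hmu (Fin.le_last i.castSucc)
          omega
    · intro h0 h hh
      have : ∀ i, ∃ a, p ^ (mu (Fin.last m) - 1) • a = h i := by
        intro i
        have hi : p • h i = 0 := congrFun hh i
        have hmi : mu (Fin.last m) ≤ mu i.castSucc := hmu (Fin.le_last i.castSucc)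
        obtain ⟨b, hb⟩ := ZMod.natCast_zmod_surjective (h i)
        rw [← hb, nsmul_eq_mul, ← Nat.cast_mul, ZMod.natCast_eq_zero_iff] at hi
        have h2 : p ^ (mu (Fin.last m) - 1) ∣ b := by
          have h3 : p * p ^ (mu (Fin.last m) - 1) ∣ p * b := by
            rw [← pow_succ']
            exact (pow_dvd_pow p (by omega)).trans hi
          exact Nat.dvd_of_mul_dvd_mul_left hp.pos h3
        obtain ⟨c, rfl⟩ := h2
        exact ⟨(c : ZMod _), by rw [← hb, nsmul_eq_mul, Nat.cast_mul]⟩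
      choose a ha using this
      exact ⟨a, funext ha⟩

/-- The number of entries of `lam` that are at least `k`. -/
def countGE {n : ℕ} (lam : Fin n → ℕ) (k : ℕ) : ℕ := (Finset.univ.filter fun j => k ≤ lam j).card

theorem sum_min_succ {n : ℕ} (lam : Fin n → ℕ) (k : ℕ) :
    ∑ j, min (k + 1) (lam j) = ∑ j, min k (lam j) + countGE lam (k + 1) := by
  rw [countGE, Finset.card_filter, ← Finset.sum_add_distrib]
  refine Finset.sum_congr rfl fun j _ => ?_
  split_ifs <;> omega

/-- An injective homomorphism is its image together with an isomorphism onto the image. These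
isomorphisms are as many as the automorphisms of the source, which are its injective endomorphisms
by finiteness. -/
theorem alpha_mul_card_injective {p : ℕ} (hp : p.Prime) {n : ℕ} (lam mu : Fin n → ℕ) :
    alpha lam mu p *
      Nat.card {f : (∀ i, ZMod (p ^ mu i)) →+ ∀ i, ZMod (p ^ mu i) // Function.Injective f} =
      Nat.card {f : (∀ i, ZMod (p ^ mu i)) →+ ∀ i, ZMod (p ^ lam i) // Function.Injective f} := by
  have : ∀ i, NeZero (p ^ mu i) := fun i => ⟨pow_ne_zero _ hp.ne_zero⟩
  have : ∀ i, NeZero (p ^ lam i) := fun i => ⟨pow_ne_zero _ hp.ne_zero⟩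
  have hfin1 : Finite ((∀ i, ZMod (p ^ mu i)) →+ ∀ i, ZMod (p ^ lam i)) :=
    Finite.of_injective _ DFunLike.coe_injective
  have hfin2 : Finite ((∀ i, ZMod (p ^ mu i)) →+ ∀ i, ZMod (p ^ mu i)) :=
    Finite.of_injective _ DFunLike.coe_injective
  let X := {K : AddSubgroup (∀ i, ZMod (p ^ lam i)) // Nonempty (K ≃+ ∀ i, ZMod (p ^ mu i))}
  have := Fintype.ofFinite X
  have e : {f : (∀ i, ZMod (p ^ mu i)) →+ ∀ i, ZMod (p ^ lam i) // Function.Injective f} ≃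
      Σ K : X, ((∀ i, ZMod (p ^ mu i)) ≃+ K.1) :=
    { toFun f := ⟨⟨f.1.range, ⟨(AddMonoidHom.ofInjective f.2).symm⟩⟩, AddMonoidHom.ofInjective f.2⟩
      invFun x := ⟨x.1.1.subtype.comp x.2.toAddMonoidHom,
        x.1.1.subtype_injective.comp x.2.injective⟩
      left_inv f := by ext; rfl
      right_inv x := by
        obtain ⟨⟨K, hK⟩, φ⟩ := x
        have h1 : (K.subtype.comp φ.toAddMonoidHom).range = K := by
          ext y
          constructor
          · rintro ⟨a, rfl⟩
            exact (φ a).2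
          · intro hy
            exact ⟨φ.symm ⟨y, hy⟩, by simp⟩
        refine Sigma.ext (Subtype.ext h1) ?_
        have h2 : ∀ (K' : AddSubgroup (∀ i, ZMod (p ^ lam i))) (h : K' = K)
            (ψ : (∀ i, ZMod (p ^ mu i)) ≃+ K'), (∀ x, (ψ x : ∀ i, ZMod (p ^ lam i)) = φ x) →
              HEq ψ φ := by
          rintro K' rfl ψ h
          exact heq_of_eq (AddEquiv.ext fun x => Subtype.ext (h x))
        exact h2 _ h1 _ fun x => rfl }
  have e2 : ∀ K : X, Nat.card ((∀ i, ZMod (p ^ mu i)) ≃+ K.1) =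
      Nat.card {f : (∀ i, ZMod (p ^ mu i)) →+ ∀ i, ZMod (p ^ mu i) // Function.Injective f} := by
    rintro ⟨K, ⟨ψ⟩⟩
    refine Nat.card_congr
      { toFun φ := ⟨(φ.trans ψ).toAddMonoidHom, (φ.trans ψ).injective⟩
        invFun f := (AddEquiv.ofBijective f.1 (Finite.injective_iff_bijective.1 f.2)).trans ψ.symm
        left_inv φ := by ext; simp
        right_inv f := by ext; simp }
  have hfin3 : ∀ K : X, Finite ((∀ i, ZMod (p ^ mu i)) ≃+ K.1) := fun K =>
    Finite.of_injective (fun φ : (∀ i, ZMod (p ^ mu i)) ≃+ K.1 => (φ : _ → K.1))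
      DFunLike.coe_injective
  rw [Nat.card_congr e, Nat.card_sigma, Finset.sum_congr rfl fun K _ => e2 K, Finset.sum_const,
    Finset.card_univ, ← Nat.card_eq_fintype_card, smul_eq_mul]
  rfl

/-- Going from `p^(k-1)`-torsion to `p^k`-torsion multiplies the order by `p` for each part at least
`k`, so the torsion order factors out. -/
theorem injective_factor_eq {p : ℕ} (hp : p.Prime) {n : ℕ} (lam : Fin n → ℕ) (k i : ℕ) :
    (((Nat.card (nsmulAddMonoidHom (p ^ k) :
        (∀ i, ZMod (p ^ lam i)) →+ ∀ i, ZMod (p ^ lam i)).ker : ℤ) -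
        if k = 0 then 0 else (p : ℤ) ^ i * Nat.card (nsmulAddMonoidHom (p ^ (k - 1)) :
        (∀ i, ZMod (p ^ lam i)) →+ ∀ i, ZMod (p ^ lam i)).ker : ℤ) : ℚ) =
      (p : ℚ) ^ (∑ j, min k (lam j)) *
        if k = 0 then 1 else (1 - (p : ℚ) ^ i * ((p : ℚ)⁻¹) ^ countGE lam k) := by
  have hp0 : (p : ℚ) ≠ 0 := by exact_mod_cast hp.ne_zero
  rw [card_torsion_pi_zmod hp, card_torsion_pi_zmod hp]
  rcases k with _ | k
  · simp
  · rw [sum_min_succ, if_neg (by omega), if_neg (by omega), Nat.add_sub_cancel]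
    push_cast
    rw [pow_add, inv_pow]
    field_simp

theorem le_countGE {n : ℕ} {lam mu : Fin n → ℕ} (hmu : Antitone mu) (hle : mu ≤ lam) (i : Fin n) :
    (i : ℕ) < countGE lam (mu i) := by
  have : Finset.Iic i ⊆ Finset.univ.filter fun j => mu i ≤ lam j := fun j hj => by
    simp only [Finset.mem_filter, Finset.mem_univ, true_and]
    exact (hmu (Finset.mem_Iic.1 hj)).trans (hle j)
  have h := Finset.card_le_card this
  rw [Fin.card_Iic] at h
  exact h

theorem card_injective_pi_zmod_pi_zmod {p : ℕ} (hp : p.Prime) {n : ℕ} (lam mu : Fin n → ℕ)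
    (hmu : Antitone mu) :
    (Nat.card {f : (∀ i, ZMod (p ^ mu i)) →+ ∀ i, ZMod (p ^ lam i) // Function.Injective f} : ℚ) =
      ∏ i : Fin n, ((p : ℚ) ^ (∑ j, min (mu i) (lam j)) *
        if mu i = 0 then 1 else (1 - (p : ℚ) ^ (i : ℕ) * ((p : ℚ)⁻¹) ^ countGE lam (mu i))) := by
  have : ∀ i, NeZero (p ^ lam i) := fun i => ⟨pow_ne_zero _ hp.ne_zero⟩
  have h := congrArg (Int.cast : ℤ → ℚ)
    (card_injective_pi_zmod (G := ∀ i, ZMod (p ^ lam i)) hp mu hmu)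
  rw [Int.cast_prod] at h
  rw [Int.cast_natCast] at h
  rw [h]
  exact Finset.prod_congr rfl fun i _ => injective_factor_eq hp lam (mu i) i

theorem one_sub_inv_pow_ne_zero {p : ℕ} (hp : p.Prime) {k : ℕ} (hk : 0 < k) :
    (1 - ((p : ℚ)⁻¹) ^ k) ≠ 0 := by
  have h1 : (p : ℚ)⁻¹ < 1 := inv_lt_one_of_one_lt₀ (by exact_mod_cast hp.one_lt)
  have h2 : ((p : ℚ)⁻¹) ^ k < 1 := pow_lt_one₀ (by positivity) h1 hk.ne'
  exact (sub_pos.2 h2).ne'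

/-- The number of subgroups of type `mu` in a group of type `lam`, as a product over the parts. -/
theorem alpha_eq {p : ℕ} (hp : p.Prime) {n : ℕ} {lam mu : Fin n → ℕ} (hmu : Antitone mu)
    (hle : mu ≤ lam) :
    (alpha lam mu p : ℚ) = ∏ i : Fin n,
      ((p : ℚ) ^ (∑ j, (min (mu i) (lam j) - min (mu i) (mu j))) *
        ((1 - ((p : ℚ)⁻¹) ^ (countGE lam (mu i) - i)) /
          (1 - ((p : ℚ)⁻¹) ^ (countGE mu (mu i) - i)))) := by
  have hp0 : (p : ℚ) ≠ 0 := by exact_mod_cast hp.ne_zero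
  -- The truncated exponent `countGE nu (mu i) - i` is a true difference, by `le_countGE`.
  have key : ∀ (nu : Fin n → ℕ), mu ≤ nu → ∀ i : Fin n,
      (1 - (p : ℚ) ^ (i : ℕ) * ((p : ℚ)⁻¹) ^ countGE nu (mu i)) =
        1 - ((p : ℚ)⁻¹) ^ (countGE nu (mu i) - i) := by
    intro nu hnu i
    have h := le_countGE hmu hnu i
    obtain ⟨c, hc⟩ : ∃ c, countGE nu (mu i) = i + c := ⟨countGE nu (mu i) - i, by omega⟩
    rw [hc, Nat.add_sub_cancel_left, pow_add, ← mul_assoc, ← mul_pow, mul_inv_cancel₀ hp0, one_pow,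
      one_mul]
  have h := congrArg (Nat.cast : ℕ → ℚ) (alpha_mul_card_injective hp lam mu)
  rw [Nat.cast_mul, card_injective_pi_zmod_pi_zmod hp lam mu hmu,
    card_injective_pi_zmod_pi_zmod hp mu mu hmu] at h
  simp only [key lam hle, key mu le_rfl] at h
  have hne : ∏ i : Fin n, ((p : ℚ) ^ (∑ j, min (mu i) (mu j)) *
      if mu i = 0 then 1 else (1 - ((p : ℚ)⁻¹) ^ (countGE mu (mu i) - i))) ≠ 0 := by
    refine Finset.prod_ne_zero_iff.2 fun i _ => mul_ne_zero (pow_ne_zero _ hp0) ?_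
    split_ifs
    · exact one_ne_zero
    · exact one_sub_inv_pow_ne_zero hp (Nat.sub_pos_of_lt (le_countGE hmu le_rfl i))
  rw [← mul_left_inj' hne, h, ← Finset.prod_mul_distrib]
  refine Finset.prod_congr rfl fun i _ => ?_
  have hs : ∑ j, min (mu i) (lam j) =
      ∑ j, (min (mu i) (lam j) - min (mu i) (mu j)) + ∑ j, min (mu i) (mu j) := by
    rw [← Finset.sum_add_distrib]
    refine Finset.sum_congr rfl fun j _ => ?_
    have : mu j ≤ lam j := hle j
    omega
  have h3 := one_sub_inv_pow_ne_zero hp (Nat.sub_pos_of_lt (le_countGE hmu le_rfl i))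
  rw [hs, pow_add]
  split_ifs with h0
  -- For a zero part both counts equal `n`, so its quotient is `1`, as is its factor in the count of
  -- injections.
  · have : countGE lam (mu i) = countGE mu (mu i) := by simp [countGE, h0]
    rw [this, div_self h3]
    ring
  · linear_combination (-((p : ℚ) ^ (∑ j, (min (mu i) (lam j) - min (mu i) (mu j))) *
      (p : ℚ) ^ (∑ j, min (mu i) (mu j)))) *
        div_mul_cancel₀ (1 - ((p : ℚ)⁻¹) ^ (countGE lam (mu i) - i)) h3

/-- The product formula for injective homomorphisms does not need `mu ≤ lam`. If the inequality
fails, then at the first bad index `i` exactly `i` parts of `lam` are at least `mu i`, and the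
factor `1 - p^i p^{-i}` vanishes. -/
theorem le_of_alpha_ne_zero {p : ℕ} (hp : p.Prime) {n : ℕ} {lam mu : Fin n → ℕ}
    (hmu : Antitone mu) (hlam : Antitone lam) (h : alpha lam mu p ≠ 0) : mu ≤ lam := by
  have hp1 : (1 : ℚ) < p := by exact_mod_cast hp.one_lt
  have hp0 : (p : ℚ) ≠ 0 := by positivity
  have : ∀ i, NeZero (p ^ mu i) := fun i => ⟨pow_ne_zero _ hp.ne_zero⟩
  have hfin : Finite ((∀ i, ZMod (p ^ mu i)) →+ ∀ i, ZMod (p ^ mu i)) :=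
    Finite.of_injective _ DFunLike.coe_injective
  have hself : Nat.card {f : (∀ i, ZMod (p ^ mu i)) →+ ∀ i, ZMod (p ^ mu i) //
      Function.Injective f} ≠ 0 :=
    Nat.card_ne_zero.2 ⟨⟨AddMonoidHom.id _, Function.injective_id⟩, inferInstance⟩
  have h1 := mul_ne_zero h hself
  rw [alpha_mul_card_injective hp] at h1
  have h2 : (Nat.card {f : (∀ i, ZMod (p ^ mu i)) →+ ∀ i, ZMod (p ^ lam i) //
      Function.Injective f} : ℚ) ≠ 0 := by exact_mod_cast h1
  rw [card_injective_pi_zmod_pi_zmod hp lam mu hmu] at h2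
  have h3 := Finset.prod_ne_zero_iff.1 h2
  by_contra hcon
  have hex : ∃ i : ℕ, ∃ hi : i < n, mu ⟨i, hi⟩ ≠ 0 ∧ countGE lam (mu ⟨i, hi⟩) ≤ i := by
    rw [Pi.le_def, not_forall] at hcon
    obtain ⟨i, hi⟩ := hcon
    rw [not_le] at hi
    refine ⟨i, i.2, (by simp only [Fin.eta]; omega), ?_⟩
    have : Finset.univ.filter (fun j => mu i ≤ lam j) ⊆ Finset.Iio i := fun j hj => by
      simp only [Finset.mem_filter, Finset.mem_univ, true_and] at hj
      rw [Finset.mem_Iio]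
      by_contra hji
      have := hlam (not_lt.1 hji)
      omega
    have h4 := Finset.card_le_card this
    rw [Fin.card_Iio] at h4
    exact h4
  classical
  obtain ⟨i, ⟨hi, h0, hc⟩, hmin⟩ : ∃ i : ℕ,
      (∃ hi : i < n, mu ⟨i, hi⟩ ≠ 0 ∧ countGE lam (mu ⟨i, hi⟩) ≤ i) ∧
        ∀ j < i, ∀ hj : j < n, mu ⟨j, hj⟩ ≠ 0 → j < countGE lam (mu ⟨j, hj⟩) :=
    ⟨Nat.find hex, Nat.find_spec hex, fun j hj hjn h0 => by
      by_contra hc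
      exact Nat.find_min hex hj ⟨hjn, h0, not_lt.1 hc⟩⟩
  -- Index `i - 1` is not bad and `mu (i - 1) ≥ mu i`, so at least `i` parts of `lam` reach `mu i`.
  have heq : countGE lam (mu ⟨i, hi⟩) = i := by
    refine le_antisymm hc ?_
    rcases Nat.eq_zero_or_pos i with h | hpos
    · omega
    · have hmono : mu ⟨i, hi⟩ ≤ mu ⟨i - 1, by omega⟩ := hmu (by simp)
      have h5 := hmin (i - 1) (by omega) (by omega) (by omega)
      have h6 : countGE lam (mu ⟨i - 1, by omega⟩) ≤ countGE lam (mu ⟨i, hi⟩) := by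
        refine Finset.card_le_card fun j hj => ?_
        simp only [Finset.mem_filter, Finset.mem_univ, true_and] at hj ⊢
        omega
      omega
  have h7 := h3 ⟨i, hi⟩ (Finset.mem_univ _)
  rw [if_neg h0, heq, ← mul_pow, mul_inv_cancel₀ hp0, one_pow] at h7
  simp at h7

end HeisenbergZeta
end

noncomputable section
namespace HeisenbergZeta

/-! ### Rearrangements -/

/-- The values `f 0, f 1, …` are chosen in turn. As `mu` is antitone, the earlier values all lie in
the set allowed for `f i`, so exactly `i` of its `countGE lam (mu i)` elements are taken. -/
theorem card_injective_le {n m : ℕ} (lam : Fin n → ℕ) (mu : Fin m → ℕ) (hmu : Antitone mu) :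
    Nat.card {f : Fin m → Fin n // Function.Injective f ∧ ∀ i, mu i ≤ lam (f i)} =
      ∏ i : Fin m, (countGE lam (mu i) - i) := by
  induction m with
  | zero =>
    rw [Fin.prod_univ_zero, Nat.card_eq_one_iff_unique]
    exact ⟨⟨fun f g => Subtype.ext (Subsingleton.elim _ _)⟩,
      ⟨⟨Fin.elim0, Function.injective_of_subsingleton _, fun i => i.elim0⟩⟩⟩
  | succ m ih =>
    have hanti : Antitone fun i : Fin m => mu i.castSucc :=
      fun i j hij => hmu (Fin.castSucc_le_castSucc_iff.2 hij)
    let A := {f : Fin m → Fin n // Function.Injective f ∧ ∀ i, mu i.castSucc ≤ lam (f i)}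
    have e1 : {f : Fin (m + 1) → Fin n // Function.Injective f ∧ ∀ i, mu i ≤ lam (f i)} ≃
        {y : Fin n × (Fin m → Fin n) // (Function.Injective y.2 ∧
          ∀ i, mu i.castSucc ≤ lam (y.2 i)) ∧ mu (Fin.last m) ≤ lam y.1 ∧ y.1 ∉ Set.range y.2} := by
      refine ((Fin.snocEquiv fun _ => Fin n).subtypeEquiv fun y => ?_).symm
      change _ ↔ Function.Injective (Fin.snoc (α := fun _ => Fin n) y.2 y.1) ∧
        ∀ i, mu i ≤ lam (Fin.snoc (α := fun _ => Fin n) y.2 y.1 i)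
      rw [Fin.snoc_injective_iff, Fin.forall_fin_succ']
      simp only [Fin.snoc_castSucc, Fin.snoc_last]
      tauto
    have e2 : {y : Fin n × (Fin m → Fin n) // (Function.Injective y.2 ∧
          ∀ i, mu i.castSucc ≤ lam (y.2 i)) ∧ mu (Fin.last m) ≤ lam y.1 ∧ y.1 ∉ Set.range y.2} ≃
        Σ g : A, {x : Fin n // mu (Fin.last m) ≤ lam x ∧ x ∉ Set.range g.1} :=
      ⟨fun y => ⟨⟨y.1.2, y.2.1⟩, ⟨y.1.1, y.2.2⟩⟩, fun y => ⟨(y.2.1, y.1.1), y.1.2, y.2.2⟩,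
        fun _ => rfl, fun _ => rfl⟩
    have := Fintype.ofFinite A
    rw [Nat.card_congr (e1.trans e2), Nat.card_sigma, Fin.prod_univ_castSucc]
    have h2 := ih _ hanti
    simp only [Fin.val_castSucc, Fin.val_last]
    rw [← h2, Nat.card_eq_fintype_card, ← Finset.card_univ, ← smul_eq_mul]
    refine Finset.sum_eq_card_nsmul fun g _ => ?_
    have h3 : Nat.card {x : Fin n // mu (Fin.last m) ≤ lam x ∧ x ∉ Set.range g.1} =
        ((Finset.univ.filter fun x => mu (Fin.last m) ≤ lam x) \
          Finset.univ.image g.1).card := by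
      rw [Nat.subtype_card]
      intro x
      simp
    rw [h3, Finset.card_sdiff_of_subset, Finset.card_image_of_injective _ g.2.1, Finset.card_univ,
      Fintype.card_fin]
    · rfl
    · intro x hx
      obtain ⟨i, -, rfl⟩ := Finset.mem_image.1 hx
      simp only [Finset.mem_filter, Finset.mem_univ, true_and]
      exact (hmu (Fin.le_last _)).trans (g.2.2 i)

theorem antitone_sortDesc {n : ℕ} (l : Fin n → ℕ) : Antitone (sortDesc l) := fun _ _ hij =>
  Tuple.monotone_sort l (Fin.rev_le_rev.2 hij)

theorem sortDesc_eq_comp {n : ℕ} (l : Fin n → ℕ) :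
    sortDesc l = l ∘ (Fin.revPerm.trans (Tuple.sort l)) := rfl

theorem exists_eq_sortDesc_comp {n : ℕ} (l : Fin n → ℕ) :
    ∃ σ : Equiv.Perm (Fin n), l = sortDesc l ∘ σ :=
  ⟨(Fin.revPerm.trans (Tuple.sort l)).symm, by
    rw [sortDesc_eq_comp, Function.comp_assoc, ← Equiv.coe_trans, Equiv.symm_trans_self]
    rfl⟩

theorem sortDesc_comp_perm {n : ℕ} {lam : Fin n → ℕ} (hlam : Antitone lam)
    (σ : Equiv.Perm (Fin n)) : sortDesc (lam ∘ σ) = lam := by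
  have h1 := antitone_sortDesc (lam ∘ σ)
  rw [sortDesc_eq_comp, Function.comp_assoc, ← Equiv.coe_trans] at h1 ⊢
  exact Tuple.unique_antitone (τ := Equiv.refl _) h1 hlam

/-- The number of rearrangements of a partition. -/
theorem card_sortDesc_eq {n : ℕ} {lam : Fin n → ℕ} (hlam : Antitone lam) :
    Nat.card {l : Fin n → ℕ // sortDesc l = lam} * ∏ i : Fin n, (countGE lam (lam i) - i) =
      ∏ i : Fin n, (n - i) := by
  have h0 := card_injective_le lam lam hlam
  have h1 := card_injective_le lam (fun _ : Fin n => 0) antitone_const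
  have h2 : countGE lam 0 = n := by simp [countGE]
  rw [h2] at h1
  rw [← h0, ← h1]
  -- A permutation that nowhere lowers `lam` preserves it, since the total is unchanged. Thus `h0`
  -- counts the stabilizer of `lam`, while `h1` counts all permutations.
  have hle : ∀ f : Fin n → Fin n, Function.Injective f → (∀ i, lam i ≤ lam (f i)) →
      lam ∘ f = lam := by
    intro f hf hl
    have hs : ∑ i, lam i = ∑ i, lam (f i) :=
      (Function.Bijective.sum_comp (Finite.injective_iff_bijective.1 hf) lam).symm
    exact funext fun i => (((Finset.sum_eq_sum_iff_of_le fun i _ => hl i).1 hs) i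
      (Finset.mem_univ i)).symm
  have hσ : ∀ l : {l : Fin n → ℕ // sortDesc l = lam}, ∃ σ : Equiv.Perm (Fin n),
      l.1 = lam ∘ σ := fun ⟨l, hl⟩ => by
    subst hl
    exact exists_eq_sortDesc_comp l
  choose s hs using hσ
  rw [← Nat.card_prod]
  -- Orbit-stabilizer: with a permutation `s l` chosen for each rearrangement `l`, every permutation
  -- is uniquely an element of the stabilizer composed with some `s l`.
  refine Nat.card_congr
    { toFun x := ⟨x.2.1 ∘ s x.1, x.2.2.1.comp (s x.1).injective, fun i => Nat.zero_le _⟩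
      invFun f :=
        let σ := Equiv.ofBijective f.1 (Finite.injective_iff_bijective.1 f.2.1)
        let l : {l : Fin n → ℕ // sortDesc l = lam} := ⟨lam ∘ σ, sortDesc_comp_perm hlam _⟩
        (l, ⟨f.1 ∘ (s l).symm, f.2.1.comp (s l).symm.injective, fun i => by
          have h := congrFun (hs l) ((s l).symm i)
          simp only [Function.comp_apply, Equiv.apply_symm_apply] at h
          exact h.symm.le⟩)
      left_inv x := ?_
      right_inv f := ?_ }
  · obtain ⟨l, f, hf1, hf2⟩ := x
    have e : (⟨lam ∘ (f ∘ s l), sortDesc_comp_perm hlam (Equiv.ofBijective (f ∘ s l)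
        (Finite.injective_iff_bijective.1 (hf1.comp (s l).injective)))⟩ :
        {l : Fin n → ℕ // sortDesc l = lam}) = l := by
      refine Subtype.ext ?_
      change (lam ∘ f) ∘ s l = l.1
      rw [hs l, hle f hf1 hf2]
    refine Prod.ext e (Subtype.ext ?_)
    change (f ∘ s l) ∘ (s (⟨lam ∘ (f ∘ s l), _⟩ : {l : Fin n → ℕ // sortDesc l = lam})).symm = f
    rw [e]
    funext i
    simp
  · refine Subtype.ext ?_
    funext i
    simp

end HeisenbergZeta
end

noncomputable section
namespace HeisenbergZeta

/-! ### Summation lemmas -/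

/-- Grouping terms is harmless in one direction only for general series; here the terms are constant
on finite fibres, so the norms can be grouped as well and summability passes both ways. -/
theorem hasSum_sigma_const_iff {X : Type*} {κ : X → Type*} [∀ x, Finite (κ x)] (a : X → ℂ)
    (S : ℂ) : HasSum (fun y : Σ x, κ x => a y.1) S ↔
      HasSum (fun x => (Nat.card (κ x) : ℂ) * a x) S := by
  have hfib : ∀ x, HasSum (fun _ : κ x => a x) ((Nat.card (κ x) : ℂ) * a x) := fun x => by
    have := Fintype.ofFinite (κ x)
    have h := hasSum_fintype fun _ : κ x => a x
    rwa [Finset.sum_const, nsmul_eq_mul, Finset.card_univ, ← Nat.card_eq_fintype_card] at h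
  have hsum : Summable (fun y : Σ x, κ x => a y.1) ↔
      Summable (fun x => (Nat.card (κ x) : ℂ) * a x) := by
    rw [← summable_norm_iff, summable_sigma_of_nonneg fun _ => norm_nonneg _,
      ← summable_norm_iff (f := fun x => (Nat.card (κ x) : ℂ) * a x)]
    have h1 : ∀ x, HasSum (fun _ : κ x => ‖a x‖) ‖(Nat.card (κ x) : ℂ) * a x‖ := fun x => by
      have := Fintype.ofFinite (κ x)
      have h := hasSum_fintype fun _ : κ x => ‖a x‖
      rwa [Finset.sum_const, nsmul_eq_mul, Finset.card_univ, ← Nat.card_eq_fintype_card,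
        ← Complex.norm_natCast, ← norm_mul] at h
    have h2 : (fun x => ∑' _ : κ x, ‖a x‖) = fun x => ‖(Nat.card (κ x) : ℂ) * a x‖ :=
      funext fun x => (h1 x).tsum_eq
    rw [← h2]
    exact ⟨fun h => h.2, fun h => ⟨fun x => (h1 x).summable, h⟩⟩
  constructor
  · intro h
    exact h.sigma hfib
  · intro h
    have h1 := (hsum.2 h.summable).hasSum
    rwa [(h1.sigma hfib).unique h] at h1

theorem HasSum.mul_complex {X Y : Type*} {f : X → ℂ} {g : Y → ℂ} {a b : ℂ} (hf : HasSum f a)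
    (hg : HasSum g b) : HasSum (fun x : X × Y => f x.1 * g x.2) (a * b) :=
  hf.mul hg (summable_mul_of_summable_norm hf.summable.norm hg.summable.norm)

theorem hasSum_pi_prod {r : ℕ} {κ : Fin r → Type*} {f : ∀ i, κ i → ℂ} {a : Fin r → ℂ}
    (hf : ∀ i, HasSum (f i) (a i)) :
    HasSum (fun m : ∀ i, κ i => ∏ i, f i (m i)) (∏ i, a i) := by
  induction r with
  | zero => simp
  | succ r ih =>
    rw [Fin.prod_univ_succ, ← (Fin.consEquiv κ).hasSum_iff]
    convert HasSum.mul_complex (hf 0) (ih fun i => hf i.succ) using 2 with m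
    simp [Fin.prod_univ_succ, Fin.consEquiv]

theorem hasSum_geometric_pos {x : ℂ} (hx : ‖x‖ < 1) :
    HasSum (fun k : ℕ => if k = 0 then 0 else x ^ k) (x / (1 - x)) := by
  have h := (hasSum_geometric_of_norm_lt_one hx).mul_left x
  rw [← div_eq_mul_inv] at h
  rw [← hasSum_nat_add_iff' 1]
  simpa [pow_succ'] using h

/-- The weight `ε` of the zeroth term treats both Igusa functions at once: `ε = 1` gives the
prefactor of `igusa` and `ε = 0` that of `igusaCirc`. -/
theorem hasSum_geometric_weighted {x : ℂ} (hx : ‖x‖ < 1) (ε : ℂ) :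
    HasSum (fun k : ℕ => (if k = 0 then ε else 1) * x ^ k) (ε + x / (1 - x)) := by
  convert (hasSum_ite_eq (0 : ℕ) ε).add (hasSum_geometric_pos hx) using 2 with k
  split_ifs with h <;> simp [h]

/-! ### Igusa functions as sums over multiplicities -/

/-- The product `φ(1) ⋯ φ(a)`. -/
def genFactorial (φ : ℕ → ℂ) (a : ℕ) : ℂ := ∏ i ∈ Finset.range a, φ (i + 1)

theorem genFactorial_ne_zero {φ : ℕ → ℂ} (hφ : ∀ k, 0 < k → φ k ≠ 0) (a : ℕ) :
    genFactorial φ a ≠ 0 :=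
  Finset.prod_ne_zero_iff.2 fun i _ => hφ _ i.succ_pos

/-- `Y` is a value at which the Gaussian binomials are quotients of the factorials of `φ`. -/
structure IsGaussValue (Y : ℂ) (φ : ℕ → ℂ) : Prop where
  ne_zero : ∀ k, 0 < k → φ k ≠ 0
  binom : ∀ a b, b ≤ a → Polynomial.aeval Y (gaussBinom a b) *
    (genFactorial φ b * genFactorial φ (a - b)) = genFactorial φ a

theorem aeval_one_gaussBinom (a b : ℕ) :
    Polynomial.aeval (1 : ℂ) (gaussBinom a b) = (a.choose b : ℂ) := by
  induction a generalizing b with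
  | zero =>
    cases b with
    | zero => simp [gaussBinom]
    | succ b => simp [gaussBinom]
  | succ a ih =>
    cases b with
    | zero => simp [gaussBinom]
    | succ b => simp [gaussBinom, ih, Nat.choose_succ_succ]

theorem genFactorial_natCast (a : ℕ) : genFactorial (fun k => (k : ℂ)) a = (a.factorial : ℂ) := by
  rw [genFactorial, ← Finset.prod_range_add_one_eq_factorial]
  push_cast
  rfl

/-- The limiting case of ordinary factorials, used for the up-runs, where rearrangements rather than
subgroups are counted. -/
theorem isGaussValue_one : IsGaussValue 1 fun k => (k : ℂ) where
  ne_zero k hk := by exact_mod_cast hk.ne'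
  binom a b h := by
    rw [aeval_one_gaussBinom, genFactorial_natCast, genFactorial_natCast, genFactorial_natCast,
      ← mul_assoc]
    exact_mod_cast Nat.choose_mul_factorial_mul_factorial h

theorem isGaussValue_of_pow_ne_one {Y : ℂ} (hY : ∀ k, 0 < k → Y ^ k ≠ 1) :
    IsGaussValue Y fun k => 1 - Y ^ k where
  ne_zero k hk := sub_ne_zero.2 (hY k hk).symm
  binom a b h := by
    have h1 := congrArg (Polynomial.aeval Y) (gaussBinom_mul a b h)
    simp only [map_mul, map_prod, map_sub, map_one, map_pow, Polynomial.aeval_X] at h1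
    have h2 : ∀ a, genFactorial (fun k => 1 - Y ^ k) a = ∏ i ∈ Finset.Icc 1 a, (1 - Y ^ i) := by
      intro a
      rw [genFactorial, Finset.range_eq_Ico, Finset.prod_Ico_add' (fun i => 1 - Y ^ i) 0 a 1]
      rfl
    rw [h2, h2, h2, ← mul_assoc, h1]
    have h3 : Finset.Icc 1 a = Finset.Icc (a - b + 1) a ∪ Finset.Icc 1 (a - b) := by
      ext x
      simp only [Finset.mem_Icc, Finset.mem_union]
      omega
    rw [h3, Finset.prod_union]
    rw [Finset.disjoint_left]
    intro x hx hx'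
    simp only [Finset.mem_Icc] at hx hx'
    omega

/-- The first element after `i` of a strictly decreasing list bounded by `a`, or `a`. -/
def listNext : ℕ → List ℕ → ℕ → ℕ
  | a, [], _ => a
  | a, b :: l, i => if i < b then listNext b l i else a

theorem isLeast_listNext {a : ℕ} {l : List ℕ} (hl : (a :: l).SortedGT) {i : ℕ} (hi : i < a) :
    IsLeast {j | i < j ∧ (a ≤ j ∨ j ∈ l)} (listNext a l i) := by
  induction l generalizing a with
  | nil => exact ⟨⟨hi, Or.inl le_rfl⟩, fun j hj => by simpa [listNext] using hj.2⟩
  | cons b l ih =>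
    have hp := List.pairwise_cons.1 hl.pairwise
    have hab : b < a := hp.1 b (by simp)
    have hl' : (b :: l).SortedGT := hp.2.sortedGT
    rw [listNext]
    split_ifs with hib
    · have h := ih hl' hib
      refine ⟨⟨h.1.1, ?_⟩, fun j hj => h.2 ⟨hj.1, ?_⟩⟩
      · rcases h.1.2 with h1 | h1
        · have h2 : listNext b l i ≤ b := h.2 ⟨hib, Or.inl le_rfl⟩
          right
          rw [le_antisymm h2 h1]
          simp
        · exact Or.inr (List.mem_cons_of_mem _ h1)
      · rcases hj.2 with h1 | h1
        · exact Or.inl (hab.le.trans h1)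
        · rcases List.mem_cons.1 h1 with rfl | h1
          · exact Or.inl le_rfl
          · exact Or.inr h1
    · refine ⟨⟨hi, Or.inl le_rfl⟩, fun j hj => ?_⟩
      rcases hj.2 with h1 | h1
      · exact h1
      · exfalso
        have h3 : j ≤ b := by
          rcases List.mem_cons.1 h1 with rfl | h1
          · exact le_rfl
          · exact ((List.pairwise_cons.1 hl'.pairwise).1 j h1).le
        have := hj.1
        omega

/-- The indices from one list entry up to the next contribute the factorial of the gap length. The
chain of binomials is the full factorial divided by the factorials of the gaps. -/
theorem aeval_chainProd_gaussBinom {Y : ℂ} {φ : ℕ → ℂ} (h : IsGaussValue Y φ) {a : ℕ}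
    {l : List ℕ} (hl : (a :: l).SortedGT) :
    Polynomial.aeval Y (chainProd gaussBinom a l) *
      ∏ i ∈ Finset.range a, φ (listNext a l i - i) = genFactorial φ a := by
  induction l generalizing a with
  | nil =>
    simp only [chainProd, map_one, listNext, one_mul, genFactorial]
    rw [← Finset.prod_range_reflect]
    refine Finset.prod_congr rfl fun i hi => ?_
    rw [Finset.mem_range] at hi
    congr 1
    omega
  | cons b l ih =>
    have hp := List.pairwise_cons.1 hl.pairwise
    have hab : b < a := hp.1 b (by simp)
    have hl' : (b :: l).SortedGT := hp.2.sortedGT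
    have h1 : ∏ i ∈ Finset.range a, φ (listNext a (b :: l) i - i) =
        (∏ i ∈ Finset.range b, φ (listNext b l i - i)) * genFactorial φ (a - b) := by
      rw [← Finset.prod_range_mul_prod_Ico _ hab.le, genFactorial, Finset.prod_Ico_eq_prod_range,
        ← Finset.prod_range_reflect (fun i => φ (i + 1))]
      congr 1
      · refine Finset.prod_congr rfl fun i hi => ?_
        rw [Finset.mem_range] at hi
        rw [listNext, if_pos hi]
      · refine Finset.prod_congr rfl fun i hi => ?_
        rw [Finset.mem_range] at hi
        rw [listNext, if_neg (by omega)]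
        congr 1
        omega
    rw [h1, chainProd, map_mul, ← h.binom a b hab.le, ← ih hl']
    ring

/-- For `i < h`, the least `j > i` that is at least `h` or the (1-based) index of a nonzero
entry of `m`. -/
def nextStep {h : ℕ} (m : Fin h → ℕ) (i : ℕ) : ℕ :=
  sInf {j | i < j ∧ (h ≤ j ∨ ∃ k : Fin h, (k : ℕ) + 1 = j ∧ m k ≠ 0)}

theorem isLeast_nextStep {h : ℕ} (m : Fin h → ℕ) (i : ℕ) :
    IsLeast {j | i < j ∧ (h ≤ j ∨ ∃ k : Fin h, (k : ℕ) + 1 = j ∧ m k ≠ 0)} (nextStep m i) := by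
  have : {j | i < j ∧ (h ≤ j ∨ ∃ k : Fin h, (k : ℕ) + 1 = j ∧ m k ≠ 0)}.Nonempty :=
    ⟨h + i + 1, by omega, Or.inl (by omega)⟩
  exact ⟨Nat.sInf_mem this, fun j hj => Nat.sInf_le hj⟩

/-- The (1-based) indices of the nonzero entries of `m`, except the last index. -/
def innerSupport {h : ℕ} (m : Fin (h + 1) → ℕ) : Finset ℕ :=
  (Finset.Icc 1 h).filter fun j => ∃ k : Fin (h + 1), (k : ℕ) + 1 = j ∧ m k ≠ 0

theorem sortedGT_cons_sort {h : ℕ} {I : Finset ℕ} (hI : I ⊆ Finset.Icc 1 h) :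
    ((h + 1) :: I.sort (· ≥ ·)).SortedGT := by
  refine List.Pairwise.sortedGT (List.pairwise_cons.2 ⟨fun j hj => ?_, (Finset.sortedGT_sort I).pairwise⟩)
  have := Finset.mem_Icc.1 (hI ((Finset.mem_sort _).1 hj))
  omega

theorem listNext_innerSupport {h : ℕ} (m : Fin (h + 1) → ℕ) {i : ℕ} (hi : i < h + 1) :
    listNext (h + 1) ((innerSupport m).sort (· ≥ ·)) i = nextStep m i := by
  have hs : innerSupport m ⊆ Finset.Icc 1 h := Finset.filter_subset _ _
  refine (isLeast_listNext (sortedGT_cons_sort hs) hi).unique ?_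
  have key : {j | i < j ∧ (h + 1 ≤ j ∨ j ∈ (innerSupport m).sort (· ≥ ·))} =
      {j | i < j ∧ (h + 1 ≤ j ∨ ∃ k : Fin (h + 1), (k : ℕ) + 1 = j ∧ m k ≠ 0)} := by
    refine Set.ext fun j => ?_
    change (_ ∧ (_ ∨ _)) ↔ (_ ∧ (_ ∨ _))
    rw [Finset.mem_sort, innerSupport, Finset.mem_filter, Finset.mem_Icc]
    refine and_congr_right fun hij => or_congr_right' fun hj => ?_
    constructor
    · exact fun h => h.2
    · exact fun h => ⟨by omega, h⟩
  rw [key]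
  exact isLeast_nextStep m i

/-- The vectors `m` are sorted by their support `I` below the last index. By
`aeval_chainProd_gaussBinom` the product of the denominators depends only on `I` and is the full
factorial divided by the Gaussian multinomial. The numerators then sum to a product of geometric
series, and the last index, which does not enter `I`, carries the weight `ε`. -/
theorem hasSum_igusaSum {h : ℕ} {Y : ℂ} {φ : ℕ → ℂ} (hφ : IsGaussValue Y φ) {X : ℕ → ℂ}
    (hX : ∀ i, 1 ≤ i → i ≤ h + 1 → ‖X i‖ < 1) (ε : ℂ) :
    HasSum (fun m : Fin (h + 1) → ℕ => (if m (Fin.last h) = 0 then ε else 1) *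
        ∏ i : Fin (h + 1), (X (i + 1) ^ m i / φ (nextStep m i - i)))
      ((ε + X (h + 1) / (1 - X (h + 1))) * igusaSum (h + 1) Y X / genFactorial φ (h + 1)) := by
  classical
  -- For fixed `I` the coordinate factors vanish unless the inner support of `m` is exactly `I`, so
  -- the condition on the support becomes a product over coordinates.
  let f : Finset ℕ → ∀ k : Fin (h + 1), ℕ → ℂ := fun I => Fin.snoc (α := fun _ => ℕ → ℂ)
    (fun k a => if (a ≠ 0 ↔ (k : ℕ) + 1 ∈ I) then X (k + 1) ^ a else 0)
    (fun a => (if a = 0 then ε else 1) * X (h + 1) ^ a)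
  let A : Finset ℕ → Fin (h + 1) → ℂ := fun I => Fin.snoc (α := fun _ => ℂ)
    (fun k => if (k : ℕ) + 1 ∈ I then X (k + 1) / (1 - X (k + 1)) else 1)
    (ε + X (h + 1) / (1 - X (h + 1)))
  have h1 : ∀ I k, HasSum (f I k) (A I k) := by
    intro I k
    refine Fin.lastCases ?_ (fun k => ?_) k
    · simp only [f, A, Fin.snoc_last]
      exact hasSum_geometric_weighted (hX _ (by omega) le_rfl) ε
    · simp only [f, A, Fin.snoc_castSucc]
      split_ifs with hk
      · convert hasSum_geometric_pos (hX (k + 1) (by omega) (by omega)) using 2 with a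
        by_cases ha : a = 0 <;> simp [ha, hk]
      · convert hasSum_ite_eq (0 : ℕ) (1 : ℂ) using 2 with a
        by_cases ha : a = 0 <;> simp [ha, hk]
  have hA : ∀ I ∈ (Finset.Icc 1 h).powerset, ∏ k, A I k =
      (ε + X (h + 1) / (1 - X (h + 1))) * ∏ i ∈ I, X i / (1 - X i) := by
    intro I hI
    rw [Finset.mem_powerset] at hI
    rw [Fin.prod_univ_castSucc, mul_comm]
    simp only [A, Fin.snoc_castSucc, Fin.snoc_last]
    congr 1
    rw [Fin.prod_univ_eq_prod_range (fun k => if k + 1 ∈ I then X (k + 1) / (1 - X (k + 1)) else 1),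
      Finset.range_eq_Ico, Finset.prod_Ico_add' (fun k => if k ∈ I then X k / (1 - X k) else 1) 0 h 1,
      ← Finset.prod_subset (s₁ := I)]
    · exact Finset.prod_congr rfl fun i hi => if_pos hi
    · intro i hi
      have := Finset.mem_Icc.1 (hI hi)
      rw [Finset.mem_Ico]
      omega
    · exact fun i _ hi => if_neg hi
  have hf : ∀ I ∈ (Finset.Icc 1 h).powerset, ∀ m : Fin (h + 1) → ℕ, ∏ k, f I k (m k) =
      if innerSupport m = I then
        (if m (Fin.last h) = 0 then ε else 1) * ∏ i : Fin (h + 1), X (i + 1) ^ m i else 0 := by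
    intro I hI m
    rw [Finset.mem_powerset] at hI
    have hiff : innerSupport m = I ↔ ∀ k : Fin h, m k.castSucc ≠ 0 ↔ (k : ℕ) + 1 ∈ I := by
      rw [Finset.ext_iff]
      constructor
      · intro H k
        rw [← H, innerSupport, Finset.mem_filter, Finset.mem_Icc]
        constructor
        · exact fun hk => ⟨by omega, k.castSucc, rfl, hk⟩
        · rintro ⟨-, k', hk', h'⟩
          rwa [show k.castSucc = k' from Fin.ext (by simp at hk' ⊢; omega)]
      · intro H j
        rw [innerSupport, Finset.mem_filter]
        constructor
        · rintro ⟨hj, k, rfl, hk⟩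
          have := Finset.mem_Icc.1 hj
          exact (H ⟨k, by omega⟩).1 hk
        · intro hj
          have := hI hj
          refine ⟨this, ?_⟩
          rw [Finset.mem_Icc] at this
          refine ⟨⟨j - 1, by omega⟩, by simp; omega, ?_⟩
          exact (H ⟨j - 1, by omega⟩).2 (by simpa [Nat.sub_add_cancel this.1] using hj)
    rw [Fin.prod_univ_castSucc, Fin.prod_univ_castSucc]
    simp only [f, Fin.snoc_castSucc, Fin.snoc_last, Fin.val_castSucc, Fin.val_last]
    by_cases hs : innerSupport m = I
    · rw [if_pos hs, Finset.prod_congr rfl fun k _ => if_pos (hiff.1 hs k)]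
      ring
    · rw [if_neg hs]
      rw [hiff, not_forall] at hs
      obtain ⟨k, hk⟩ := hs
      rw [Finset.prod_eq_zero (Finset.mem_univ k) (if_neg hk), zero_mul]
  have hc : ∀ m : Fin (h + 1) → ℕ,
      Polynomial.aeval Y (gaussMultinomial (h + 1) (innerSupport m)) / genFactorial φ (h + 1) =
        ∏ i : Fin (h + 1), (φ (nextStep m i - i))⁻¹ := by
    intro m
    have h2 := aeval_chainProd_gaussBinom hφ
      (sortedGT_cons_sort (I := innerSupport m) (Finset.filter_subset _ _))
    have h3 : ∏ i ∈ Finset.range (h + 1),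
        φ (listNext (h + 1) ((innerSupport m).sort (· ≥ ·)) i - i) =
          ∏ i : Fin (h + 1), φ (nextStep m i - i) := by
      rw [Fin.prod_univ_eq_prod_range (fun i => φ (nextStep m i - i))]
      refine Finset.prod_congr rfl fun i hi => ?_
      rw [listNext_innerSupport m (Finset.mem_range.1 hi)]
    have h4 : ∏ i : Fin (h + 1), φ (nextStep m i - i) ≠ 0 :=
      Finset.prod_ne_zero_iff.2 fun i _ =>
        hφ.ne_zero _ (Nat.sub_pos_of_lt (isLeast_nextStep m i).1.1)
    rw [h3] at h2
    rw [Finset.prod_inv_distrib, div_eq_iff (genFactorial_ne_zero hφ.ne_zero _), ← h2, mul_comm,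
      mul_assoc, mul_inv_cancel₀ h4, mul_one, gaussMultinomial]
  have hmain := hasSum_sum fun I (_ : I ∈ (Finset.Icc 1 h).powerset) =>
    (hasSum_pi_prod (h1 I)).mul_left
      (Polynomial.aeval Y (gaussMultinomial (h + 1) I) / genFactorial φ (h + 1))
  have e1 : (fun m : Fin (h + 1) → ℕ => (if m (Fin.last h) = 0 then ε else 1) *
      ∏ i : Fin (h + 1), (X (i + 1) ^ m i / φ (nextStep m i - i))) = fun m =>
      ∑ I ∈ (Finset.Icc 1 h).powerset, Polynomial.aeval Y (gaussMultinomial (h + 1) I) /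
        genFactorial φ (h + 1) * ∏ k, f I k (m k) := by
    funext m
    rw [Finset.sum_congr rfl (g := fun I => Polynomial.aeval Y (gaussMultinomial (h + 1) I) /
      genFactorial φ (h + 1) * if innerSupport m = I then
        (if m (Fin.last h) = 0 then ε else 1) * ∏ i : Fin (h + 1), X (i + 1) ^ m i else 0)
      fun I hI => by rw [hf I hI m]]
    simp only [mul_ite, mul_zero]
    rw [Finset.sum_ite_eq, if_pos (Finset.mem_powerset.2 (by
      rw [innerSupport]; exact Finset.filter_subset _ _)), mul_left_comm, hc]
    simp only [div_eq_mul_inv, Finset.prod_mul_distrib]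
    split_ifs <;> ring
  have e2 : (ε + X (h + 1) / (1 - X (h + 1))) * igusaSum (h + 1) Y X / genFactorial φ (h + 1) =
      ∑ I ∈ (Finset.Icc 1 h).powerset, Polynomial.aeval Y (gaussMultinomial (h + 1) I) /
        genFactorial φ (h + 1) * ∏ k, A I k := by
    rw [igusaSum, Nat.add_sub_cancel, Finset.mul_sum, Finset.sum_div]
    refine Finset.sum_congr rfl fun I hI => ?_
    rw [hA I hI]
    ring
  rw [e1, e2]
  exact hmain

end HeisenbergZeta
end

noncomputable section
namespace HeisenbergZeta

/-! ### Merging two partitions along a lattice path -/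

/-- A lattice path with `n` up- and `n` down-steps: `ell i` up-steps precede the down-step `i`, and
`em j` down-steps precede the up-step `j`. -/
structure IsPath {n : ℕ} (ell em : Fin n → ℕ) : Prop where
  mono_ell : Monotone ell
  mono_em : Monotone em
  ell_le : ∀ i, ell i ≤ n
  em_le : ∀ j, em j ≤ n
  lt_iff : ∀ i j : Fin n, (j : ℕ) < ell i ↔ em j ≤ i

/-- The position in the path of the up-step `j` and of the down-step `i`. -/
def rank {n : ℕ} (ell em : Fin n → ℕ) : Fin n ⊕ Fin n → ℕ
  | Sum.inl j => j + em j
  | Sum.inr i => i + ell i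

section Path

variable {n : ℕ} {ell em : Fin n → ℕ}

theorem rank_lt (h : IsPath ell em) (x : Fin n ⊕ Fin n) : rank ell em x < 2 * n := by
  rcases x with j | i
  · have := h.em_le j
    have := j.2
    simp only [rank]
    omega
  · have := h.ell_le i
    have := i.2
    simp only [rank]
    omega

theorem rank_inl_lt_inl (h : IsPath ell em) {j k : Fin n} :
    rank ell em (Sum.inl j) < rank ell em (Sum.inl k) ↔ j < k := by
  simp only [rank]
  constructor
  · intro hlt
    by_contra hc
    have := h.mono_em (not_lt.1 hc)
    have : (k : ℕ) ≤ j := not_lt.1 hc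
    omega
  · intro hlt
    have := h.mono_em hlt.le
    have : (j : ℕ) < k := hlt
    omega

theorem rank_inr_lt_inr (h : IsPath ell em) {j k : Fin n} :
    rank ell em (Sum.inr j) < rank ell em (Sum.inr k) ↔ j < k := by
  simp only [rank]
  constructor
  · intro hlt
    by_contra hc
    have := h.mono_ell (not_lt.1 hc)
    have : (k : ℕ) ≤ j := not_lt.1 hc
    omega
  · intro hlt
    have := h.mono_ell hlt.le
    have : (j : ℕ) < k := hlt
    omega

theorem rank_inl_lt_inr (h : IsPath ell em) {i j : Fin n} :
    rank ell em (Sum.inl j) < rank ell em (Sum.inr i) ↔ (j : ℕ) < ell i := by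
  have := h.lt_iff i j
  simp only [rank]
  omega

theorem rank_inr_lt_inl (h : IsPath ell em) {i j : Fin n} :
    rank ell em (Sum.inr i) < rank ell em (Sum.inl j) ↔ ell i ≤ j := by
  have := h.lt_iff i j
  simp only [rank]
  omega

theorem rank_injective (h : IsPath ell em) : Function.Injective (rank ell em) := by
  intro x y hxy
  rcases x with j | i <;> rcases y with k | l
  · have h1 := (rank_inl_lt_inl h (j := j) (k := k)).not.1 hxy.not_lt
    have h2 := (rank_inl_lt_inl h (j := k) (k := j)).not.1 hxy.not_gt
    rw [le_antisymm (not_lt.1 h2) (not_lt.1 h1)]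
  · have h1 := rank_inl_lt_inr h (i := l) (j := j)
    have h2 := rank_inr_lt_inl h (i := l) (j := j)
    omega
  · have h1 := rank_inl_lt_inr h (i := i) (j := k)
    have h2 := rank_inr_lt_inl h (i := i) (j := k)
    omega
  · have h1 := (rank_inr_lt_inr h (j := i) (k := l)).not.1 hxy.not_lt
    have h2 := (rank_inr_lt_inr h (j := l) (k := i)).not.1 hxy.not_gt
    rw [le_antisymm (not_lt.1 h2) (not_lt.1 h1)]

theorem exists_rank_eq (h : IsPath ell em) {c : ℕ} (hc : c < 2 * n) :
    ∃ x, rank ell em x = c := by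
  let f : Fin n ⊕ Fin n → Fin (2 * n) := fun x => ⟨rank ell em x, rank_lt h x⟩
  have hf : Function.Bijective f := by
    rw [Fintype.bijective_iff_injective_and_card]
    refine ⟨fun x y hxy => rank_injective h (Fin.ext_iff.1 hxy), ?_⟩
    simp [two_mul]
  obtain ⟨x, hx⟩ := hf.2 ⟨c, hc⟩
  exact ⟨x, Fin.ext_iff.1 hx⟩

/-- The `c`-th entry of the merged partition with multiplicities `m`. -/
def chain (ell em : Fin n → ℕ) (m : Fin n ⊕ Fin n → ℕ) (c : ℕ) : ℕ :=
  ∑ x, if c ≤ rank ell em x then m x else 0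

theorem chain_antitone (m : Fin n ⊕ Fin n → ℕ) : Antitone (chain ell em m) := by
  intro c d hcd
  refine Finset.sum_le_sum fun x _ => ?_
  split_ifs <;> omega

theorem chain_eq_zero (h : IsPath ell em) (m : Fin n ⊕ Fin n → ℕ) {c : ℕ} (hc : 2 * n ≤ c) :
    chain ell em m c = 0 :=
  Finset.sum_eq_zero fun x _ => if_neg (by have := rank_lt h x; omega)

/-- `m x` is the drop of the merged sequence just after the position of `x`, since distinct steps
have distinct positions. -/
theorem chain_rank (h : IsPath ell em) (m : Fin n ⊕ Fin n → ℕ) (x : Fin n ⊕ Fin n) :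
    chain ell em m (rank ell em x) = m x + chain ell em m (rank ell em x + 1) := by
  have h1 : m x = ∑ y, if y = x then m y else 0 := by simp
  rw [chain, chain, h1, ← Finset.sum_add_distrib]
  refine Finset.sum_congr rfl fun y _ => ?_
  by_cases hy : y = x
  · subst hy
    simp
  · have : rank ell em y ≠ rank ell em x := fun h' => hy (rank_injective h h')
    split_ifs <;> omega

theorem chain_eq_of_antitone (h : IsPath ell em) {Z : ℕ → ℕ} (hZ : Antitone Z)
    (h0 : ∀ c, 2 * n ≤ c → Z c = 0) (c : ℕ) :
    chain ell em (fun x => Z (rank ell em x) - Z (rank ell em x + 1)) c = Z c := by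
  rcases le_total (2 * n) c with hc | hc
  · rw [chain_eq_zero h _ hc, h0 c hc]
  · induction hc using Nat.decreasingInduction with
    | self => rw [chain_eq_zero h _ le_rfl, h0 _ le_rfl]
    | of_succ c hc ih =>
      obtain ⟨x, rfl⟩ := exists_rank_eq h hc
      rw [chain_rank h, ih]
      have := hZ (Nat.le_succ (rank ell em x))
      simp only [Nat.succ_eq_add_one] at this
      omega

/-- The pairs of partitions whose entries, merged along the path, are non-ascending. -/
structure IsMerged (ell : Fin n → ℕ) (x : (Fin n → ℕ) × (Fin n → ℕ)) : Prop where
  anti_mu : Antitone x.1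
  anti_lam : Antitone x.2
  le : ∀ i j : Fin n, (j : ℕ) < ell i → x.1 i ≤ x.2 j
  ge : ∀ i j : Fin n, ell i ≤ j → x.2 j ≤ x.1 i

/-- The pair `(μ, λ)` with given multiplicities. -/
def mergedPair (ell em : Fin n → ℕ) (m : Fin n ⊕ Fin n → ℕ) : (Fin n → ℕ) × (Fin n → ℕ) :=
  (fun i => chain ell em m (rank ell em (Sum.inr i)),
    fun j => chain ell em m (rank ell em (Sum.inl j)))

theorem isMerged_mergedPair (h : IsPath ell em) (m : Fin n ⊕ Fin n → ℕ) :
    IsMerged ell (mergedPair ell em m) where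
  anti_mu _ _ hij := chain_antitone m (le_of_not_gt fun hc =>
    absurd hij (not_le.2 ((rank_inr_lt_inr h).1 hc)))
  anti_lam _ _ hij := chain_antitone m (le_of_not_gt fun hc =>
    absurd hij (not_le.2 ((rank_inl_lt_inl h).1 hc)))
  le _ _ hij := chain_antitone m ((rank_inl_lt_inr h).2 hij).le
  ge _ _ hij := chain_antitone m ((rank_inr_lt_inl h).2 hij).le

/-- The multiplicities are recovered as consecutive drops of the merged sequence, which is zero from
position `2 * n` on. Conversely any non-ascending sequence is the sum of its drops. -/
theorem bijective_mergedPair (h : IsPath ell em) :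
    Function.Bijective fun m => (⟨mergedPair ell em m, isMerged_mergedPair h m⟩ :
      {x // IsMerged ell x}) := by
  constructor
  · intro m m' hm
    have h1 := Subtype.ext_iff.1 hm
    have h2 : ∀ c, chain ell em m c = chain ell em m' c := by
      intro c
      rcases lt_or_ge c (2 * n) with hc | hc
      · obtain ⟨x, rfl⟩ := exists_rank_eq h hc
        rcases x with j | i
        · exact congrFun (congrArg Prod.snd h1) j
        · exact congrFun (congrArg Prod.fst h1) i
      · rw [chain_eq_zero h _ hc, chain_eq_zero h _ hc]
    funext x
    have h3 := chain_rank h m x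
    have h4 := chain_rank h m' x
    rw [h2, h2] at h3
    omega
  · rintro ⟨⟨mu, lam⟩, hx⟩
    let V : Fin n ⊕ Fin n → ℕ := Sum.elim lam mu
    -- The merged sequence: each part is placed at the position of its step, with `0` beyond the
    -- path.
    let Z : ℕ → ℕ := Function.extend (rank ell em) V 0
    have hZV : ∀ x, Z (rank ell em x) = V x := fun x => (rank_injective h).extend_apply _ _ x
    have h0 : ∀ c, 2 * n ≤ c → Z c = 0 := fun c hc =>
      Function.extend_apply' _ _ _ fun ⟨x, hx⟩ => by
        have := rank_lt h x
        omega
    have hVanti : ∀ x y, rank ell em x < rank ell em y → V y ≤ V x := by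
      rintro (j | i) (k | l) hxy
      · exact hx.anti_lam ((rank_inl_lt_inl h).1 hxy).le
      · exact hx.le l j ((rank_inl_lt_inr h).1 hxy)
      · exact hx.ge i k ((rank_inr_lt_inl h).1 hxy)
      · exact hx.anti_mu ((rank_inr_lt_inr h).1 hxy).le
    have hZ : Antitone Z := by
      intro c d hcd
      rcases lt_or_ge d (2 * n) with hd | hd
      · obtain ⟨x, rfl⟩ := exists_rank_eq h (hcd.trans_lt hd)
        obtain ⟨y, rfl⟩ := exists_rank_eq h hd
        rw [hZV, hZV]
        rcases hcd.lt_or_eq with hlt | heq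
        · exact hVanti _ _ hlt
        · rw [rank_injective h heq]
      · rw [h0 d hd]
        exact Nat.zero_le _
    refine ⟨fun x => Z (rank ell em x) - Z (rank ell em x + 1), Subtype.ext ?_⟩
    refine Prod.ext (funext fun i => ?_) (funext fun j => ?_)
    · exact (chain_eq_of_antitone h hZ h0 _).trans (hZV _)
    · exact (chain_eq_of_antitone h hZ h0 _).trans (hZV _)

/-- The number of down-steps among the first `c + 1` steps. -/
def downCount (ell em : Fin n → ℕ) (c : ℕ) : ℕ :=
  (Finset.univ.filter fun i => rank ell em (Sum.inr i) ≤ c).card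

/-- The number of up-steps among the first `c + 1` steps. -/
def upCount (ell em : Fin n → ℕ) (c : ℕ) : ℕ :=
  (Finset.univ.filter fun j => rank ell em (Sum.inl j) ≤ c).card

theorem card_filter_fin_lt {c : ℕ} (hc : c ≤ n) :
    (Finset.univ.filter fun i : Fin n => (i : ℕ) < c).card = c := by
  rw [Fin.card_filter_val_lt, min_eq_right hc]

theorem downCount_inr (h : IsPath ell em) (i : Fin n) :
    downCount ell em (rank ell em (Sum.inr i)) = i + 1 := by
  rw [downCount, ← card_filter_fin_lt (n := n) (c := i + 1) i.2]
  congr 1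
  ext k
  simp only [Finset.mem_filter, Finset.mem_univ, true_and]
  rw [← not_lt, rank_inr_lt_inr h, not_lt, Fin.le_def]
  omega

theorem upCount_inr (h : IsPath ell em) (i : Fin n) :
    upCount ell em (rank ell em (Sum.inr i)) = ell i := by
  rw [upCount, ← card_filter_fin_lt (h.ell_le i)]
  congr 1
  ext k
  simp only [Finset.mem_filter, Finset.mem_univ, true_and]
  rw [← not_lt, rank_inr_lt_inl h, not_le]

theorem upCount_inl (h : IsPath ell em) (j : Fin n) :
    upCount ell em (rank ell em (Sum.inl j)) = j + 1 := by
  rw [upCount, ← card_filter_fin_lt (n := n) (c := j + 1) j.2]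
  congr 1
  ext k
  simp only [Finset.mem_filter, Finset.mem_univ, true_and]
  rw [← not_lt, rank_inl_lt_inl h, not_lt, Fin.le_def]
  omega

theorem downCount_inl (h : IsPath ell em) (j : Fin n) :
    downCount ell em (rank ell em (Sum.inl j)) = em j := by
  rw [downCount, ← card_filter_fin_lt (h.em_le j)]
  congr 1
  ext k
  simp only [Finset.mem_filter, Finset.mem_univ, true_and]
  rw [← not_lt, rank_inl_lt_inr h, h.lt_iff, not_le]

theorem sum_fst_mergedPair (m : Fin n ⊕ Fin n → ℕ) :
    ∑ i, (mergedPair ell em m).1 i = ∑ x, m x * downCount ell em (rank ell em x) := by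
  simp only [mergedPair, chain]
  rw [Finset.sum_comm]
  refine Finset.sum_congr rfl fun x _ => ?_
  rw [downCount, Finset.card_filter, Finset.mul_sum]
  exact Finset.sum_congr rfl fun i _ => by simp

theorem sum_snd_mergedPair (m : Fin n ⊕ Fin n → ℕ) :
    ∑ j, (mergedPair ell em m).2 j = ∑ x, m x * upCount ell em (rank ell em x) := by
  simp only [mergedPair, chain]
  rw [Finset.sum_comm]
  refine Finset.sum_congr rfl fun x _ => ?_
  rw [upCount, Finset.card_filter, Finset.mul_sum]
  exact Finset.sum_congr rfl fun i _ => by simp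

/-- The minimum of two entries of a non-ascending sequence is the entry at the larger position.
Hence `m x` is counted once for each pair of positions that are both at or before the position of
`x`. -/
theorem sum_min_chain (m : Fin n ⊕ Fin n → ℕ) (f g : Fin n → ℕ) :
    ∑ i, ∑ j, min (chain ell em m (f i)) (chain ell em m (g j)) =
      ∑ x, m x * ((Finset.univ.filter fun i => f i ≤ rank ell em x).card *
        (Finset.univ.filter fun i => g i ≤ rank ell em x).card) := by
  have h1 : ∀ i j, min (chain ell em m (f i)) (chain ell em m (g j)) =
      ∑ x, m x * ((if f i ≤ rank ell em x then 1 else 0) *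
        (if g j ≤ rank ell em x then 1 else 0)) := by
    intro i j
    rw [← (chain_antitone (ell := ell) (em := em) m).map_max, chain]
    refine Finset.sum_congr rfl fun x _ => ?_
    simp only [max_le_iff]
    split_ifs <;> simp_all
  simp only [h1]
  rw [Finset.sum_congr rfl fun i _ => Finset.sum_comm, Finset.sum_comm]
  refine Finset.sum_congr rfl fun x _ => ?_
  rw [Finset.card_filter, Finset.card_filter, Finset.sum_mul_sum, Finset.mul_sum]
  exact Finset.sum_congr rfl fun i _ => (Finset.mul_sum _ _ _).symm

/-- The total exponent of `p`, from `alpha` and from `p^(2n)` to the power `∑ μ_i`, is linear in the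
drops. A drop after `d` down-steps and `u` up-steps contributes `d(u - d) + 2nd`. -/
theorem sum_exponent_mergedPair (m : Fin n ⊕ Fin n → ℕ) (hle : (mergedPair ell em m).1 ≤
    (mergedPair ell em m).2) :
    ∑ i, ∑ j, (min ((mergedPair ell em m).1 i) ((mergedPair ell em m).2 j) -
        min ((mergedPair ell em m).1 i) ((mergedPair ell em m).1 j)) +
      2 * n * ∑ i, (mergedPair ell em m).1 i =
    ∑ x, m x * (downCount ell em (rank ell em x) * (2 * n + upCount ell em (rank ell em x) -
      downCount ell em (rank ell em x))) := by
  have h1 := sum_min_chain (ell := ell) (em := em) m (fun i => rank ell em (Sum.inr i))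
    (fun j => rank ell em (Sum.inl j))
  have h2 := sum_min_chain (ell := ell) (em := em) m (fun i => rank ell em (Sum.inr i))
    (fun j => rank ell em (Sum.inr j))
  have h3 : ∑ i, ∑ j, (min ((mergedPair ell em m).1 i) ((mergedPair ell em m).2 j) -
        min ((mergedPair ell em m).1 i) ((mergedPair ell em m).1 j)) +
      ∑ i, ∑ j, min ((mergedPair ell em m).1 i) ((mergedPair ell em m).1 j) =
      ∑ i, ∑ j, min ((mergedPair ell em m).1 i) ((mergedPair ell em m).2 j) := by
    rw [← Finset.sum_add_distrib]
    refine Finset.sum_congr rfl fun i _ => ?_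
    rw [← Finset.sum_add_distrib]
    refine Finset.sum_congr rfl fun j _ => ?_
    have : (mergedPair ell em m).1 j ≤ (mergedPair ell em m).2 j := hle j
    omega
  have h4 := sum_fst_mergedPair (ell := ell) (em := em) m
  have h5 : ∑ x, m x * (downCount ell em (rank ell em x) * (2 * n + upCount ell em (rank ell em x) -
      downCount ell em (rank ell em x))) +
      ∑ x, m x * (downCount ell em (rank ell em x) * downCount ell em (rank ell em x)) =
      ∑ x, m x * (downCount ell em (rank ell em x) * upCount ell em (rank ell em x)) +
        2 * n * ∑ x, m x * downCount ell em (rank ell em x) := by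
    rw [Finset.mul_sum, ← Finset.sum_add_distrib, ← Finset.sum_add_distrib]
    refine Finset.sum_congr rfl fun x _ => ?_
    have h6 : downCount ell em (rank ell em x) ≤ n :=
      (Finset.card_filter_le _ _).trans (by simp)
    obtain ⟨d, hd⟩ : ∃ d, 2 * n + upCount ell em (rank ell em x) =
        downCount ell em (rank ell em x) + d :=
      ⟨2 * n + upCount ell em (rank ell em x) - downCount ell em (rank ell em x), by omega⟩
    rw [hd, Nat.add_sub_cancel_left]
    have h7 := congrArg (fun y => m x * downCount ell em (rank ell em x) * y) hd
    simp only [mul_add] at h7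
    linarith
  change ∑ i, ∑ j, min ((mergedPair ell em m).1 i) ((mergedPair ell em m).2 j) =
    ∑ x, m x * (downCount ell em (rank ell em x) * upCount ell em (rank ell em x)) at h1
  change ∑ i, ∑ j, min ((mergedPair ell em m).1 i) ((mergedPair ell em m).1 j) =
    ∑ x, m x * (downCount ell em (rank ell em x) * downCount ell em (rank ell em x)) at h2
  rw [h4]
  omega

end Path

end HeisenbergZeta
end

noncomputable section
namespace HeisenbergZeta

/-! ### Blocks of a lattice path -/

/-- Cut points `0 = L 0 < ⋯ < L r = n`. -/
structure IsCuts (n r : ℕ) (L : ℕ → ℕ) : Prop where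
  zero : L 0 = 0
  last : L r = n
  lt : ∀ i < r, L i < L (i + 1)

section Cuts

variable {n r : ℕ} {L : ℕ → ℕ}

theorem IsCuts.lt_of_lt (h : IsCuts n r L) {a b : ℕ} (hab : a < b) (hb : b ≤ r) : L a < L b := by
  induction b, hab using Nat.le_induction with
  | base => exact h.lt a hb
  | succ b hab ih => exact (ih (by omega)).trans (h.lt b hb)

theorem IsCuts.le_of_le (h : IsCuts n r L) {a b : ℕ} (hab : a ≤ b) (hb : b ≤ r) : L a ≤ L b := by
  rcases hab.lt_or_eq with hlt | rfl
  · exact (h.lt_of_lt hlt hb).le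
  · exact le_rfl

theorem IsCuts.le_n (h : IsCuts n r L) {a : ℕ} (ha : a ≤ r) : L a ≤ n :=
  (h.le_of_le ha le_rfl).trans_eq h.last

theorem IsCuts.exists_block (h : IsCuts n r L) {j : ℕ} (hj : j < n) :
    ∃ b < r, L b ≤ j ∧ j < L (b + 1) := by
  classical
  have hex : ∃ a, a ≤ r ∧ j < L a := ⟨r, le_rfl, by rw [h.last]; exact hj⟩
  obtain ⟨h1, h2⟩ := Nat.find_spec hex
  have h0 : Nat.find hex ≠ 0 := fun h0 => by
    rw [h0, h.zero] at h2
    omega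
  refine ⟨Nat.find hex - 1, by omega, ?_, ?_⟩
  · have := Nat.find_min hex (m := Nat.find hex - 1) (by omega)
    by_contra hc
    exact this ⟨by omega, by omega⟩
  · rwa [Nat.sub_add_cancel (by omega)]

theorem IsCuts.block_lt (h : IsCuts n r L) (x : Σ b : Fin r, Fin (L (b + 1) - L b)) :
    L x.1 + x.2 < n := by
  have h1 := x.2.2
  have h2 := h.le_n (a := x.1 + 1) x.1.2
  omega

theorem IsCuts.bijective (h : IsCuts n r L) :
    Function.Bijective fun x : Σ b : Fin r, Fin (L (b + 1) - L b) =>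
      (⟨L x.1 + x.2, h.block_lt x⟩ : Fin n) := by
  constructor
  · rintro ⟨⟨a, ha⟩, k⟩ ⟨⟨b, hb⟩, l⟩ hab
    have hab' : L a + k = L b + l := Fin.ext_iff.1 hab
    have hk : (k : ℕ) < L (a + 1) - L a := k.2
    have hl : (l : ℕ) < L (b + 1) - L b := l.2
    have heq : a = b := by
      rcases lt_trichotomy a b with hlt | heq | hgt
      · have := h.le_of_le (a := a + 1) (b := b) hlt (by omega)
        omega
      · exact heq
      · have := h.le_of_le (a := b + 1) (b := a) hgt (by omega)
        omega
    subst heq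
    have : k = l := Fin.ext (by omega)
    subst this
    rfl
  · intro j
    obtain ⟨b, hb, h1, h2⟩ := h.exists_block j.2
    exact ⟨⟨⟨b, hb⟩, ⟨j - L b, by simp only; omega⟩⟩, Fin.ext (by simp only; omega)⟩

/-- The decomposition of `{0, …, n - 1}` into blocks. -/
def IsCuts.equiv (h : IsCuts n r L) : (Σ b : Fin r, Fin (L (b + 1) - L b)) ≃ Fin n :=
  Equiv.ofBijective _ h.bijective

theorem IsCuts.val_equiv (h : IsCuts n r L) (x : Σ b : Fin r, Fin (L (b + 1) - L b)) :
    (h.equiv x : ℕ) = L x.1 + x.2 := rfl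

/-- The block of an index. -/
def IsCuts.blk (h : IsCuts n r L) (j : Fin n) : Fin r := (h.equiv.symm j).1

theorem IsCuts.blk_equiv (h : IsCuts n r L) (x : Σ b : Fin r, Fin (L (b + 1) - L b)) :
    h.blk (h.equiv x) = x.1 := by rw [blk, Equiv.symm_apply_apply]

theorem IsCuts.le_blk (h : IsCuts n r L) (j : Fin n) : L (h.blk j) ≤ j := by
  obtain ⟨x, rfl⟩ := h.equiv.surjective j
  rw [h.blk_equiv, h.val_equiv]
  omega

theorem IsCuts.lt_blk (h : IsCuts n r L) (j : Fin n) : j < L (h.blk j + 1) := by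
  obtain ⟨x, rfl⟩ := h.equiv.surjective j
  rw [h.blk_equiv, h.val_equiv]
  have := x.2.2
  omega

theorem IsCuts.lt_iff (h : IsCuts n r L) (j : Fin n) {a : ℕ} (ha : a ≤ r) :
    j < L a ↔ h.blk j < a := by
  constructor
  · intro hj
    by_contra hc
    have h1 := h.le_of_le (not_lt.1 hc) (h.blk j).2.le
    have h2 := h.le_blk j
    omega
  · intro hj
    exact (h.lt_blk j).trans_le (h.le_of_le hj ha)

theorem IsCuts.blk_mono (h : IsCuts n r L) : Monotone h.blk := by
  intro i j hij
  rw [Fin.le_def, ← Nat.lt_succ_iff, ← h.lt_iff i (h.blk j).2]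
  exact lt_of_le_of_lt hij (h.lt_blk j)

theorem IsCuts.le_of_blk (h : IsCuts n r L) (j : Fin n) {a : ℕ} (ha : a ≤ r) :
    L a ≤ j ↔ a ≤ h.blk j := by
  rw [← not_lt, h.lt_iff j ha, not_lt]

end Cuts

/-- The block data of a lattice path staying weakly above the diagonal. -/
structure IsBlocks (n r : ℕ) (L M : ℕ → ℕ) : Prop where
  cutsL : IsCuts n r L
  cutsM : IsCuts n r M
  le : ∀ i ≤ r, M i ≤ L i

/-! ### Overlap inequalities and equal parts along the blocks -/

section Blocks

variable {n r : ℕ} {L M : ℕ → ℕ}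

/-- The number of up-steps before the down-step `i`. -/
def IsBlocks.ell (h : IsBlocks n r L M) (i : Fin n) : ℕ := L (h.cutsM.blk i + 1)

/-- The number of down-steps before the up-step `j`. -/
def IsBlocks.em (h : IsBlocks n r L M) (j : Fin n) : ℕ := M (h.cutsL.blk j)

theorem IsBlocks.isPath (h : IsBlocks n r L M) : IsPath h.ell h.em where
  mono_ell i j hij := h.cutsL.le_of_le
    (Nat.succ_le_succ (Fin.le_def.1 (h.cutsM.blk_mono hij))) (h.cutsM.blk j).2
  mono_em i j hij := h.cutsM.le_of_le (Fin.le_def.1 (h.cutsL.blk_mono hij)) (h.cutsL.blk j).2.le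
  ell_le i := h.cutsL.le_n (h.cutsM.blk i).2
  em_le j := h.cutsM.le_n (h.cutsL.blk j).2.le
  lt_iff i j := by
    rw [ell, em, h.cutsL.lt_iff j (h.cutsM.blk i).2, h.cutsM.le_of_blk i (h.cutsL.blk j).2.le,
      Nat.lt_succ_iff]

theorem IsBlocks.lt_ell (h : IsBlocks n r L M) (i : Fin n) : (i : ℕ) < h.ell i :=
  (h.cutsM.lt_blk i).trans_le (h.le _ (h.cutsM.blk i).2)

/-- The overlap inequalities for given block data. -/
def OverlapAt {n : ℕ} (r : ℕ) (L M : ℕ → ℕ) (mu lam : Fin n → ℕ) : Prop :=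
  (∀ i < r, part mu (M i + 1) ≤ part lam (L (i + 1))) ∧
    (∀ i, 1 ≤ i → i < r → part lam (L i + 1) < part mu (M i))

theorem part_succ {v : Fin n → ℕ} {j : ℕ} (hj : j < n) : part v (j + 1) = v ⟨j, hj⟩ := by
  rw [part, dif_pos ⟨by omega, hj⟩]
  rfl

/-- By monotonicity the inequalities at the block ends govern all the entries: the weak ones give
`μ_i ≤ λ_j` for the up-steps before the down-step `i`, and the strict ones at the valleys exclude it
for all later up-steps. -/
theorem IsBlocks.overlapAt_iff (h : IsBlocks n r L M) {mu lam : Fin n → ℕ} (hmu : Antitone mu)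
    (hlam : Antitone lam) :
    OverlapAt r L M mu lam ↔ ∀ i j : Fin n, mu i ≤ lam j ↔ (j : ℕ) < h.ell i := by
  constructor
  · rintro ⟨h1, h2⟩ i j
    have hb := (h.cutsM.blk i).2
    have hMi := h.cutsM.le_blk i
    have hiM := h.cutsM.lt_blk i
    rw [ell]
    set b : ℕ := (h.cutsM.blk i : ℕ) with hbdef
    have hLn := h.cutsL.le_n (a := b + 1) hb
    have hMn := h.cutsM.le_n (a := b + 1) hb
    constructor
    · intro hle
      by_contra hc
      rw [not_lt] at hc
      have hbr : b + 1 < r := by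
        rcases Nat.lt_or_ge (b + 1) r with hlt | hge
        · exact hlt
        · have := h.cutsL.last
          rw [show r = b + 1 by omega] at this
          omega
      have h3 := h2 (b + 1) (by omega) hbr
      rw [part_succ (by omega)] at h3
      obtain ⟨c, hc'⟩ : ∃ c, M (b + 1) = c + 1 := ⟨M (b + 1) - 1, by omega⟩
      rw [hc', part_succ (by omega)] at h3
      have h4 : lam j ≤ lam ⟨L (b + 1), by omega⟩ := hlam (Fin.le_def.2 hc)
      have h5 : mu ⟨c, by omega⟩ ≤ mu i := hmu (Fin.le_def.2 (by simp only; omega))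
      omega
    · intro hj
      have h3 := h1 b hb
      have h0 := h.cutsL.lt b hb
      rw [part_succ (by omega)] at h3
      obtain ⟨c, hc'⟩ : ∃ c, L (b + 1) = c + 1 := ⟨L (b + 1) - 1, by omega⟩
      rw [hc', part_succ (by omega)] at h3
      have h4 : lam ⟨c, by omega⟩ ≤ lam j := hlam (Fin.le_def.2 (by simp only; omega))
      have h5 : mu i ≤ mu ⟨M b, by omega⟩ := hmu (Fin.le_def.2 hMi)
      omega
  · intro H
    have hblk : ∀ (i : ℕ) (hi : i < n) (b : ℕ), b < r → M b ≤ i → i < M (b + 1) →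
        h.ell ⟨i, hi⟩ = L (b + 1) := by
      intro i hi b hb h1 h2
      have h3 := (h.cutsM.le_of_blk ⟨i, hi⟩ hb.le).1 h1
      have h4 := (h.cutsM.lt_iff ⟨i, hi⟩ (a := b + 1) hb).1 h2
      rw [ell, show (h.cutsM.blk ⟨i, hi⟩ : ℕ) = b by omega]
    constructor
    · intro b hb
      have h1 := h.cutsL.lt b hb
      have h2 := h.cutsM.lt b hb
      have hLn := h.cutsL.le_n (a := b + 1) hb
      have hMn := h.cutsM.le_n (a := b + 1) hb
      obtain ⟨c, hc'⟩ : ∃ c, L (b + 1) = c + 1 := ⟨L (b + 1) - 1, by omega⟩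
      rw [part_succ (by omega), hc', part_succ (by omega), H, hblk _ _ b hb le_rfl h2]
      simp only
      omega
    · intro b h1b hb
      obtain ⟨b, rfl⟩ : ∃ c, b = c + 1 := ⟨b - 1, by omega⟩
      have h1 := h.cutsL.lt _ hb
      have h2 := h.cutsM.lt b (by omega)
      have hLn := h.cutsL.le_n (a := b + 1 + 1) hb
      have hMn := h.cutsM.le_n (a := b + 1) hb.le
      obtain ⟨c, hc'⟩ : ∃ c, M (b + 1) = c + 1 := ⟨M (b + 1) - 1, by omega⟩
      rw [part_succ (by omega), hc', part_succ (by omega), ← not_le, H,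
        hblk c _ b (by omega) (by omega) (by omega)]
      simp

/-- The multiplicities in the block `b` of up-steps. -/
def IsBlocks.upMult (h : IsBlocks n r L M) (m : Fin n ⊕ Fin n → ℕ) (b : Fin r) :
    Fin (L (b + 1) - L b) → ℕ := fun k => m (Sum.inl (h.cutsL.equiv ⟨b, k⟩))

/-- The multiplicities in the block `b` of down-steps. -/
def IsBlocks.downMult (h : IsBlocks n r L M) (m : Fin n ⊕ Fin n → ℕ) (b : Fin r) :
    Fin (M (b + 1) - M b) → ℕ := fun k => m (Sum.inr (h.cutsM.equiv ⟨b, k⟩))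

theorem IsCuts.sub_pos (h : IsCuts n r L) (b : Fin r) : 0 < L (b + 1) - L b :=
  Nat.sub_pos_of_lt (h.lt b b.2)

/-- The last index of a nonempty block. -/
def lastIdx {k : ℕ} (hk : 0 < k) : Fin k := ⟨k - 1, by omega⟩

/-- The multiplicities at the valleys of the path are positive. -/
def IsBlocks.ValleyPos (h : IsBlocks n r L M) (m : Fin n ⊕ Fin n → ℕ) : Prop :=
  ∀ b : Fin r, (b : ℕ) + 1 < r → h.downMult m b (lastIdx (h.cutsM.sub_pos b)) ≠ 0

theorem IsBlocks.ell_equiv (h : IsBlocks n r L M) (x : Σ b : Fin r, Fin (M (b + 1) - M b)) :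
    h.ell (h.cutsM.equiv x) = L (x.1 + 1) := by rw [ell, h.cutsM.blk_equiv]

theorem IsBlocks.em_equiv (h : IsBlocks n r L M) (x : Σ b : Fin r, Fin (L (b + 1) - L b)) :
    h.em (h.cutsL.equiv x) = M x.1 := by rw [em, h.cutsL.blk_equiv]

/-- The multiplicity of the last down-step of a block is the drop from that part of `μ` to the first
part of `λ` in the next block, so it is positive exactly when the inequality at the valley is
strict. -/
theorem IsBlocks.valleyPos_iff (h : IsBlocks n r L M) (m : Fin n ⊕ Fin n → ℕ) :
    h.ValleyPos m ↔ ∀ i j : Fin n, (mergedPair h.ell h.em m).1 i ≤ (mergedPair h.ell h.em m).2 j ↔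
      (j : ℕ) < h.ell i := by
  have hp := h.isPath
  constructor
  · intro hv i j
    refine ⟨fun hle => ?_, (isMerged_mergedPair hp m).le i j⟩
    by_contra hc
    rw [not_lt] at hc
    have hbr : (h.cutsM.blk i : ℕ) + 1 < r := by
      rcases Nat.lt_or_ge ((h.cutsM.blk i : ℕ) + 1) r with hlt | hge
      · exact hlt
      · have h1 := (h.cutsM.blk i).2
        have := h.cutsL.last
        rw [show r = h.cutsM.blk i + 1 by omega] at this
        rw [ell] at hc
        have := j.2
        omega
    have h1 := hv (h.cutsM.blk i) hbr
    set x : Σ b : Fin r, Fin (M (b + 1) - M b) :=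
      ⟨h.cutsM.blk i, lastIdx (h.cutsM.sub_pos (h.cutsM.blk i))⟩ with hx
    have h2 := chain_rank hp m (Sum.inr (h.cutsM.equiv x))
    have h3 : rank h.ell h.em (Sum.inr (h.cutsM.equiv x)) < rank h.ell h.em (Sum.inl j) := by
      rw [rank_inr_lt_inl hp, h.ell_equiv]
      exact hc
    have h4 : i ≤ h.cutsM.equiv x := by
      rw [Fin.le_def, h.cutsM.val_equiv]
      have := h.cutsM.lt_blk i
      have := h.cutsM.lt _ (h.cutsM.blk i).2
      change (i : ℕ) ≤ M (h.cutsM.blk i) + (M (h.cutsM.blk i + 1) - M (h.cutsM.blk i) - 1)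
      omega
    have h5 : (mergedPair h.ell h.em m).1 (h.cutsM.equiv x) ≤ (mergedPair h.ell h.em m).1 i :=
      (isMerged_mergedPair hp m).anti_mu h4
    have h6 : chain h.ell h.em m (rank h.ell h.em (Sum.inl j)) ≤ _ := chain_antitone m h3
    change m (Sum.inr (h.cutsM.equiv x)) ≠ 0 at h1
    simp only [mergedPair, Nat.succ_eq_add_one] at hle h5 h6
    omega
  · intro H b hb h0
    have hL := h.cutsL.lt _ hb
    have hLn := h.cutsL.le_n (a := b + 1 + 1) hb
    have hM := h.cutsM.lt _ b.2
    set x : Σ b : Fin r, Fin (M (b + 1) - M b) := ⟨b, lastIdx (h.cutsM.sub_pos b)⟩ with hx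
    -- The first up-step of the next block; its position directly follows that of `x`.
    let y : Σ b : Fin r, Fin (L (b + 1) - L b) := ⟨⟨b + 1, hb⟩, ⟨0, by simp only; omega⟩⟩
    have h1 : rank h.ell h.em (Sum.inl (h.cutsL.equiv y)) =
        rank h.ell h.em (Sum.inr (h.cutsM.equiv x)) + 1 := by
      simp only [rank]
      rw [h.ell_equiv, h.em_equiv, h.cutsL.val_equiv, h.cutsM.val_equiv]
      change L (b + 1) + 0 + M (b + 1) = M b + (M (b + 1) - M b - 1) + L (b + 1) + 1
      omega
    have h2 := chain_rank hp m (Sum.inr (h.cutsM.equiv x))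
    have h3 := (H (h.cutsM.equiv x) (h.cutsL.equiv y)).1 (by
      simp only [mergedPair]
      rw [h1]
      change m (Sum.inr (h.cutsM.equiv x)) = 0 at h0
      omega)
    rw [h.ell_equiv, h.cutsL.val_equiv] at h3
    simp only [hx, y] at h3
    omega

theorem countGE_eq {v : Fin n → ℕ} (i : Fin n) {c : ℕ} (hc : c ≤ n)
    (h : ∀ j : Fin n, v i ≤ v j ↔ (j : ℕ) < c) : countGE v (v i) = c := by
  rw [countGE, ← card_filter_fin_lt hc]
  congr 1
  ext j
  simp only [Finset.mem_filter, Finset.mem_univ, true_and]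
  exact h j

theorem nextStep_le {h : ℕ} (m : Fin h → ℕ) {i : ℕ} (hi : i < h) : nextStep m i ≤ h :=
  (isLeast_nextStep m i).2 ⟨hi, Or.inl le_rfl⟩

theorem eq_zero_of_lt_nextStep {h : ℕ} (m : Fin h → ℕ) {i : ℕ} {k : Fin h} (hik : i ≤ k)
    (hk : (k : ℕ) + 1 < nextStep m i) : m k = 0 := by
  by_contra hc
  have := (isLeast_nextStep m i).2 ⟨Nat.lt_succ_of_le hik, Or.inr ⟨k, rfl, hc⟩⟩
  simp only [Nat.succ_eq_add_one] at this
  omega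

/-- Along a run of consecutive steps, an antitone chain is constant up to the next nonzero
multiplicity. -/
theorem chain_const_of_lt_nextStep {ell em : Fin n → ℕ} (hp : IsPath ell em)
    (m : Fin n ⊕ Fin n → ℕ) {h : ℕ} (x : Fin h → Fin n ⊕ Fin n) (c : ℕ)
    (hx : ∀ k, rank ell em (x k) = c + k) (k : Fin h) {l : ℕ} (hkl : (k : ℕ) ≤ l)
    (hl : l < nextStep (fun k => m (x k)) k) :
    chain ell em m (c + l) = chain ell em m (c + k) := by
  induction l, hkl using Nat.le_induction with
  | base => rfl
  | succ l hkl ih =>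
    have hlt := nextStep_le (fun k => m (x k)) k.2
    have h1 := eq_zero_of_lt_nextStep (fun k => m (x k)) (k := ⟨l, by omega⟩) hkl hl
    have h2 := chain_rank hp m (x ⟨l, by omega⟩)
    rw [hx] at h2
    simp only at h1 h2
    rw [← ih (by omega), ← add_assoc]
    omega

/-- Passing `nextStep` means passing a nonzero drop. When `nextStep` takes its default value at the
end of the run, the last drop need not be nonzero, and `hs` has to ensure it. -/
theorem chain_lt_of_nextStep {ell em : Fin n → ℕ} (hp : IsPath ell em)
    (m : Fin n ⊕ Fin n → ℕ) {h : ℕ} (x : Fin h → Fin n ⊕ Fin n) (c : ℕ)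
    (hx : ∀ k, rank ell em (x k) = c + k) (k : Fin h)
    (hs : h ≤ nextStep (fun k => m (x k)) k → m (x (lastIdx (k.pos))) ≠ 0) {d : ℕ}
    (hd : c + nextStep (fun k => m (x k)) k ≤ d) :
    chain ell em m d < chain ell em m (c + k) := by
  have h1 := isLeast_nextStep (fun k => m (x k)) k
  obtain ⟨l, hl, hml⟩ : ∃ l : Fin h, (l : ℕ) + 1 = nextStep (fun k => m (x k)) k ∧ m (x l) ≠ 0 := by
    rcases h1.1.2 with h2 | h2
    · refine ⟨_, ?_, hs h2⟩
      have := nextStep_le (fun k => m (x k)) k.2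
      have := k.2
      simp only [lastIdx]
      omega
    · exact h2
  have h3 := h1.1.1
  have h4 := chain_rank hp m (x l)
  have h5 := chain_antitone (ell := ell) (em := em) m hd
  have h6 := chain_antitone (ell := ell) (em := em) m (show c + (k : ℕ) ≤ c + l by omega)
  rw [hx] at h4
  rw [← hl, ← add_assoc] at h5
  omega

theorem IsBlocks.rank_inl_equiv (h : IsBlocks n r L M) (b : Fin r) (k : Fin (L (b + 1) - L b)) :
    rank h.ell h.em (Sum.inl (h.cutsL.equiv ⟨b, k⟩)) = L b + M b + k := by
  simp only [rank]
  rw [h.em_equiv, h.cutsL.val_equiv]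
  simp only
  omega

theorem IsBlocks.rank_inr_equiv (h : IsBlocks n r L M) (b : Fin r) (k : Fin (M (b + 1) - M b)) :
    rank h.ell h.em (Sum.inr (h.cutsM.equiv ⟨b, k⟩)) = M b + L (b + 1) + k := by
  simp only [rank]
  rw [h.ell_equiv, h.cutsM.val_equiv]
  simp only
  omega

/-- Equal parts of `μ` continue up to the next nonzero drop in their run. They cannot spill into the
next block, because the valley between the two is a strict descent. -/
theorem IsBlocks.countGE_fst (h : IsBlocks n r L M) {m : Fin n ⊕ Fin n → ℕ} (hv : h.ValleyPos m)
    (b : Fin r) (k : Fin (M (b + 1) - M b)) :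
    countGE (mergedPair h.ell h.em m).1 ((mergedPair h.ell h.em m).1 (h.cutsM.equiv ⟨b, k⟩)) =
      M b + nextStep (h.downMult m b) k := by
  have hp := h.isPath
  have hanti := (isMerged_mergedPair hp m).anti_mu
  have hs1 := nextStep_le (h.downMult m b) k.2
  have hs2 := (isLeast_nextStep (h.downMult m b) k).1.1
  have hMn := h.cutsM.le_n (a := b + 1) b.2
  have hMlt := h.cutsM.lt b b.2
  refine countGE_eq _ (by omega) fun j => ?_
  have hval : (mergedPair h.ell h.em m).1 (h.cutsM.equiv ⟨b, k⟩) =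
      chain h.ell h.em m (M b + L (b + 1) + k) := by rw [← h.rank_inr_equiv]; rfl
  constructor
  · intro hle
    by_contra hc
    rw [not_lt] at hc
    refine absurd hle (not_le.2 ?_)
    rw [hval]
    refine chain_lt_of_nextStep hp m (fun k => Sum.inr (h.cutsM.equiv ⟨b, k⟩)) _
      (h.rank_inr_equiv b) k (fun hge => ?_) ?_
    · refine hv b ?_
      by_contra hbr
      have := h.cutsM.last
      rw [show r = b + 1 by omega] at this
      have := j.2
      change M (b + 1) - M b ≤ nextStep (h.downMult m b) k at hge
      omega
    · change M b + L (b + 1) + nextStep (h.downMult m b) k ≤ j + h.ell j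
      have h1 : L (b + 1) ≤ h.ell j := by
        refine h.cutsL.le_of_le (Nat.succ_le_succ ?_) (h.cutsM.blk j).2
        exact (h.cutsM.le_of_blk j b.2.le).1 (by omega)
      omega
  · intro hj
    rcases Nat.lt_or_ge j (M b + k) with hlt | hge
    · exact hanti (Fin.le_def.2 (by rw [h.cutsM.val_equiv]; simp only; omega))
    · obtain ⟨l, hl⟩ : ∃ l, (j : ℕ) = M b + l := ⟨j - M b, by omega⟩
      have h2 : j = h.cutsM.equiv ⟨b, ⟨l, by omega⟩⟩ := Fin.ext hl
      have h3 := chain_const_of_lt_nextStep hp m (fun k => Sum.inr (h.cutsM.equiv ⟨b, k⟩)) _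
        (h.rank_inr_equiv b) k (l := l) (by omega)
        (show l < nextStep (h.downMult m b) k by omega)
      rw [hval, h2, ← h3]
      simp only [mergedPair]
      rw [h.rank_inr_equiv]

/-- As for `μ`, with one difference: the last drop of an up-run may vanish. The following down-run
then ends in a valley with positive drop, so the parts of `λ` in the next block are still strictly
smaller. -/
theorem IsBlocks.countGE_snd (h : IsBlocks n r L M) {m : Fin n ⊕ Fin n → ℕ} (hv : h.ValleyPos m)
    (b : Fin r) (k : Fin (L (b + 1) - L b)) :
    countGE (mergedPair h.ell h.em m).2 ((mergedPair h.ell h.em m).2 (h.cutsL.equiv ⟨b, k⟩)) =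
      L b + nextStep (h.upMult m b) k := by
  have hp := h.isPath
  have hanti := (isMerged_mergedPair hp m).anti_lam
  have hs1 := nextStep_le (h.upMult m b) k.2
  have hs2 := (isLeast_nextStep (h.upMult m b) k).1.1
  have hLn := h.cutsL.le_n (a := b + 1) b.2
  have hLlt := h.cutsL.lt b b.2
  have hMlt := h.cutsM.lt b b.2
  refine countGE_eq _ (by omega) fun j => ?_
  have hval : (mergedPair h.ell h.em m).2 (h.cutsL.equiv ⟨b, k⟩) =
      chain h.ell h.em m (L b + M b + k) := by rw [← h.rank_inl_equiv]; rfl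
  constructor
  · intro hle
    by_contra hc
    rw [not_lt] at hc
    refine absurd hle (not_le.2 ?_)
    by_cases hjb : (j : ℕ) < L (b + 1)
    · rw [hval]
      refine chain_lt_of_nextStep hp m (fun k => Sum.inl (h.cutsL.equiv ⟨b, k⟩)) _
        (h.rank_inl_equiv b) k (fun hge => ?_) ?_
      · change L (b + 1) - L b ≤ nextStep (h.upMult m b) k at hge
        omega
      · change L b + M b + nextStep (h.upMult m b) k ≤ j + h.em j
        have h1 : M b ≤ h.em j := by
          refine h.cutsM.le_of_le ?_ (h.cutsL.blk j).2.le
          exact (h.cutsL.le_of_blk j b.2.le).1 (by omega)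
        omega
    · have hbr : (b : ℕ) + 1 < r := by
        by_contra hbr
        have := h.cutsL.last
        rw [show r = b + 1 by omega] at this
        have := j.2
        omega
      have h1 := hv b hbr
      set x : Σ b : Fin r, Fin (M (b + 1) - M b) := ⟨b, lastIdx (h.cutsM.sub_pos b)⟩ with hx
      have h2 := chain_rank hp m (Sum.inr (h.cutsM.equiv x))
      have h3 : rank h.ell h.em (Sum.inr (h.cutsM.equiv x)) < rank h.ell h.em (Sum.inl j) := by
        rw [rank_inr_lt_inl hp, h.ell_equiv]
        simp only [hx]
        omega
      have h4 : rank h.ell h.em (Sum.inl (h.cutsL.equiv ⟨b, k⟩)) <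
          rank h.ell h.em (Sum.inr (h.cutsM.equiv x)) := by
        rw [rank_inl_lt_inr hp, h.ell_equiv, h.cutsL.val_equiv]
        simp only [hx]
        omega
      have h5 := chain_antitone (ell := h.ell) (em := h.em) m h3
      have h6 := chain_antitone (ell := h.ell) (em := h.em) m h4.le
      change m (Sum.inr (h.cutsM.equiv x)) ≠ 0 at h1
      simp only [mergedPair, Nat.succ_eq_add_one] at h5 h6 ⊢
      omega
  · intro hj
    rcases Nat.lt_or_ge j (L b + k) with hlt | hge
    · exact hanti (Fin.le_def.2 (by rw [h.cutsL.val_equiv]; simp only; omega))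
    · obtain ⟨l, hl⟩ : ∃ l, (j : ℕ) = L b + l := ⟨j - L b, by omega⟩
      have h2 : j = h.cutsL.equiv ⟨b, ⟨l, by omega⟩⟩ := Fin.ext hl
      have h3 := chain_const_of_lt_nextStep hp m (fun k => Sum.inl (h.cutsL.equiv ⟨b, k⟩)) _
        (h.rank_inl_equiv b) k (l := l) (by omega)
        (show l < nextStep (h.upMult m b) k by omega)
      rw [hval, h2, ← h3]
      simp only [mergedPair]
      rw [h.rank_inl_equiv]

end Blocks

end HeisenbergZeta
end

noncomputable section
namespace HeisenbergZeta

/-! ### The sum over the pairs of partitions of a given overlap type -/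

/-- For `e = f = 1` the blocks of positions are singletons and `δ = 0`, so the condition is vacuous.
-/
theorem isAdm_one {n : ℕ} (l : Fin n → ℕ) : IsAdm (fun _ : Fin n => 1) (fun _ => 1) l := by
  refine fun i => ⟨0, one_pos, l i, fun j => ?_⟩
  intro C hC
  have h1 : C = i := by
    simp only [C, mul_one, Finset.sum_const, smul_eq_mul]
    rw [show (Finset.univ.filter fun k : Fin n => k < i) = Finset.Iio i by ext; simp, Fin.card_Iio]
  have h3 : C ≤ j ∧ (j : ℕ) < C + 1 := by simpa only [mul_one] using hC
  have h2 : j = i := Fin.ext (by omega)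
  rw [h2, if_neg (by simp only [zero_mul]; omega)]

theorem countGE_self_gt {n : ℕ} {v : Fin n → ℕ} (hv : Antitone v) (i : Fin n) :
    (i : ℕ) < countGE v (v i) := le_countGE hv le_rfl i

theorem finite_sortDesc_eq {n : ℕ} {lam : Fin n → ℕ} (hlam : Antitone lam) :
    Finite {l : Fin n → ℕ // sortDesc l = lam} := by
  refine (Nat.card_ne_zero.1 fun h0 => ?_).2
  have h := card_sortDesc_eq hlam
  rw [h0, zero_mul] at h
  have h2 : ∏ i : Fin n, (n - (i : ℕ)) ≠ 0 :=
    Finset.prod_ne_zero_iff.2 fun i _ => by omega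
  exact h2 h.symm

theorem sum_eq_of_sortDesc_eq {n : ℕ} {l lam : Fin n → ℕ} (h : sortDesc l = lam) :
    ∑ i, l i = ∑ i, lam i := by
  rw [← h, sortDesc_eq_comp]
  exact (Equiv.sum_comp _ l).symm

theorem dyckTerm_one {n : ℕ} (p : ℕ) (t : ℂ) {x : (Fin n → ℕ) × (Fin n → ℕ)}
    (hx : Antitone x.2) :
    dyckTerm (fun _ : Fin n => 1) (fun _ => 1) p t x =
      (alpha x.2 x.1 p : ℂ) * ((p : ℂ) ^ (2 * n) * t) ^ (∑ i, x.1 i) *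
        ((Nat.card {l : Fin n → ℕ // sortDesc l = x.2} : ℂ) * t ^ (2 * ∑ i, x.2 i)) := by
  have : Finite {l : Fin n → ℕ | sortDesc l = x.2} := finite_sortDesc_eq hx
  rw [dyckTerm]
  congr 1
  have h1 : {l : Fin n → ℕ | IsAdm (fun _ : Fin n => 1) (fun _ => 1) l ∧ sortDesc l = x.2} =
      {l | sortDesc l = x.2} := by
    ext l
    exact and_iff_right (isAdm_one l)
  rw [h1, finsum_mem_congr rfl (g := fun _ => t ^ (2 * ∑ i, x.2 i)) fun l hl => by
    rw [sum_eq_of_sortDesc_eq hl], finsum_mem_eq_finite_toFinset_sum _ (Set.toFinite _),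
    Finset.sum_const, nsmul_eq_mul, ← Set.ncard_eq_toFinset_card _ (Set.toFinite _)]
  rfl

theorem card_sortDesc_eq_div {n : ℕ} {lam : Fin n → ℕ} (hlam : Antitone lam) :
    (Nat.card {l : Fin n → ℕ // sortDesc l = lam} : ℂ) =
      (n.factorial : ℂ) / ∏ i : Fin n, ((countGE lam (lam i) - i : ℕ) : ℂ) := by
  have h := congrArg (Nat.cast : ℕ → ℂ) (card_sortDesc_eq hlam)
  have h1 : ∏ i : Fin n, (n - (i : ℕ)) = n.factorial := by
    rw [Fin.prod_univ_eq_prod_range (fun i => n - i), ← Nat.descFactorial_eq_prod_range,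
      Nat.descFactorial_self]
  rw [h1] at h
  rw [eq_div_iff, ← h]
  · push_cast
    rfl
  · refine Finset.prod_ne_zero_iff.2 fun i _ => ?_
    have := countGE_self_gt hlam i
    rw [Nat.cast_ne_zero]
    omega

theorem inv_pow_ne_one {p : ℕ} (hp : p.Prime) (k : ℕ) (hk : 0 < k) : ((p : ℂ)⁻¹) ^ k ≠ 1 := by
  intro h
  have h2 := congrArg norm h
  rw [norm_pow, norm_inv, Complex.norm_natCast, norm_one] at h2
  have h1 : (p : ℝ)⁻¹ < 1 := inv_lt_one_of_one_lt₀ (by exact_mod_cast hp.one_lt)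
  exact (pow_lt_one₀ (by positivity) h1 hk.ne').ne h2

theorem alpha_eq_complex {p : ℕ} (hp : p.Prime) {n : ℕ} {lam mu : Fin n → ℕ} (hmu : Antitone mu)
    (hle : mu ≤ lam) :
    (alpha lam mu p : ℂ) = (p : ℂ) ^ (∑ i, ∑ j, (min (mu i) (lam j) - min (mu i) (mu j))) *
      ∏ i : Fin n, ((1 - ((p : ℂ)⁻¹) ^ (countGE lam (mu i) - i)) /
          (1 - ((p : ℂ)⁻¹) ^ (countGE mu (mu i) - i))) := by
  have h := congrArg (Rat.cast : ℚ → ℂ) (alpha_eq hp hmu hle)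
  rw [Rat.cast_natCast] at h
  rw [h, Finset.prod_mul_distrib, Finset.prod_pow_eq_pow_sum]
  push_cast
  rfl

/-! ### Factorization of the summand over the blocks -/

section Blocks

variable {n r : ℕ} {L M : ℕ → ℕ}

/-- The weight of a step of the path. -/
def stepWeight (ell em : Fin n → ℕ) (X t : ℂ) (x : Fin n ⊕ Fin n) : ℂ :=
  X ^ (downCount ell em (rank ell em x) * (2 * n + upCount ell em (rank ell em x) -
      downCount ell em (rank ell em x))) *
    t ^ (2 * upCount ell em (rank ell em x) + downCount ell em (rank ell em x))

theorem IsBlocks.stepWeight_inl (h : IsBlocks n r L M) (X t : ℂ) (b : Fin r)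
    (k : Fin (L (b + 1) - L b)) :
    stepWeight h.ell h.em X t (Sum.inl (h.cutsL.equiv ⟨b, k⟩)) =
      numY n M X t (b + 1) (L b + (k + 1)) := by
  have h1 := h.cutsM.le_n b.2.le
  rw [stepWeight, downCount_inl h.isPath, upCount_inl h.isPath, h.em_equiv, h.cutsL.val_equiv, numY]
  simp only [Nat.add_sub_cancel]
  rw [mul_comm (M b)]
  congr 3
  omega

theorem IsBlocks.stepWeight_inr (h : IsBlocks n r L M) (X t : ℂ) (b : Fin r)
    (k : Fin (M (b + 1) - M b)) :
    stepWeight h.ell h.em X t (Sum.inr (h.cutsM.equiv ⟨b, k⟩)) =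
      numX n L X t (b + 1) (M b + (k + 1)) := by
  rw [stepWeight, downCount_inr h.isPath, upCount_inr h.isPath, h.ell_equiv, h.cutsM.val_equiv,
    numX]
  simp only [add_assoc]

/-- All exponents of `p` and `t` in the summand are linear in the drops, so together they form a
monomial with one weight for each step. -/
theorem stepWeight_power (ell em : Fin n → ℕ) (X t : ℂ) (m : Fin n ⊕ Fin n → ℕ)
    (hle : (mergedPair ell em m).1 ≤ (mergedPair ell em m).2) :
    X ^ (∑ i, ∑ j, (min ((mergedPair ell em m).1 i) ((mergedPair ell em m).2 j) -
        min ((mergedPair ell em m).1 i) ((mergedPair ell em m).1 j))) *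
      (X ^ (2 * n) * t) ^ (∑ i, (mergedPair ell em m).1 i) *
      t ^ (2 * ∑ i, (mergedPair ell em m).2 i) = ∏ x, stepWeight ell em X t x ^ m x := by
  have h1 := sum_exponent_mergedPair m hle
  simp only [stepWeight, mul_pow, Finset.prod_mul_distrib, ← pow_mul, Finset.prod_pow_eq_pow_sum]
  rw [← mul_assoc, ← pow_add, h1, mul_assoc, ← pow_add]
  congr 2
  · exact Finset.sum_congr rfl fun x _ => mul_comm _ _
  · rw [sum_fst_mergedPair, sum_snd_mergedPair, Finset.mul_sum, ← Finset.sum_add_distrib]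
    exact Finset.sum_congr rfl fun x _ => by ring

/-- The factor of the summand that depends on the multiplicities in the `b`-th up-run. -/
def upFactor (n : ℕ) (L M : ℕ → ℕ) (X t : ℂ) (b : ℕ) (m : Fin (L (b + 1) - L b) → ℕ) : ℂ :=
  ∏ k : Fin (L (b + 1) - L b),
    (numY n M X t (b + 1) (L b + (k + 1)) ^ m k / ((nextStep m k - k : ℕ) : ℂ))

/-- The factor of the summand that depends on the multiplicities in the `b`-th down-run. -/
def downFactor (n : ℕ) (L M : ℕ → ℕ) (X t : ℂ) (b : ℕ) (m : Fin (M (b + 1) - M b) → ℕ) : ℂ :=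
  ∏ k : Fin (M (b + 1) - M b),
    (numX n L X t (b + 1) (M b + (k + 1)) ^ m k / (1 - X⁻¹ ^ (nextStep m k - k)))

theorem IsCuts.prod_eq (h : IsCuts n r L) (f : Fin n → ℂ) :
    ∏ i, f i = ∏ b : Fin r, ∏ k : Fin (L (b + 1) - L b), f (h.equiv ⟨b, k⟩) := by
  rw [← h.equiv.prod_comp, Fintype.prod_sigma]

theorem IsBlocks.mergedPair_le (h : IsBlocks n r L M) (m : Fin n ⊕ Fin n → ℕ) :
    (mergedPair h.ell h.em m).1 ≤ (mergedPair h.ell h.em m).2 :=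
  fun i => (isMerged_mergedPair h.isPath m).le i i (h.lt_ell i)

/-- The numerators of `alpha` involve only the number of parts of `λ` that are at least `μ_i`, which
is `h.ell i` and hence constant on the overlap type. The denominators involve multiplicities of
equal parts, which are visible inside a single run. -/
theorem IsBlocks.dyckTerm_mergedPair (h : IsBlocks n r L M) {p : ℕ} (hp : p.Prime) (t : ℂ)
    {m : Fin n ⊕ Fin n → ℕ} (hv : h.ValleyPos m) :
    dyckTerm (fun _ : Fin n => 1) (fun _ => 1) p t (mergedPair h.ell h.em m) =
      ((n.factorial : ℂ) * ∏ i : Fin n, (1 - ((p : ℂ)⁻¹) ^ (h.ell i - i))) *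
        ((∏ b : Fin r, upFactor n L M p t b (h.upMult m b)) *
          ∏ b : Fin r, downFactor n L M p t b (h.downMult m b)) := by
  have hm := isMerged_mergedPair h.isPath m
  have hle := h.mergedPair_le m
  have hw := stepWeight_power h.ell h.em (p : ℂ) t m hle
  rw [Fintype.prod_sum_type, h.cutsL.prod_eq, h.cutsM.prod_eq] at hw
  simp only [h.stepWeight_inl, h.stepWeight_inr] at hw
  rw [dyckTerm_one p t hm.anti_lam, alpha_eq_complex hp hm.anti_mu hle,
    card_sortDesc_eq_div hm.anti_lam, Finset.prod_div_distrib]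
  have hell : ∀ i, countGE (mergedPair h.ell h.em m).2 ((mergedPair h.ell h.em m).1 i) =
      h.ell i := by
    intro i
    rw [countGE, ← card_filter_fin_lt (h.isPath.ell_le i)]
    congr 1
    ext j
    simp only [Finset.mem_filter, Finset.mem_univ, true_and]
    exact (h.valleyPos_iff m).1 hv i j
  simp only [hell]
  rw [h.cutsM.prod_eq (fun i => 1 - ((p : ℂ)⁻¹) ^
      (countGE (mergedPair h.ell h.em m).1 ((mergedPair h.ell h.em m).1 i) - i)),
    h.cutsL.prod_eq (fun i =>
      ((countGE (mergedPair h.ell h.em m).2 ((mergedPair h.ell h.em m).2 i) - i : ℕ) : ℂ))]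
  simp only [h.countGE_fst hv, h.countGE_snd hv, h.cutsM.val_equiv, h.cutsL.val_equiv,
    Nat.add_sub_add_left]
  simp only [upFactor, downFactor, Finset.prod_div_distrib]
  simp only [IsBlocks.upMult, IsBlocks.downMult] at hw ⊢
  rw [div_mul_div_comm, mul_div_assoc', ← hw]
  ring

/-- Splitting the multiplicities into blocks. -/
def IsBlocks.multEquiv (h : IsBlocks n r L M) : (Fin n ⊕ Fin n → ℕ) ≃
    (∀ b : Fin r, Fin (L (b + 1) - L b) → ℕ) × (∀ b : Fin r, Fin (M (b + 1) - M b) → ℕ) where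
  toFun m := (h.upMult m, h.downMult m)
  invFun y := Sum.elim (fun j => y.1 (h.cutsL.equiv.symm j).1 (h.cutsL.equiv.symm j).2)
    (fun i => y.2 (h.cutsM.equiv.symm i).1 (h.cutsM.equiv.symm i).2)
  left_inv m := by
    funext x
    rcases x with j | i
    · simp [IsBlocks.upMult]
    · simp [IsBlocks.downMult]
  right_inv y := by
    refine Prod.ext (funext fun b => funext fun k => ?_) (funext fun b => funext fun k => ?_)
    · simp only [IsBlocks.upMult, Sum.elim_inl]
      rw [Equiv.symm_apply_apply]
    · simp only [IsBlocks.downMult, Sum.elim_inr]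
      rw [Equiv.symm_apply_apply]

theorem hasSum_igusaSum_lastIdx {h : ℕ} (hh : 0 < h) {Y : ℂ} {φ : ℕ → ℂ} (hφ : IsGaussValue Y φ)
    {X : ℕ → ℂ} (hX : ∀ i, 1 ≤ i → i ≤ h → ‖X i‖ < 1) (ε : ℂ) :
    HasSum (fun m : Fin h → ℕ => (if m (lastIdx hh) = 0 then ε else 1) *
        ∏ i : Fin h, (X (i + 1) ^ m i / φ (nextStep m i - i)))
      ((ε + X h / (1 - X h)) * igusaSum h Y X / genFactorial φ h) := by
  obtain ⟨h, rfl⟩ : ∃ k, h = k + 1 := ⟨h - 1, by omega⟩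
  exact hasSum_igusaSum hφ hX ε

theorem one_add_div_one_sub {x : ℂ} (hx : ‖x‖ < 1) : 1 + x / (1 - x) = 1 / (1 - x) := by
  have : 1 - x ≠ 0 := sub_ne_zero.2 fun h => by simp [← h] at hx
  field_simp
  ring

theorem chainProd_choose_mul {L : ℕ → ℕ} (h0 : L 0 = 0) (r : ℕ)
    (hL : ∀ i < r + 1, L i < L (i + 1)) :
    chainProd Nat.choose (L (r + 1)) ((List.range r).reverse.map fun i => L (i + 1)) *
      ∏ b ∈ Finset.range (r + 1), (L (b + 1) - L b).factorial = (L (r + 1)).factorial := by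
  induction r with
  | zero => simp [chainProd, h0]
  | succ r ih =>
    have h1 := ih fun i hi => hL i (by omega)
    have h2 := (hL (r + 1) (by omega)).le
    rw [List.range_succ, List.reverse_append, List.reverse_singleton, List.singleton_append,
      List.map_cons, chainProd, Finset.prod_range_succ, ← Nat.choose_mul_factorial_mul_factorial h2,
      ← h1]
    ring

theorem IsCuts.multinomial_mul (h : IsCuts n (r + 1) L) :
    (multinomial n ((Finset.Icc 1 r).image L) : ℂ) *
      ∏ b : Fin (r + 1), ((L (b + 1) - L b).factorial : ℂ) = n.factorial := by
  have hsort : ((Finset.Icc 1 r).image L).sort (· ≥ ·) =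
      (List.range r).reverse.map fun i => L (i + 1) := by
    have hs : ((List.range r).reverse.map fun i => L (i + 1)).Pairwise (· > ·) := by
      rw [List.pairwise_map, List.pairwise_reverse]
      refine (List.pairwise_lt_range (n := r)).imp_of_mem fun {a b} ha hb hab => ?_
      rw [List.mem_range] at ha hb
      exact h.lt_of_lt (by omega) (by omega)
    refine List.Perm.eq_of_pairwise' (r := (· ≥ ·)) ?_ (hs.imp fun hab => hab.le) ?_
    · exact Finset.pairwise_sort _ _
    · rw [List.perm_ext_iff_of_nodup (Finset.sort_nodup _ _) (hs.imp fun hab => hab.ne')]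
      intro a
      simp only [Finset.mem_sort, Finset.mem_image, Finset.mem_Icc, List.mem_map, List.mem_reverse,
        List.mem_range]
      constructor
      · rintro ⟨i, hi, rfl⟩
        exact ⟨i - 1, by omega, by rw [Nat.sub_add_cancel hi.1]⟩
      · rintro ⟨i, hi, rfl⟩
        exact ⟨i + 1, by omega, rfl⟩
  have h1 := chainProd_choose_mul h.zero r h.lt
  rw [multinomial, hsort, Fin.prod_univ_eq_prod_range (fun b => ((L (b + 1) - L b).factorial : ℂ))]
  rw [h.last] at h1
  exact_mod_cast h1

/-- On the `b`-th down-run `ell` is constant, so the exponents descend from `L (b + 1) - M b` to `L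
(b + 1) - M (b + 1) + 1`: a falling factorial, that is, a binomial times the factorial of the run
length. This factorial cancels the one produced by the Igusa sum of the run. -/
theorem IsBlocks.prod_ell (h : IsBlocks n r L M) {Y : ℂ} (hY : ∀ k, 0 < k → Y ^ k ≠ 1) :
    ∏ i : Fin n, (1 - Y ^ (h.ell i - i)) =
      ∏ b : Fin r, (Polynomial.aeval Y (gaussBinom (L (b + 1) - M b) (L (b + 1) - M (b + 1))) *
        genFactorial (fun k => 1 - Y ^ k) (M (b + 1) - M b)) := by
  rw [h.cutsM.prod_eq]
  refine Finset.prod_congr rfl fun b _ => ?_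
  have hg := isGaussValue_of_pow_ne_one hY
  have hM := h.cutsM.lt b b.2
  have hLM := h.le (b + 1) b.2
  have h1 := hg.binom (L (b + 1) - M b) (L (b + 1) - M (b + 1)) (by omega)
  rw [show L (b + 1) - M b - (L (b + 1) - M (b + 1)) = M (b + 1) - M b by omega] at h1
  have h2 := genFactorial_ne_zero hg.ne_zero (L (b + 1) - M (b + 1))
  rw [← mul_left_inj' h2, mul_assoc, mul_comm (genFactorial _ (M (b + 1) - M b)), h1]
  simp only [h.ell_equiv, h.cutsM.val_equiv]
  rw [Fin.prod_univ_eq_prod_range (fun k => 1 - Y ^ (L (b + 1) - (M b + k))), genFactorial,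
    genFactorial, mul_comm, show L (b + 1) - M b = (L (b + 1) - M (b + 1)) + (M (b + 1) - M b) by
      omega, Finset.prod_range_add,
    ← Finset.prod_range_reflect (fun k => 1 - Y ^ (L (b + 1) - M (b + 1) + k + 1))]
  congr 1
  refine Finset.prod_congr rfl fun k hk => ?_
  rw [Finset.mem_range] at hk
  congr 2
  omega

theorem prod_Icc_one_eq (r : ℕ) (f : ℕ → ℂ) :
    ∏ i ∈ Finset.Icc 1 r, f i = ∏ b : Fin r, f (b + 1) := by
  rw [Fin.prod_univ_eq_prod_range (fun b => f (b + 1)), Finset.range_eq_Ico,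
    Finset.prod_Ico_add' f 0 r 1]
  rfl

theorem IsBlocks.hasSum_mult (h : IsBlocks n (r + 1) L M) {p : ℕ} (hp : p.Prime) {t : ℂ}
    (hX : ∀ b < r + 1, ∀ j, M b < j → j ≤ M (b + 1) → ‖numX n L (p : ℂ) t (b + 1) j‖ < 1)
    (hY : ∀ b < r + 1, ∀ j, L b < j → j ≤ L (b + 1) → ‖numY n M (p : ℂ) t (b + 1) j‖ < 1) :
    HasSum ({m | h.ValleyPos m}.indicator fun m =>
      dyckTerm (fun _ : Fin n => 1) (fun _ => 1) p t (mergedPair h.ell h.em m))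
      (splitProduct n (r + 1) L M (p : ℂ) t) := by
  classical
  have hq := inv_pow_ne_one hp
  -- Every down-run but the last ends in a valley. Weight `0` there encodes positivity and leads to
  -- `igusaCirc`; weight `1` on the last run leads to `igusa`.
  let ε : Fin (r + 1) → ℂ := fun b => if (b : ℕ) + 1 < r + 1 then 0 else 1
  have h1 : ∀ b : Fin (r + 1), HasSum (fun m => upFactor n L M p t b m)
      (igusa (L (b + 1) - L b) 1 (fun k => numY n M (p : ℂ) t (b + 1) (L b + k)) /
        ((L (b + 1) - L b).factorial : ℂ)) := by
    intro b
    have h2 := hasSum_igusaSum_lastIdx (h.cutsL.sub_pos b) isGaussValue_one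
      (X := fun k => numY n M (p : ℂ) t (b + 1) (L b + k))
      (fun i hi hi' => hY b b.2 _ (by omega) (by omega)) 1
    have h0 := h.cutsL.sub_pos b
    rw [one_add_div_one_sub (hY b b.2 _ (by omega) (by omega)),
      genFactorial_natCast] at h2
    simpa only [ite_self, one_mul] using! h2
  have h2 : ∀ b : Fin (r + 1), HasSum (fun m : Fin (M (b + 1) - M b) → ℕ =>
      (if m (lastIdx (h.cutsM.sub_pos b)) = 0 then ε b else 1) * downFactor n L M p t b m)
      ((ε b + numX n L (p : ℂ) t (b + 1) (M b + (M (b + 1) - M b)) /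
        (1 - numX n L (p : ℂ) t (b + 1) (M b + (M (b + 1) - M b)))) *
        igusaSum (M (b + 1) - M b) (p : ℂ)⁻¹ (fun k => numX n L (p : ℂ) t (b + 1) (M b + k)) /
        genFactorial (fun k => 1 - (p : ℂ)⁻¹ ^ k) (M (b + 1) - M b)) := fun b =>
    hasSum_igusaSum_lastIdx (h.cutsM.sub_pos b) (isGaussValue_of_pow_ne_one hq)
      (X := fun k => numX n L (p : ℂ) t (b + 1) (M b + k))
      (fun i hi hi' => hX b b.2 _ (by omega) (by omega)) (ε b)
  have h3 := ((HasSum.mul_complex (hasSum_pi_prod h1) (hasSum_pi_prod h2)).mul_left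
    ((n.factorial : ℂ) * ∏ i : Fin n, (1 - ((p : ℂ)⁻¹) ^ (h.ell i - i))))
  rw [← h.multEquiv.hasSum_iff] at h3
  have e1 : ({m | h.ValleyPos m}.indicator fun m =>
      dyckTerm (fun _ : Fin n => 1) (fun _ => 1) p t (mergedPair h.ell h.em m)) = fun m =>
      ((n.factorial : ℂ) * ∏ i : Fin n, (1 - ((p : ℂ)⁻¹) ^ (h.ell i - i))) *
        ((∏ b : Fin (r + 1), upFactor n L M p t b (h.upMult m b)) *
          ∏ b : Fin (r + 1), ((if h.downMult m b (lastIdx (h.cutsM.sub_pos b)) = 0 then ε b else 1) *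
            downFactor n L M p t b (h.downMult m b))) := by
    funext m
    by_cases hv : h.ValleyPos m
    · rw [Set.indicator_of_mem (show m ∈ {m | h.ValleyPos m} from hv), h.dyckTerm_mergedPair hp t hv]
      congr 2
      refine Finset.prod_congr rfl fun b _ => ?_
      by_cases hb : (b : ℕ) + 1 < r + 1
      · rw [if_neg (hv b hb), one_mul]
      · simp only [ε, if_neg hb, ite_self, one_mul]
    · rw [Set.indicator_of_notMem (show m ∉ {m | h.ValleyPos m} from hv)]
      simp only [IsBlocks.ValleyPos, not_forall, not_not] at hv
      obtain ⟨b, hb, h0⟩ := hv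
      rw [Finset.prod_eq_zero (i := b) (f := fun b : Fin (r + 1) =>
        (if h.downMult m b (lastIdx (h.cutsM.sub_pos b)) = 0 then ε b else 1) *
            downFactor n L M p t b (h.downMult m b)) (Finset.mem_univ b), mul_zero, mul_zero]
      rw [if_pos h0]
      simp only [ε, if_pos hb, zero_mul]
  have e2 : splitProduct n (r + 1) L M (p : ℂ) t =
      ((n.factorial : ℂ) * ∏ i : Fin n, (1 - ((p : ℂ)⁻¹) ^ (h.ell i - i))) *
      ((∏ b : Fin (r + 1), igusa (L (b + 1) - L b) 1
          (fun k => numY n M (p : ℂ) t (b + 1) (L b + k)) / ((L (b + 1) - L b).factorial : ℂ)) *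
        ∏ b : Fin (r + 1), ((ε b + numX n L (p : ℂ) t (b + 1) (M b + (M (b + 1) - M b)) /
        (1 - numX n L (p : ℂ) t (b + 1) (M b + (M (b + 1) - M b)))) *
        igusaSum (M (b + 1) - M b) (p : ℂ)⁻¹ (fun k => numX n L (p : ℂ) t (b + 1) (M b + k)) /
        genFactorial (fun k => 1 - (p : ℂ)⁻¹ ^ k) (M (b + 1) - M b))) := by
    -- The last down-run has length `n - M r`, because `M (r + 1) = n`; it is split off as the
    -- factor outside the product.
    have hx : ∏ b : Fin (r + 1), ((ε b + numX n L (p : ℂ) t (b + 1) (M b + (M (b + 1) - M b)) /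
        (1 - numX n L (p : ℂ) t (b + 1) (M b + (M (b + 1) - M b)))) *
        igusaSum (M (b + 1) - M b) (p : ℂ)⁻¹ (fun k => numX n L (p : ℂ) t (b + 1) (M b + k))) =
        (∏ b : Fin r, igusaCirc (M (b + 1) - M b) (p : ℂ)⁻¹
          (fun k => numX n L (p : ℂ) t (b + 1) (M b + k))) *
        igusa (n - M r) (p : ℂ)⁻¹ fun k => numX n L (p : ℂ) t (r + 1) (M r + k) := by
      rw [Fin.prod_univ_castSucc]
      congr 1
      · refine Finset.prod_congr rfl fun b _ => ?_
        simp only [ε, Fin.val_castSucc, igusaCirc]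
        rw [if_pos (by omega), zero_add]
      · have hM := h.cutsM.lt r (by omega)
        simp only [ε, Fin.val_last, lt_irrefl, if_false, igusa]
        rw [h.cutsM.last, one_add_div_one_sub (hX r (by omega) _
          (by have := h.cutsM.last; omega) (by have := h.cutsM.last; omega))]
    have hfac : ∏ b : Fin (r + 1), ((L (b + 1) - L b).factorial : ℂ) ≠ 0 :=
      Finset.prod_ne_zero_iff.2 fun b _ => by exact_mod_cast Nat.factorial_ne_zero _
    have hgen : ∏ b : Fin (r + 1), genFactorial (fun k => 1 - (p : ℂ)⁻¹ ^ k) (M (b + 1) - M b) ≠ 0 :=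
      Finset.prod_ne_zero_iff.2 fun b _ =>
        genFactorial_ne_zero (isGaussValue_of_pow_ne_one hq).ne_zero _
    rw [splitProduct, Nat.add_sub_cancel, prod_Icc_one_eq, prod_Icc_one_eq, prod_Icc_one_eq,
      h.prod_ell hq, Finset.prod_mul_distrib, Finset.prod_div_distrib, Finset.prod_div_distrib, hx,
      ← h.cutsL.multinomial_mul]
    simp only [Nat.add_sub_cancel]
    generalize ∏ b : Fin (r + 1), ((L (b + 1) - L b).factorial : ℂ) = A at hfac ⊢
    generalize ∏ b : Fin (r + 1), genFactorial (fun k => 1 - (p : ℂ)⁻¹ ^ k) (M (b + 1) - M b) = B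
      at hgen ⊢
    generalize (p : ℂ)⁻¹ = q
    field_simp
  rw [e1, e2]
  exact h3

theorem IsBlocks.hasSum_overlapAt (h : IsBlocks n (r + 1) L M) {p : ℕ} (hp : p.Prime) {t : ℂ}
    (hX : ∀ b < r + 1, ∀ j, M b < j → j ≤ M (b + 1) → ‖numX n L (p : ℂ) t (b + 1) j‖ < 1)
    (hY : ∀ b < r + 1, ∀ j, L b < j → j ≤ L (b + 1) → ‖numY n M (p : ℂ) t (b + 1) j‖ < 1) :
    HasSum (fun x : {x : (Fin n → ℕ) × (Fin n → ℕ) // Antitone x.1 ∧ Antitone x.2 ∧ x.1 ≤ x.2 ∧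
      OverlapAt (r + 1) L M x.1 x.2} => dyckTerm (fun _ : Fin n => 1) (fun _ => 1) p t x.1)
      (splitProduct n (r + 1) L M (p : ℂ) t) := by
  have h1 := hasSum_subtype_iff_indicator.2 (h.hasSum_mult hp hX hY)
  have hmem : ∀ m, h.ValleyPos m → Antitone (mergedPair h.ell h.em m).1 ∧
      Antitone (mergedPair h.ell h.em m).2 ∧
      (mergedPair h.ell h.em m).1 ≤ (mergedPair h.ell h.em m).2 ∧
      OverlapAt (r + 1) L M (mergedPair h.ell h.em m).1 (mergedPair h.ell h.em m).2 := by
    intro m hv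
    have hm := isMerged_mergedPair h.isPath m
    exact ⟨hm.anti_mu, hm.anti_lam, h.mergedPair_le m,
      (h.overlapAt_iff hm.anti_mu hm.anti_lam).2 ((h.valleyPos_iff m).1 hv)⟩
  let g : {m | h.ValleyPos m} → {x : (Fin n → ℕ) × (Fin n → ℕ) // Antitone x.1 ∧ Antitone x.2 ∧
      x.1 ≤ x.2 ∧ OverlapAt (r + 1) L M x.1 x.2} :=
    fun m => ⟨mergedPair h.ell h.em m.1, hmem m.1 m.2⟩
  have hb := bijective_mergedPair h.isPath
  have hg : Function.Bijective g := by
    constructor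
    · intro m m' hm
      have hm' : mergedPair h.ell h.em m.1 = mergedPair h.ell h.em m'.1 := congrArg Subtype.val hm
      exact Subtype.ext (hb.1 (Subtype.ext hm'))
    · rintro ⟨x, hx1, hx2, hx3, hx4⟩
      have hx5 := (h.overlapAt_iff hx1 hx2).1 hx4
      obtain ⟨m, hm⟩ := hb.2 ⟨x, hx1, hx2, fun i j hij => (hx5 i j).2 hij, fun i j hij =>
        (not_le.1 fun hc => absurd ((hx5 i j).1 hc) (not_lt.2 hij)).le⟩
      have hm' : mergedPair h.ell h.em m = x := Subtype.ext_iff.1 hm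
      exact ⟨⟨m, (h.valleyPos_iff m).2 (by rw [hm']; exact hx5)⟩, Subtype.ext hm'⟩
  rw [← (Equiv.ofBijective g hg).hasSum_iff]
  exact h1

end Blocks

end HeisenbergZeta
end

noncomputable section
namespace HeisenbergZeta

/-! ### Dyck words and overlap types -/

open DyckStep in
/-- Some initial segment of the word has `u` letters `U` and `d` letters `D`. -/
def HasPoint (W : List DyckStep) (u d : ℕ) : Prop :=
  ∃ l, l <+: W ∧ l.count U = u ∧ l.count D = d

/-- Initial segments of one word are nested. This alone forces the up-counts to be unique, and
conversely the word to be determined by them. -/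
theorem HasPoint.total {W : List DyckStep} {u d u' d' : ℕ} (h : HasPoint W u d)
    (h' : HasPoint W u' d') : (u ≤ u' ∧ d ≤ d') ∨ (u' ≤ u ∧ d' ≤ d) := by
  obtain ⟨l, hl, rfl, rfl⟩ := h
  obtain ⟨l', hl', rfl, rfl⟩ := h'
  rcases List.prefix_or_prefix_of_prefix hl hl' with h | h
  · exact Or.inl ⟨h.sublist.count_le _, h.sublist.count_le _⟩
  · exact Or.inr ⟨h.sublist.count_le _, h.sublist.count_le _⟩

/-- `e i` letters `U` precede the `i`-th letter `D`. -/
def HasUpCounts {n : ℕ} (W : List DyckStep) (e : Fin n → ℕ) : Prop :=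
  ∀ i : Fin n, HasPoint W (e i) i ∧ HasPoint W (e i) (i + 1)

theorem HasUpCounts.unique {n : ℕ} {W : List DyckStep} {e e' : Fin n → ℕ} (h : HasUpCounts W e)
    (h' : HasUpCounts W e') : e = e' := by
  funext i
  have h1 := (h i).1.total (h' i).2
  have h2 := (h i).2.total (h' i).1
  omega

/-- Let `u` and `d` be the letter counts of `l`. The word `W'` passes from `(u, d)` to `(u, d + 1)`,
so `e` has value `u` at `d`, whereas `W` passes through `(u + 1, d)`, which forces a value of at
least `u + 1`. -/
theorem HasUpCounts.not_U_D {n : ℕ} {W W' l : List DyckStep} {e : Fin n → ℕ}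
    (h : HasUpCounts W e) (h' : HasUpCounts W' e) (hn : W'.count DyckStep.D = n)
    (hl : l ++ [DyckStep.U] <+: W) (hl' : l ++ [DyckStep.D] <+: W') : False := by
  have hd : l.count DyckStep.D < n := by
    have := hl'.sublist.count_le DyckStep.D
    simp only [List.count_append, List.count_singleton_self] at this
    omega
  have h1 : HasPoint W' (l.count DyckStep.U) (l.count DyckStep.D) :=
    ⟨l, (List.prefix_append _ _).trans hl', rfl, rfl⟩
  have h2 : HasPoint W' (l.count DyckStep.U) (l.count DyckStep.D + 1) :=
    ⟨_, hl', by simp, by simp⟩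
  have h3 : HasPoint W (l.count DyckStep.U + 1) (l.count DyckStep.D) :=
    ⟨_, hl, by simp, by simp⟩
  have h4 := (h ⟨_, hd⟩).2.total h3
  have h5 := (h' ⟨_, hd⟩).1.total h2
  have h6 := (h' ⟨_, hd⟩).2.total h1
  simp only at h4 h5 h6
  omega

theorem HasUpCounts.word_unique {n : ℕ} {W W' : List DyckStep} {e : Fin n → ℕ}
    (h : HasUpCounts W e) (h' : HasUpCounts W' e) (hn : W.count DyckStep.D = n)
    (hn' : W'.count DyckStep.D = n) (hlen : W.length = W'.length) : W = W' := by
  have key : ∀ c ≤ W.length, W.take c = W'.take c := by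
    intro c
    induction c with
    | zero => simp
    | succ c ih =>
      intro hc
      have h1 := ih (by omega)
      have e1 := List.take_succ_eq_append_getElem (l := W) (i := c) (by omega)
      have e2 := List.take_succ_eq_append_getElem (l := W') (i := c) (by omega)
      have p1 := List.take_prefix (c + 1) W
      have p2 := List.take_prefix (c + 1) W'
      rw [e1] at p1
      rw [e2, ← h1] at p2
      rw [e1, e2, ← h1]
      rcases W[c].dichotomy with hu | hu <;> rcases W'[c].dichotomy with hv | hv
      · rw [hu, hv]
      · rw [hu] at p1
        rw [hv] at p2
        exact (h.not_U_D h' hn' p1 p2).elim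
      · rw [hu] at p1
        rw [hv] at p2
        exact (h'.not_U_D h hn p2 p1).elim
      · rw [hu, hv]
  have := key _ le_rfl
  rwa [List.take_length, hlen, List.take_length] at this

/-! ### Block data and overlap types of Dyck words -/

section BlockForm

variable {n r : ℕ} {L M : ℕ → ℕ} {w : DyckWord}

theorem IsBlockForm.cutsL (h : IsBlockForm n w r L M) : IsCuts n r L :=
  ⟨h.L_zero, h.L_last, h.L_lt⟩

theorem IsBlockForm.cutsM (h : IsBlockForm n w r L M) : IsCuts n r M :=
  ⟨h.M_zero, h.M_last, h.M_lt⟩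

theorem count_flatMap_blocks (hL : IsCuts n r L) (hM : IsCuts n r M) {b : ℕ} (hb : b ≤ r) :
    ((List.range b).flatMap fun i => List.replicate (L (i + 1) - L i) DyckStep.U ++
      List.replicate (M (i + 1) - M i) DyckStep.D).count DyckStep.U = L b ∧
    ((List.range b).flatMap fun i => List.replicate (L (i + 1) - L i) DyckStep.U ++
      List.replicate (M (i + 1) - M i) DyckStep.D).count DyckStep.D = M b := by
  induction b with
  | zero => simp [hL.zero, hM.zero]
  | succ b ih =>
    have h1 := ih (by omega)
    have h2 := hL.lt b hb
    have h3 := hM.lt b hb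
    rw [List.range_succ, List.flatMap_append, List.flatMap_singleton]
    simp only [List.count_append, h1.1, h1.2, List.count_replicate_self]
    rw [List.count_replicate, List.count_replicate, if_neg (by decide), if_neg (by decide)]
    omega

theorem IsBlockForm.hasPoint (h : IsBlockForm n w r L M) {b : ℕ} (hb : b < r) {d : ℕ}
    (hd : M b ≤ d) (hd' : d ≤ M (b + 1)) : HasPoint w.toList (L (b + 1)) d := by
  have h1 := count_flatMap_blocks h.cutsL h.cutsM hb.le
  have hL := h.L_lt b hb
  set A := (List.range b).flatMap fun i => List.replicate (L (i + 1) - L i) DyckStep.U ++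
      List.replicate (M (i + 1) - M i) DyckStep.D with hA
  refine ⟨A ++ (List.replicate (L (b + 1) - L b) DyckStep.U ++
    List.replicate (d - M b) DyckStep.D), ?_, ?_, ?_⟩
  · rw [h.word_eq]
    have h2 : (List.range (b + 1)).flatMap (fun i => List.replicate (L (i + 1) - L i) DyckStep.U ++
        List.replicate (M (i + 1) - M i) DyckStep.D) <+: (List.range r).flatMap fun i =>
        List.replicate (L (i + 1) - L i) DyckStep.U ++
          List.replicate (M (i + 1) - M i) DyckStep.D := by
      obtain ⟨k, rfl⟩ : ∃ k, r = (b + 1) + k := ⟨r - (b + 1), by omega⟩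
      rw [List.range_add (n := b + 1) (m := k), List.flatMap_append]
      exact List.prefix_append _ _
    refine List.IsPrefix.trans ?_ h2
    rw [List.range_succ, List.flatMap_append, List.flatMap_singleton, ← hA]
    refine (List.prefix_append_right_inj _).2 ((List.prefix_append_right_inj _).2 ?_)
    obtain ⟨k, hk⟩ : ∃ k, M (b + 1) - M b = (d - M b) + k := ⟨M (b + 1) - d, by omega⟩
    rw [hk, List.replicate_add]
    exact List.prefix_append _ _
  · simp only [List.count_append, h1.1, List.count_replicate_self]
    rw [List.count_replicate, if_neg (by decide)]
    omega
  · simp only [List.count_append, h1.2, List.count_replicate_self]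
    rw [List.count_replicate, if_neg (by decide)]
    omega

theorem IsBlockForm.isBlocks (h : IsBlockForm n w r L M) : IsBlocks n r L M where
  cutsL := h.cutsL
  cutsM := h.cutsM
  le i hi := by
    rcases i with _ | b
    · rw [h.L_zero, h.M_zero]
    · obtain ⟨l, hl, h1, h2⟩ := h.hasPoint (b := b) hi (h.M_lt b hi).le le_rfl
      have h3 := w.count_D_le_count_U l.length
      rw [← List.prefix_iff_eq_take.1 hl] at h3
      omega

theorem IsBlockForm.hasUpCounts (h : IsBlockForm n w r L M) :
    HasUpCounts w.toList h.isBlocks.ell := fun i =>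
  ⟨h.hasPoint (h.cutsM.blk i).2 (h.cutsM.le_blk i) (h.cutsM.lt_blk i).le,
    h.hasPoint (h.cutsM.blk i).2 ((h.cutsM.le_blk i).trans (Nat.le_succ _)) (h.cutsM.lt_blk i)⟩

theorem le_iff_lt_countGE {lam : Fin n → ℕ} (hlam : Antitone lam) (k : ℕ) (j : Fin n) :
    k ≤ lam j ↔ (j : ℕ) < countGE lam k := by
  constructor
  · intro hk
    have h1 : Finset.Iic j ⊆ Finset.univ.filter fun j => k ≤ lam j := fun i hi => by
      simp only [Finset.mem_filter, Finset.mem_univ, true_and]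
      exact hk.trans (hlam (Finset.mem_Iic.1 hi))
    have h2 := Finset.card_le_card h1
    rwa [Fin.card_Iic] at h2
  · intro hj
    by_contra hc
    have h1 : (Finset.univ.filter fun j => k ≤ lam j) ⊆ Finset.Iio j := fun i hi => by
      simp only [Finset.mem_filter, Finset.mem_univ, true_and] at hi
      rw [Finset.mem_Iio]
      by_contra hji
      exact hc (hi.trans (hlam (not_lt.1 hji)))
    have h2 := Finset.card_le_card h1
    rw [Fin.card_Iio] at h2
    exact absurd hj (not_lt.2 h2)

theorem countGE_eq_iff {mu lam : Fin n → ℕ} (hlam : Antitone lam) {e : Fin n → ℕ}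
    (he : ∀ i, e i ≤ n) :
    (∀ i j : Fin n, mu i ≤ lam j ↔ (j : ℕ) < e i) ↔ ∀ i, countGE lam (mu i) = e i := by
  constructor
  · intro H i
    rw [countGE, ← card_filter_fin_lt (he i)]
    congr 1
    ext j
    simp only [Finset.mem_filter, Finset.mem_univ, true_and]
    exact H i j
  · intro H i j
    rw [le_iff_lt_countGE hlam, H]

/-- `HasOverlap` asks for some block data of `w`. The up-counts depend only on the word, so a
condition on them frees the statement from the choice of data. -/
theorem IsBlockForm.hasOverlap_iff (h : IsBlockForm n w r L M) {mu lam : Fin n → ℕ}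
    (hmu : Antitone mu) (hlam : Antitone lam) :
    HasOverlap mu lam w ↔ HasUpCounts w.toList fun i => countGE lam (mu i) := by
  constructor
  · rintro ⟨r', L', M', h', hov⟩
    have h1 := (countGE_eq_iff hlam h'.isBlocks.isPath.ell_le).1
      ((h'.isBlocks.overlapAt_iff hmu hlam).1 hov)
    rw [show (fun i => countGE lam (mu i)) = h'.isBlocks.ell from funext h1]
    exact h'.hasUpCounts
  · intro hc
    refine ⟨r, L, M, h, (h.isBlocks.overlapAt_iff hmu hlam).2
      ((countGE_eq_iff hlam h.isBlocks.isPath.ell_le).2 fun i => ?_)⟩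
    exact congrFun (hc.unique h.hasUpCounts) i

theorem IsBlockForm.hasOverlap_iff_overlapAt (h : IsBlockForm n w r L M) {mu lam : Fin n → ℕ}
    (hmu : Antitone mu) (hlam : Antitone lam) :
    HasOverlap mu lam w ↔ OverlapAt r L M mu lam := by
  constructor
  · intro ho
    have hc := (h.hasOverlap_iff hmu hlam).1 ho
    refine (h.isBlocks.overlapAt_iff hmu hlam).2
      ((countGE_eq_iff hlam h.isBlocks.isPath.ell_le).2 fun i => ?_)
    exact congrFun (hc.unique h.hasUpCounts) i
  · exact fun ho => ⟨r, L, M, h, ho⟩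

end BlockForm

/-- The word in which `E (i + 1)` letters `U` precede the `i`-th letter `D`. -/
def wordOf (E : ℕ → ℕ) : ℕ → List DyckStep
  | 0 => []
  | n + 1 => wordOf E n ++ List.replicate (E (n + 1) - E n) DyckStep.U ++ [DyckStep.D]

theorem count_wordOf {E : ℕ → ℕ} (h0 : E 0 = 0) (hE : Monotone E) (n : ℕ) :
    (wordOf E n).count DyckStep.U = E n ∧ (wordOf E n).count DyckStep.D = n := by
  induction n with
  | zero => simp [wordOf, h0]
  | succ n ih =>
    have := hE (Nat.le_succ n)
    simp only [wordOf, List.count_append, ih.1, ih.2, List.count_replicate_self,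
      List.count_singleton_self, Nat.succ_eq_add_one] at this ⊢
    rw [List.count_replicate, if_neg (by decide), List.count_singleton, if_neg (by decide)]
    omega

theorem wordOf_prefix (E : ℕ → ℕ) {n n' : ℕ} (h : n ≤ n') : wordOf E n <+: wordOf E n' := by
  induction n', h using Nat.le_induction with
  | base => exact List.prefix_refl _
  | succ k hk ih =>
    refine ih.trans ?_
    rw [wordOf, List.append_assoc]
    exact List.prefix_append _ _

theorem hasPoint_wordOf {E : ℕ → ℕ} (h0 : E 0 = 0) (hE : Monotone E) {i n : ℕ} (hi : i < n) :
    HasPoint (wordOf E n) (E (i + 1)) i ∧ HasPoint (wordOf E n) (E (i + 1)) (i + 1) := by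
  have h1 := count_wordOf h0 hE i
  have h2 := count_wordOf h0 hE (i + 1)
  have h3 := wordOf_prefix E hi
  refine ⟨⟨wordOf E i ++ List.replicate (E (i + 1) - E i) DyckStep.U, ?_, ?_, ?_⟩,
    ⟨_, h3, h2.1, h2.2⟩⟩
  · refine List.IsPrefix.trans ?_ h3
    rw [wordOf]
    exact List.prefix_append _ _
  · have := hE (Nat.le_succ i)
    simp only [List.count_append, h1.1, List.count_replicate_self, Nat.succ_eq_add_one] at this ⊢
    omega
  · simp only [List.count_append, h1.2]
    rw [List.count_replicate, if_neg (by decide)]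
    rfl

/-- No initial segment has more letters `D` than letters `U`. -/
def IsBallot (W : List DyckStep) : Prop :=
  ∀ l, l <+: W → l.count DyckStep.D ≤ l.count DyckStep.U

theorem IsBallot.append_replicate_U {W : List DyckStep} (h : IsBallot W) (k : ℕ) :
    IsBallot (W ++ List.replicate k DyckStep.U) := by
  induction k with
  | zero => simpa using h
  | succ k ih =>
    rw [List.replicate_succ', ← List.append_assoc]
    intro l hl
    rcases List.prefix_concat_iff.1 hl with rfl | hl
    · have := ih _ (List.prefix_refl _)
      simp only [List.count_append, List.count_singleton_self] at this ⊢
      rw [List.count_singleton, if_neg (by decide)]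
      omega
    · exact ih l hl

/-- Letters `U` cannot break the condition, so it is only tested after each `D`, where it reads `i ≤
E i`. -/
theorem isBallot_wordOf {E : ℕ → ℕ} (h0 : E 0 = 0) (hE : Monotone E) (hle : ∀ i, i ≤ E i) (n : ℕ) :
    IsBallot (wordOf E n) := by
  induction n with
  | zero =>
    intro l hl
    rw [List.prefix_nil.1 hl]
    rfl
  | succ n ih =>
    intro l hl
    rw [wordOf] at hl
    rcases List.prefix_concat_iff.1 hl with hl | hl
    · have h1 := count_wordOf h0 hE (n + 1)
      rw [wordOf, ← hl] at h1
      rw [h1.1, h1.2]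
      exact hle _
    · exact ih.append_replicate_U _ l hl

theorem exists_dyckWord {n : ℕ} {mu lam : Fin n → ℕ} (hmu : Antitone mu) (hlam : Antitone lam)
    (hle : mu ≤ lam) :
    ∃ w : DyckWords n, HasUpCounts w.1.toList fun i => countGE lam (mu i) := by
  -- The index is shifted by one so that `E 0 = 0`. The default value `i` keeps `E` monotone and at
  -- least the identity beyond `n`.
  let E : ℕ → ℕ := fun i => if h : 1 ≤ i ∧ i ≤ n then countGE lam (mu ⟨i - 1, by omega⟩) else i
  have hEs : ∀ i (hi : i < n), E (i + 1) = countGE lam (mu ⟨i, hi⟩) := fun i hi =>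
    dif_pos ⟨by omega, by omega⟩
  have hle_n : ∀ k, countGE lam k ≤ n := fun k =>
    (Finset.card_le_univ _).trans (Fintype.card_fin n).le
  have hge : ∀ i : Fin n, (i : ℕ) + 1 ≤ countGE lam (mu i) := fun i => by
    rw [← Fin.card_Iic]
    refine Finset.card_le_card fun j hj => ?_
    simp only [Finset.mem_filter, Finset.mem_univ, true_and]
    exact (hle i).trans (hlam (Finset.mem_Iic.1 hj))
  have hanti : ∀ a b, a ≤ b → countGE lam b ≤ countGE lam a := fun a b hab => by
    refine Finset.card_le_card fun j hj => ?_
    simp only [Finset.mem_filter, Finset.mem_univ, true_and] at hj ⊢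
    exact hab.trans hj
  have hbig : ∀ i, n < i → E i = i := fun i hi => dif_neg (by omega)
  have h0 : E 0 = 0 := dif_neg (by omega)
  have hid : ∀ i, i ≤ E i := by
    intro i
    rcases i with _ | i
    · exact Nat.zero_le _
    · by_cases hi : i < n
      · rw [hEs i hi]
        exact hge ⟨i, hi⟩
      · exact (hbig _ (by omega)).ge
  have hE : Monotone E := by
    refine monotone_nat_of_le_succ fun i => ?_
    rcases i with _ | i
    · exact h0.le.trans (Nat.zero_le _)
    · by_cases hi : i + 1 < n
      · rw [hEs i (by omega), hEs _ hi]
        exact hanti _ _ (hmu (Fin.mk_le_mk.2 (Nat.le_succ i)))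
      · rw [hbig (i + 1 + 1) (by omega)]
        by_cases hi' : i < n
        · rw [hEs i hi']
          exact (hle_n _).trans (by omega)
        · rw [hbig _ (by omega)]
          omega
  have hEn : E n = n := by
    refine le_antisymm ?_ (hid n)
    rcases n with _ | n
    · exact h0.le
    · rw [hEs n (by omega)]
      exact hle_n _
  have hc := count_wordOf h0 hE n
  refine ⟨⟨⟨wordOf E n, hc.1.trans (hEn.trans hc.2.symm), fun i =>
    isBallot_wordOf h0 hE hid n _ (List.take_prefix _ _)⟩, hc.1.trans hEn⟩, fun i => ?_⟩
  have := hasPoint_wordOf h0 hE i.2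
  rw [hEs] at this
  exact this

theorem norm_weight_lt_one {n p : ℕ} (hp : p.Prime) {s : ℂ} (hs : 2 * (n : ℝ) / 3 < s.re)
    {a c : ℕ} (hac : a ≤ c) (hc : 1 ≤ c) (hcn : c ≤ n) :
    ‖(p : ℂ) ^ (a * (2 * n + c - a)) * ((p : ℂ) ^ (-s)) ^ (2 * c + a)‖ < 1 := by
  have hp1 : (1 : ℝ) < p := by exact_mod_cast hp.one_lt
  have hp0 : (0 : ℝ) < p := by positivity
  have hac' : (a : ℝ) ≤ c := by exact_mod_cast hac
  have hcn' : (c : ℝ) ≤ n := by exact_mod_cast hcn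
  have hc' : (1 : ℝ) ≤ c := by exact_mod_cast hc
  have ha' : (0 : ℝ) ≤ a := by positivity
  rw [norm_mul, norm_pow, norm_pow, Complex.norm_natCast,
    Complex.norm_natCast_cpow_of_pos hp.pos, ← Real.rpow_natCast, ← Real.rpow_natCast,
    ← Real.rpow_mul hp0.le, ← Real.rpow_add hp0]
  refine Real.rpow_lt_one_of_one_lt_of_neg hp1 ?_
  rw [Complex.neg_re, Nat.cast_mul, Nat.cast_sub (by omega)]
  push_cast
  -- The first hint rests on `2n(2c + a) - 3a(2n + c - a) = (c - a)(4n - 3a) ≥ 0`, so the critical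
  -- abscissa of each weight is at most `2n/3`.
  nlinarith [mul_nonneg (sub_nonneg.2 hac') (show (0 : ℝ) ≤ 4 * n - 3 * a by linarith),
    mul_lt_mul_of_pos_right hs (show (0 : ℝ) < 2 * c + a by linarith)]

theorem hasSum_overlapPairs {n r : ℕ} {L M : ℕ → ℕ} {w : DyckWord} (hn : 1 ≤ n)
    (h : IsBlockForm n w r L M) {p : ℕ} (hp : p.Prime) {s : ℂ} (hs : 2 * (n : ℝ) / 3 < s.re) :
    HasSum (fun x : overlapPairs n w => dyckTerm (fun _ : Fin n => 1) (fun _ => 1) p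
      ((p : ℂ) ^ (-s)) x.1) (splitProduct n r L M (p : ℂ) ((p : ℂ) ^ (-s))) := by
  have hr : r ≠ 0 := by
    rintro rfl
    have := h.L_zero
    have := h.L_last
    omega
  obtain ⟨r, rfl⟩ : ∃ k, r = k + 1 := ⟨r - 1, by omega⟩
  have hb := h.isBlocks
  have hset : overlapPairs n w = {x : (Fin n → ℕ) × (Fin n → ℕ) | Antitone x.1 ∧ Antitone x.2 ∧
      x.1 ≤ x.2 ∧ OverlapAt (r + 1) L M x.1 x.2} := by
    ext x
    refine and_congr_right fun h1 => and_congr_right fun h2 => and_congr_right fun _ => ?_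
    exact h.hasOverlap_iff_overlapAt h1 h2
  rw [hset]
  refine hb.hasSum_overlapAt hp (fun b hbr j hj hj' => ?_) (fun b hbr j hj hj' => ?_)
  · have h1 := hb.le (b + 1) hbr
    have h2 := hb.cutsL.le_n (a := b + 1) hbr
    exact norm_weight_lt_one hp hs (hj'.trans h1) (by omega) h2
  · have h1 := hb.le b hbr.le
    have h2 := hb.cutsL.le_n (a := b + 1) hbr
    have h3 := norm_weight_lt_one hp hs (a := M b) (c := j) (by omega) (by omega) (hj'.trans h2)
    rw [numY, Nat.add_sub_cancel]
    convert h3 using 4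
    rw [mul_comm]
    congr 1
    omega

end HeisenbergZeta
end

noncomputable section
namespace HeisenbergZeta

/-! ### Types of finite abelian `p`-groups -/

/-- The Smith normal form of the kernel splits `H` into `n` cyclic groups, some possibly trivial.
Their orders multiply to `p^k`, so they are powers of `p`. -/
theorem exists_type_of_surjective {p : ℕ} (hp : p.Prime) {n : ℕ} {H : Type*} [AddCommGroup H]
    {k : ℕ} (hcard : Nat.card H = p ^ k) (f : (Fin n → ℤ) →+ H) (hf : Function.Surjective f) :
    ∃ mu : Fin n → ℕ, Antitone mu ∧ Nonempty (H ≃+ ∀ i, ZMod (p ^ mu i)) := by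
  have : Finite H := Nat.finite_of_card_ne_zero (by rw [hcard]; exact pow_ne_zero _ hp.ne_zero)
  let g := f.toIntLinearMap
  let e : ((Fin n → ℤ) ⧸ LinearMap.ker g) ≃ₗ[ℤ] H := g.quotKerEquivOfSurjective hf
  have hfin : Finite ((Fin n → ℤ) ⧸ LinearMap.ker g) := Finite.of_equiv _ e.symm.toEquiv
  have hrank := (Submodule.finiteQuotient_iff _).1 hfin
  let a : Fin n → ℕ :=
    fun i => (Submodule.smithNormalFormCoeffs (Pi.basisFun ℤ (Fin n)) hrank i).natAbs
  let e' : H ≃+ ∀ i, ZMod (a i) :=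
    e.symm.toAddEquiv.trans (Submodule.quotientEquivPiZMod _ (Pi.basisFun ℤ (Fin n)) hrank)
  have hprod : ∏ i, a i = p ^ k := by
    rw [← hcard, Nat.card_congr e'.toEquiv, Nat.card_pi]
    exact Finset.prod_congr rfl fun i _ => (Nat.card_zmod _).symm
  have ha : ∀ i, ∃ c, a i = p ^ c := fun i => by
    obtain ⟨c, -, hc⟩ := (Nat.dvd_prime_pow hp).1
      (hprod ▸ Finset.dvd_prod_of_mem a (Finset.mem_univ i))
    exact ⟨c, hc⟩
  choose c hc using ha
  obtain ⟨σ, hσ⟩ := exists_eq_sortDesc_comp c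
  refine ⟨sortDesc c, antitone_sortDesc c, ⟨e'.trans ?_⟩⟩
  rw [show a = fun i => p ^ sortDesc c (σ i) from
    funext fun i => (hc i).trans (congrArg (p ^ ·) (congrFun hσ i))]
  exact (LinearEquiv.piCongrLeft ℤ (fun i => ZMod (p ^ sortDesc c i)) σ).toAddEquiv

theorem sum_min_eq_of_equiv {p : ℕ} (hp : p.Prime) {n : ℕ} {mu mu' : Fin n → ℕ}
    (e : (∀ i, ZMod (p ^ mu i)) ≃+ ∀ i, ZMod (p ^ mu' i)) (k : ℕ) :
    ∑ j, min k (mu j) = ∑ j, min k (mu' j) := by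
  have h1 := card_torsion_pi_zmod hp mu k
  have h2 := card_torsion_pi_zmod hp mu' k
  have h3 : Nat.card (nsmulAddMonoidHom (p ^ k) :
      (∀ i, ZMod (p ^ mu i)) →+ ∀ i, ZMod (p ^ mu i)).ker =
      Nat.card (nsmulAddMonoidHom (p ^ k) :
      (∀ i, ZMod (p ^ mu' i)) →+ ∀ i, ZMod (p ^ mu' i)).ker :=
    Nat.card_congr (e.toEquiv.subtypeEquiv fun x => by
      rw [AddMonoidHom.mem_ker, AddMonoidHom.mem_ker, nsmulAddMonoidHom_apply,
        nsmulAddMonoidHom_apply, AddEquiv.toEquiv_eq_coe, AddEquiv.coe_toEquiv, ← map_nsmul,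
        EmbeddingLike.map_eq_zero_iff])
  rw [h1, h2] at h3
  exact Nat.pow_right_injective hp.two_le h3

/-- The orders of the `p^k`-torsion determine how many parts are at least `k`, for every `k`, and
hence the partition. -/
theorem type_unique {p : ℕ} (hp : p.Prime) {n : ℕ} {mu mu' : Fin n → ℕ} (hmu : Antitone mu)
    (hmu' : Antitone mu') (e : (∀ i, ZMod (p ^ mu i)) ≃+ ∀ i, ZMod (p ^ mu' i)) : mu = mu' := by
  have h := sum_min_eq_of_equiv hp e
  have hc : ∀ k, countGE mu (k + 1) = countGE mu' (k + 1) := fun k => by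
    have h1 := sum_min_succ mu k
    have h2 := sum_min_succ mu' k
    rw [h, h] at h1
    omega
  have key : ∀ k j, k ≤ mu j ↔ k ≤ mu' j := fun k j => by
    rcases k with _ | k
    · simp
    · rw [le_iff_lt_countGE hmu, le_iff_lt_countGE hmu', hc]
  funext j
  exact le_antisymm ((key _ j).1 le_rfl) ((key _ j).2 le_rfl)

theorem card_pi_zmod_pow (p : ℕ) {n : ℕ} (l : Fin n → ℕ) :
    Nat.card (∀ i, ZMod (p ^ l i)) = p ^ ∑ i, l i := by
  rw [Nat.card_pi, Finset.prod_congr rfl fun i _ => Nat.card_zmod _, Finset.prod_pow_eq_pow_sum]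

/-- The preimage of `H` in `ℤ^n` is free of rank at most `n`. So `H` is generated by `n` elements,
and `exists_type_of_surjective` applies with the same `n`. -/
theorem exists_type {p : ℕ} (hp : p.Prime) {n : ℕ} {l : Fin n → ℕ}
    (H : AddSubgroup (∀ i, ZMod (p ^ l i))) :
    ∃ mu : Fin n → ℕ, Antitone mu ∧ Nonempty (H ≃+ ∀ i, ZMod (p ^ mu i)) := by
  let f : (Fin n → ℤ) →+ ∀ i, ZMod (p ^ l i) :=
    AddMonoidHom.pi fun i => (Int.castAddHom _).comp (Pi.evalAddMonoidHom _ i)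
  have hf : Function.Surjective f := fun y => by
    choose x hx using fun i => ZMod.intCast_surjective (y i)
    exact ⟨x, funext hx⟩
  obtain ⟨m, b⟩ := Submodule.nonempty_basis_of_pid (Pi.basisFun ℤ (Fin n))
    (AddSubgroup.toIntSubmodule (H.comap f))
  obtain ⟨b⟩ := b
  have hm : m ≤ n := by
    have h1 := Submodule.finrank_le (AddSubgroup.toIntSubmodule (H.comap f))
    rwa [Module.finrank_eq_card_basis b, Module.finrank_fin_fun, Fintype.card_fin] at h1
  let g : (Fin n → ℤ) →ₗ[ℤ] AddSubgroup.toIntSubmodule (H.comap f) :=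
    b.equivFun.symm.toLinearMap ∘ₗ LinearMap.funLeft ℤ ℤ (Fin.castLE hm)
  have hg : Function.Surjective g := b.equivFun.symm.surjective.comp
    (LinearMap.funLeft_surjective_of_injective _ _ _ (Fin.castLE_injective hm))
  obtain ⟨k, -, hk⟩ := (Nat.dvd_prime_pow hp).1
    ((card_pi_zmod_pow p l) ▸ AddSubgroup.card_addSubgroup_dvd_card H)
  refine exists_type_of_surjective hp hk
    ((f.addSubgroupComap H : H.comap f →+ H).comp g.toAddMonoidHom) ?_
  refine Function.Surjective.comp (g := f.addSubgroupComap H) (fun y => ?_) hg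
  obtain ⟨x, hx⟩ := hf y
  exact ⟨⟨x, by rw [AddSubgroup.mem_comap, hx]; exact y.2⟩, Subtype.ext hx⟩

theorem card_addSubgroup_congr {G G' K : Type*} [AddGroup G] [AddGroup G'] [AddGroup K]
    (e : G ≃+ G') :
    Nat.card {H : AddSubgroup G // Nonempty (H ≃+ K)} =
      Nat.card {H : AddSubgroup G' // Nonempty (H ≃+ K)} :=
  Nat.card_congr (e.mapAddSubgroup.toEquiv.subtypeEquiv fun H =>
    ⟨fun ⟨f⟩ => ⟨(e.addSubgroupMap H).symm.trans f⟩, fun ⟨f⟩ => ⟨(e.addSubgroupMap H).trans f⟩⟩)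

theorem alpha_sortDesc {n : ℕ} (l mu : Fin n → ℕ) (p : ℕ) :
    alpha (sortDesc l) mu p = alpha l mu p := by
  obtain ⟨σ, hσ⟩ := exists_eq_sortDesc_comp l
  conv_rhs => rw [hσ]
  exact card_addSubgroup_congr
    (LinearEquiv.piCongrLeft ℤ (fun i => ZMod (p ^ sortDesc l i)) σ).symm.toAddEquiv

/-- Duality of finite abelian groups on subgroups. -/
theorem exists_dual_equiv (G : Type*) [AddCommGroup G] [Finite G] :
    ∃ e : AddSubgroup G ≃ AddSubgroup G, ∀ H, Nat.card (e H) = H.index := by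
  obtain ⟨f⟩ := CommGroup.monoidHom_mulEquiv_of_hasEnoughRootsOfUnity (Multiplicative G) ℂ
  refine ⟨AddSubgroup.toSubgroup.toEquiv.trans
    ((CommGroup.subgroupOrderIsoSubgroupMonoidHom (Multiplicative G) ℂ).toEquiv.trans
      (OrderDual.ofDual.trans (f.mapSubgroup.toEquiv.trans AddSubgroup.toSubgroup.symm.toEquiv))),
    fun H => ?_⟩
  have h1 := CommGroup.card_subgroupOrderIsoSubgroupMonoidHom ℂ (AddSubgroup.toSubgroup H)
  refine (Nat.card_congr (f.subgroupMap _).symm.toEquiv).trans (h1.trans ?_)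
  exact Nat.card_congr (Equiv.refl _)

/-- The pairs of partitions with `n` parts. -/
abbrev PartitionPairs (n : ℕ) : Type :=
  {x : (Fin n → ℕ) × (Fin n → ℕ) // Antitone x.1 ∧ Antitone x.2}

/-- Every pair with `μ ≤ λ` has exactly one overlap word: `exists_dyckWord` gives one and the
up-counts determine it. All other pairs contribute zero, as `alpha` vanishes. -/
theorem hasSum_partitionPairs {n : ℕ} (hn : 1 ≤ n) {r : DyckWords n → ℕ}
    {L M : DyckWords n → ℕ → ℕ} (hblock : ∀ w, IsBlockForm n w.1 (r w) (L w) (M w)) {p : ℕ}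
    (hp : p.Prime) {s : ℂ} (hs : 2 * (n : ℝ) / 3 < s.re) :
    HasSum (fun x : PartitionPairs n =>
      dyckTerm (fun _ : Fin n => 1) (fun _ => 1) p ((p : ℂ) ^ (-s)) x.1)
      (∑ w, splitProduct n (r w) (L w) (M w) (p : ℂ) ((p : ℂ) ^ (-s))) := by
  set f := dyckTerm (fun _ : Fin n => 1) (fun _ => 1) p ((p : ℂ) ^ (-s)) with hf
  have h1 : ∀ w : DyckWords n, HasSum ((overlapPairs n w.1).indicator f) _ := fun w =>
    hasSum_subtype_iff_indicator.1 (hasSum_overlapPairs hn (hblock w) hp hs)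
  refine (hasSum_subtype_iff_indicator (f := f)
    (s := {x : (Fin n → ℕ) × (Fin n → ℕ) | Antitone x.1 ∧ Antitone x.2})).2 ((hasSum_sum fun w _ => h1 w).congr_fun fun x => ?_)
  by_cases hx : Antitone x.1 ∧ Antitone x.2
  · rw [Set.indicator_of_mem (show x ∈ {x : (Fin n → ℕ) × (Fin n → ℕ) |
      Antitone x.1 ∧ Antitone x.2} from hx)]
    by_cases hle : x.1 ≤ x.2
    · obtain ⟨w, hw⟩ := exists_dyckWord hx.1 hx.2 hle
      have hD : ∀ w : DyckWords n, w.1.toList.count DyckStep.D = n := fun w =>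
        w.1.count_U_eq_count_D.symm.trans w.2
      rw [Finset.sum_eq_single w]
      · refine Eq.symm ?_
        exact Set.indicator_of_mem
          (show x ∈ overlapPairs n w.1 from
            ⟨hx.1, hx.2, hle, ((hblock w).hasOverlap_iff hx.1 hx.2).2 hw⟩) f
      · intro w' _ hne
        refine Set.indicator_of_notMem (fun hmem => hne ?_) f
        have hw' := ((hblock w').hasOverlap_iff hx.1 hx.2).1 hmem.2.2.2
        have hlen : w'.1.toList.length = w.1.toList.length := by
          rw [← w'.1.two_mul_semilength_eq_length, ← w.1.two_mul_semilength_eq_length, w.2, w'.2]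
        exact Subtype.ext (DyckWord.ext (hw'.word_unique hw (hD w') (hD w) hlen))
      · exact fun h => (h (Finset.mem_univ _)).elim
    · have h0 : alpha x.2 x.1 p = 0 := by
        by_contra h
        exact hle (le_of_alpha_ne_zero hp hx.1 hx.2 h)
      have hf0 : f x = 0 := by rw [hf, dyckTerm, h0, Nat.cast_zero, zero_mul, zero_mul]
      rw [hf0]
      exact (Finset.sum_eq_zero fun w _ => Set.indicator_apply_eq_zero.2 fun _ => hf0).symm
  · rw [Set.indicator_of_notMem (show x ∉ {x : (Fin n → ℕ) × (Fin n → ℕ) |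
      Antitone x.1 ∧ Antitone x.2} from hx)]
    refine (Finset.sum_eq_zero fun w _ => Set.indicator_of_notMem (fun h => ?_) f).symm
    exact hx ⟨h.1, h.2.1⟩

theorem natCast_pow_cpow (p k : ℕ) (s : ℂ) : ((p ^ k : ℕ) : ℂ) ^ s = ((p : ℂ) ^ s) ^ k := by
  induction k with
  | zero => simp
  | succ k ih => rw [pow_succ, Nat.cast_mul, Complex.natCast_mul_natCast_cpow, ih, pow_succ]

/-- Tuples `ℓ` together with a subgroup of `∏ ℤ/p^{ℓ_i}`. -/
abbrev TorsionSubgroups (n p : ℕ) : Type :=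
  Σ l : Fin n → ℕ, AddSubgroup (∀ i, ZMod (p ^ l i))

theorem card_fiber_type {n p : ℕ} (hp : p.Prime) {lam mu : Fin n → ℕ} (hlam : Antitone lam) :
    Nat.card {y : TorsionSubgroups n p // sortDesc y.1 = lam ∧
      Nonempty (y.2 ≃+ ∀ i, ZMod (p ^ mu i))} =
      Nat.card {l : Fin n → ℕ // sortDesc l = lam} * alpha lam mu p := by
  have : Finite {l : Fin n → ℕ // sortDesc l = lam} := finite_sortDesc_eq hlam
  have := Fintype.ofFinite {l : Fin n → ℕ // sortDesc l = lam}
  have e : {y : TorsionSubgroups n p // sortDesc y.1 = lam ∧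
      Nonempty (y.2 ≃+ ∀ i, ZMod (p ^ mu i))} ≃ Σ l : {l : Fin n → ℕ // sortDesc l = lam},
      {H : AddSubgroup (∀ i, ZMod (p ^ l.1 i)) // Nonempty (H ≃+ ∀ i, ZMod (p ^ mu i))} :=
    ⟨fun y => ⟨⟨y.1.1, y.2.1⟩, ⟨y.1.2, y.2.2⟩⟩, fun y => ⟨⟨y.1.1, y.2.1⟩, y.1.2, y.2.2⟩,
      fun _ => rfl, fun _ => rfl⟩
  have hfin : ∀ l : Fin n → ℕ, Finite (AddSubgroup (∀ i, ZMod (p ^ l i))) := fun l => by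
    have : ∀ i, NeZero (p ^ l i) := fun i => ⟨pow_ne_zero _ hp.ne_zero⟩
    infer_instance
  rw [Nat.card_congr e, Nat.card_sigma, Finset.sum_congr rfl fun l _ => show _ = alpha lam mu p by
    exact (alpha_sortDesc l.1 mu p).symm.trans (congrArg (alpha · mu p) l.2), Finset.sum_const, Finset.card_univ, smul_eq_mul,
    Nat.card_eq_fintype_card]

/-- The subgroups are grouped by their type and by the sorted tuple. The summand is constant on a
group, whose size is the product of the two counts in `dyckTerm`. -/
theorem hasSum_torsionSubgroups {n : ℕ} (hn : 1 ≤ n) {r : DyckWords n → ℕ}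
    {L M : DyckWords n → ℕ → ℕ} (hblock : ∀ w, IsBlockForm n w.1 (r w) (L w) (M w)) {p : ℕ}
    (hp : p.Prime) {s : ℂ} (hs : 2 * (n : ℝ) / 3 < s.re) :
    HasSum (fun y : TorsionSubgroups n p =>
      (Nat.card y.2 : ℂ) ^ (2 * n) * (Nat.card y.2 : ℂ) ^ (-s) *
        ((p : ℂ) ^ (-s)) ^ (2 * ∑ i, y.1 i))
      (∑ w, splitProduct n (r w) (L w) (M w) (p : ℂ) ((p : ℂ) ^ (-s))) := by
  choose typ htyp using fun y : TorsionSubgroups n p => exists_type hp y.2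
  let F : TorsionSubgroups n p → PartitionPairs n := fun y =>
    ⟨(typ y, sortDesc y.1), (htyp y).1, antitone_sortDesc _⟩
  let a : PartitionPairs n → ℂ := fun x =>
    ((p : ℂ) ^ (2 * n) * (p : ℂ) ^ (-s)) ^ (∑ i, x.1.1 i) * ((p : ℂ) ^ (-s)) ^ (2 * ∑ i, x.1.2 i)
  have hF : ∀ y x, F y = x ↔ sortDesc y.1 = x.1.2 ∧
      Nonempty (y.2 ≃+ ∀ i, ZMod (p ^ x.1.1 i)) := fun y x => by
    constructor
    · rintro rfl
      exact ⟨rfl, (htyp y).2⟩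
    · rintro ⟨h1, ⟨e⟩⟩
      obtain ⟨e'⟩ := (htyp y).2
      exact Subtype.ext (Prod.ext (type_unique hp (htyp y).1 x.2.1 (e'.symm.trans e)) h1)
  have hcard : ∀ x, Nat.card {y // F y = x} =
      Nat.card {l : Fin n → ℕ // sortDesc l = x.1.2} * alpha x.1.2 x.1.1 p := fun x => by
    rw [← card_fiber_type hp x.2.2]
    exact Nat.card_congr (Equiv.subtypeEquivRight fun y => hF y x)
  have hfin : ∀ x, Finite {y // F y = x} := fun x => by
    have hl : Finite {l : Fin n → ℕ // sortDesc l = x.1.2} := finite_sortDesc_eq x.2.2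
    have : ∀ l : Fin n → ℕ, Finite (AddSubgroup (∀ i, ZMod (p ^ l i))) := fun l => by
      have : ∀ i, NeZero (p ^ l i) := fun i => ⟨pow_ne_zero _ hp.ne_zero⟩
      infer_instance
    refine Finite.of_injective (β := Σ l : {l : Fin n → ℕ // sortDesc l = x.1.2},
      AddSubgroup (∀ i, ZMod (p ^ l.1 i))) (fun y => ⟨⟨y.1.1, ((hF _ _).1 y.2).1⟩, y.1.2⟩) ?_
    rintro ⟨⟨l, H⟩, h⟩ ⟨⟨l', H'⟩, h'⟩ heq
    simp only [Sigma.mk.injEq, Subtype.mk.injEq] at heq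
    obtain ⟨rfl, h2⟩ := heq
    obtain rfl := eq_of_heq h2
    rfl
  have hsum := (hasSum_sigma_const_iff (κ := fun x => {y // F y = x}) a _).2
    ((hasSum_partitionPairs hn hblock hp hs).congr_fun fun x => by
      rw [dyckTerm_one _ _ x.2.2, hcard]
      push_cast
      ring)
  rw [← (Equiv.sigmaFiberEquiv F).hasSum_iff]
  refine hsum.congr_fun fun y => ?_
  obtain ⟨x, y, rfl⟩ := y
  obtain ⟨e⟩ := (htyp y).2
  change (Nat.card y.2 : ℂ) ^ (2 * n) * (Nat.card y.2 : ℂ) ^ (-s) *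
    ((p : ℂ) ^ (-s)) ^ (2 * ∑ i, y.1 i) = ((p : ℂ) ^ (2 * n) * (p : ℂ) ^ (-s)) ^ (∑ i, typ y i) *
    ((p : ℂ) ^ (-s)) ^ (2 * ∑ i, sortDesc y.1 i)
  rw [Nat.card_congr e.toEquiv, card_pi_zmod_pow, natCast_pow_cpow, Nat.cast_pow,
    sum_eq_of_sortDesc_eq (rfl : sortDesc y.1 = _), mul_pow, ← pow_mul, ← pow_mul,
    mul_comm (2 * n)]

/-- The tuples `ℓ` with a subgroup of `∏ ℤ/p^{ℓ_i}`, weighted by the index of the subgroup. -/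
theorem hasSum_torsionSubgroups_index {n : ℕ} (hn : 1 ≤ n) {r : DyckWords n → ℕ}
    {L M : DyckWords n → ℕ → ℕ} (hblock : ∀ w, IsBlockForm n w.1 (r w) (L w) (M w)) {p : ℕ}
    (hp : p.Prime) {s : ℂ} (hs : 2 * (n : ℝ) / 3 < s.re) :
    HasSum (fun y : TorsionSubgroups n p =>
      (y.2.index : ℂ) ^ (2 * n) * (y.2.index : ℂ) ^ (-s) * ((p : ℂ) ^ (-s)) ^ (2 * ∑ i, y.1 i))
      (∑ w, splitProduct n (r w) (L w) (M w) (p : ℂ) ((p : ℂ) ^ (-s))) := by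
  have h1 : ∀ l : Fin n → ℕ, ∃ e : AddSubgroup (∀ i, ZMod (p ^ l i)) ≃
      AddSubgroup (∀ i, ZMod (p ^ l i)), ∀ H, Nat.card (e H) = H.index := fun l => by
    have : ∀ i, NeZero (p ^ l i) := fun i => ⟨pow_ne_zero _ hp.ne_zero⟩
    exact exists_dual_equiv _
  choose e he using h1
  refine ((Equiv.sigmaCongrRight e).hasSum_iff.2
    (hasSum_torsionSubgroups hn hblock hp hs)).congr_fun fun y => ?_
  rw [← he]
  rfl

end HeisenbergZeta
end

noncomputable section
namespace HeisenbergZeta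

/-! ### Subgroups of `p`-power index -/

/-- Subgroups of `p`-power index. -/
abbrev PowIndex (p : ℕ) (B : Type*) [AddCommGroup B] : Type _ :=
  {N : AddSubgroup B // ∃ k, N.index = p ^ k}

/-- The subgroup of `B × C` attached to a homomorphism from a subgroup of `B` to a quotient
of `C`. -/
def graphSubgroup {B C : Type*} [AddCommGroup B] [AddCommGroup C] (S : AddSubgroup B)
    (S' : AddSubgroup C) (f : S →+ C ⧸ S') : AddSubgroup (B × C) where
  carrier := {x | ∃ h : x.1 ∈ S, f ⟨x.1, h⟩ = (x.2 : C ⧸ S')}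
  zero_mem' := ⟨S.zero_mem, map_zero f⟩
  add_mem' := by
    rintro x y ⟨hx, hx'⟩ ⟨hy, hy'⟩
    refine ⟨S.add_mem hx hy, ?_⟩
    rw [Prod.snd_add, QuotientAddGroup.mk_add, ← hx', ← hy', ← map_add]
    rfl
  neg_mem' := by
    rintro x ⟨hx, hx'⟩
    refine ⟨S.neg_mem hx, ?_⟩
    rw [Prod.snd_neg, QuotientAddGroup.mk_neg, ← hx', ← map_neg]
    rfl

/-! ### Subgroups of a product -/

section Prod

variable {B C : Type*} [AddCommGroup B] [AddCommGroup C]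

theorem index_prod_eq_mul (N : AddSubgroup (B × C)) :
    N.index = (N.map (AddMonoidHom.fst B C)).index * (N.comap (AddMonoidHom.inr B C)).index := by
  have h1 := AddSubgroup.relIndex_mul_index
    (le_sup_left : N ≤ N ⊔ (AddMonoidHom.fst B C).ker)
  rw [AddSubgroup.relIndex_sup_left, ← AddSubgroup.comap_map_eq,
    AddSubgroup.index_comap_of_surjective _ Prod.fst_surjective] at h1
  rw [AddSubgroup.index_comap, ← h1, mul_comm]
  congr 2
  ext x
  constructor
  · rintro hx
    exact ⟨x.2, Prod.ext (Eq.symm hx) rfl⟩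
  · rintro ⟨c, rfl⟩
    rfl

theorem map_fst_graphSubgroup (S : AddSubgroup B) (S' : AddSubgroup C) (f : S →+ C ⧸ S') :
    (graphSubgroup S S' f).map (AddMonoidHom.fst B C) = S := by
  ext b
  constructor
  · rintro ⟨x, ⟨hx, -⟩, rfl⟩
    exact hx
  · intro hb
    obtain ⟨c, hc⟩ := QuotientAddGroup.mk_surjective (f ⟨b, hb⟩)
    exact ⟨(b, c), ⟨hb, hc.symm⟩, rfl⟩

theorem comap_inr_graphSubgroup (S : AddSubgroup B) (S' : AddSubgroup C) (f : S →+ C ⧸ S') :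
    (graphSubgroup S S' f).comap (AddMonoidHom.inr B C) = S' := by
  ext c
  have h0 : f ⟨0, S.zero_mem⟩ = 0 := map_zero f
  constructor
  · rintro ⟨_, hc⟩
    exact (QuotientAddGroup.eq_zero_iff c).1 (hc.symm.trans h0)
  · intro hc
    exact ⟨S.zero_mem, h0.trans ((QuotientAddGroup.eq_zero_iff c).2 hc).symm⟩

/-- The subgroups of `B × C` with given projection to `B` and given intersection with `C`. -/
theorem card_prod_fiber_eq_card_hom (S : AddSubgroup B) (S' : AddSubgroup C) :
    Nat.card {N : AddSubgroup (B × C) // N.map (AddMonoidHom.fst B C) = S ∧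
      N.comap (AddMonoidHom.inr B C) = S'} = Nat.card (S →+ C ⧸ S') := by
  refine (Nat.card_congr (Equiv.ofBijective (fun f : S →+ C ⧸ S' =>
    (⟨graphSubgroup S S' f, map_fst_graphSubgroup S S' f, comap_inr_graphSubgroup S S' f⟩ :
      {N : AddSubgroup (B × C) // N.map (AddMonoidHom.fst B C) = S ∧
        N.comap (AddMonoidHom.inr B C) = S'})) ⟨fun f g hfg => ?_, ?_⟩)).symm
  · ext ⟨b, hb⟩
    obtain ⟨c, hc⟩ := QuotientAddGroup.mk_surjective (f ⟨b, hb⟩)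
    have h1 : (b, c) ∈ graphSubgroup S S' f := ⟨hb, hc.symm⟩
    rw [show graphSubgroup S S' f = graphSubgroup S S' g from congrArg Subtype.val hfg] at h1
    exact hc.symm.trans h1.2.symm
  · rintro ⟨N, rfl, rfl⟩
    have hex : ∀ b : N.map (AddMonoidHom.fst B C), ∃ c, ((b : B), c) ∈ N := by
      rintro ⟨b, ⟨x, hx, rfl⟩⟩
      exact ⟨x.2, hx⟩
    choose c hc using hex
    -- Two lifts of `b` to `N` differ by an element of the intersection with `C`, so `c` is well
    -- defined modulo that intersection; additivity follows from the same uniqueness.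
    have huniq : ∀ b d, ((b : N.map (AddMonoidHom.fst B C)) , d).1.1 = b.1 → ((b : B), d) ∈ N →
        (c b : C ⧸ N.comap (AddMonoidHom.inr B C)) = d := fun b d _ hd => by
      rw [QuotientAddGroup.eq, AddSubgroup.mem_comap]
      have := N.add_mem (N.neg_mem (hc b)) hd
      simpa using this
    refine ⟨AddMonoidHom.mk' (fun b => (c b : C ⧸ N.comap (AddMonoidHom.inr B C))) fun b b' => ?_,
      ?_⟩
    · exact huniq _ _ rfl (N.add_mem (hc b) (hc b'))
    · refine Subtype.ext (AddSubgroup.ext fun x => ?_)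
      constructor
      · rintro ⟨hx, hx'⟩
        have h1 := QuotientAddGroup.eq.1 hx'
        rw [AddSubgroup.mem_comap] at h1
        have h2 := N.add_mem (hc ⟨x.1, hx⟩) h1
        simpa using h2
      · intro hx
        exact ⟨⟨x, hx, rfl⟩, huniq ⟨x.1, ⟨x, hx, rfl⟩⟩ x.2 rfl hx⟩

/-- A subgroup of finite index is free of the same rank, so a homomorphism is a free choice of
images of a basis. -/
theorem card_hom_of_finiteIndex [Module.Free ℤ B] [Module.Finite ℤ B] (S : AddSubgroup B)
    [S.FiniteIndex] (A : Type*) [AddCommGroup A] :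
    Nat.card (S →+ A) = Nat.card A ^ Module.finrank ℤ B := by
  let S1 := AddSubgroup.toIntSubmodule S
  have hr : Module.finrank ℤ S1 = Module.finrank ℤ B := by
    have : Finite (B ⧸ S1) := inferInstanceAs (Finite (B ⧸ S))
    exact (Submodule.finiteQuotient_iff S1).1 this
  let b := Module.finBasisOfFinrankEq ℤ S1 hr
  have e : (S →+ A) ≃ (Fin (Module.finrank ℤ B) → A) :=
    (addMonoidHomLequivInt ℤ (A := S) (B := A)).toEquiv.trans (b.constr ℤ).symm.toEquiv
  rw [Nat.card_congr e, Nat.card_fun, Nat.card_fin]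

theorem card_prod_fiber [Module.Free ℤ B] [Module.Finite ℤ B] (S : AddSubgroup B)
    [S.FiniteIndex] (S' : AddSubgroup C) :
    Nat.card {N : AddSubgroup (B × C) // N.map (AddMonoidHom.fst B C) = S ∧
      N.comap (AddMonoidHom.inr B C) = S'} = S'.index ^ Module.finrank ℤ B := by
  rw [card_prod_fiber_eq_card_hom, card_hom_of_finiteIndex]
  rfl

end Prod

theorem PowIndex.finiteIndex {p : ℕ} (hp : p.Prime) {B : Type*} [AddCommGroup B]
    (S : PowIndex p B) : S.1.FiniteIndex := by
  obtain ⟨k, hk⟩ := S.2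
  exact ⟨by rw [hk]; exact pow_ne_zero _ hp.ne_zero⟩

theorem finite_prod_fiber {p : ℕ} (hp : p.Prime) {B C : Type*} [AddCommGroup B] [AddCommGroup C]
    [Module.Free ℤ B] [Module.Finite ℤ B] (S : PowIndex p B) (S' : PowIndex p C) :
    Finite {N : AddSubgroup (B × C) // N.map (AddMonoidHom.fst B C) = S.1 ∧
      N.comap (AddMonoidHom.inr B C) = S'.1} := by
  have := S.finiteIndex hp
  have := S'.finiteIndex hp
  refine Nat.finite_of_card_ne_zero ?_
  rw [card_prod_fiber]
  exact pow_ne_zero _ AddSubgroup.FiniteIndex.index_ne_zero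

/-- Isomorphic groups have the same subgroups of `p`-power index. -/
def PowIndex.congr (p : ℕ) {B C : Type*} [AddCommGroup B] [AddCommGroup C] (e : B ≃+ C) :
    PowIndex p B ≃ PowIndex p C :=
  e.mapAddSubgroup.toEquiv.subtypeEquiv fun S => by
    change _ ↔ ∃ k, (S.map (e : B →+ C)).index = _
    rw [AddSubgroup.index_map_equiv]

theorem PowIndex.index_congr (p : ℕ) {B C : Type*} [AddCommGroup B] [AddCommGroup C] (e : B ≃+ C)
    (S : PowIndex p B) : (PowIndex.congr p e S).1.index = S.1.index :=
  AddSubgroup.index_map_equiv S.1 e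

theorem eq_zmultiples_of_index_eq {p k : ℕ} {S : AddSubgroup ℤ} (h : S.index = p ^ k) :
    S = AddSubgroup.zmultiples ((p : ℤ) ^ k) := by
  obtain ⟨g, rfl⟩ := Int.subgroup_cyclic S
  rw [← AddSubgroup.zmultiples_eq_closure] at h ⊢
  rw [Int.index_zmultiples] at h
  rw [← Int.zmultiples_natAbs g, h, Nat.cast_pow]

theorem hasSum_powIndex_int {p : ℕ} (hp : p.Prime) {s : ℂ} {d : ℕ}
    (hs : ‖(p : ℂ) ^ d * (p : ℂ) ^ (-s)‖ < 1) :
    HasSum (fun S : PowIndex p ℤ => (S.1.index : ℂ) ^ d * (S.1.index : ℂ) ^ (-s))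
      (1 / (1 - (p : ℂ) ^ d * (p : ℂ) ^ (-s))) := by
  let e : ℕ ≃ PowIndex p ℤ := Equiv.ofBijective
    (fun k => ⟨AddSubgroup.zmultiples ((p : ℤ) ^ k), k, by
      rw [Int.index_zmultiples, Int.natAbs_pow, Int.natAbs_natCast]⟩) ⟨fun k k' h => by
      have h1 := congrArg (fun S : PowIndex p ℤ => S.1.index) h
      simp only [Int.index_zmultiples, Int.natAbs_pow, Int.natAbs_natCast] at h1
      exact Nat.pow_right_injective hp.two_le h1, fun S => by
      obtain ⟨S, k, hk⟩ := S
      exact ⟨k, Subtype.ext (eq_zmultiples_of_index_eq hk).symm⟩⟩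
  rw [← e.hasSum_iff, one_div]
  refine (hasSum_geometric_of_norm_lt_one hs).congr_fun fun k => ?_
  have : (e k).1.index = p ^ k := by
    change (AddSubgroup.zmultiples ((p : ℤ) ^ k)).index = _
    rw [Int.index_zmultiples, Int.natAbs_pow, Int.natAbs_natCast]
  rw [Function.comp_apply, this, natCast_pow_cpow, Nat.cast_pow, mul_pow, ← pow_mul, ← pow_mul,
    mul_comm k]

/-- The subgroups of `p`-power index in a product, grouped by projection and intersection. -/
def powIndexProdEquiv {p : ℕ} (hp : p.Prime) (B C : Type*) [AddCommGroup B] [AddCommGroup C] :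
    (Σ x : PowIndex p B × PowIndex p C, {N : AddSubgroup (B × C) //
      N.map (AddMonoidHom.fst B C) = x.1.1 ∧ N.comap (AddMonoidHom.inr B C) = x.2.1}) ≃
      PowIndex p (B × C) where
  toFun y := ⟨y.2.1, by
    obtain ⟨k, hk⟩ := y.1.1.2
    obtain ⟨k', hk'⟩ := y.1.2.2
    exact ⟨k + k', by rw [index_prod_eq_mul, y.2.2.1, y.2.2.2, hk, hk', pow_add]⟩⟩
  invFun N := ⟨(⟨N.1.map (AddMonoidHom.fst B C), by
      obtain ⟨k, hk⟩ := N.2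
      rw [index_prod_eq_mul] at hk
      obtain ⟨j, -, hj⟩ := (Nat.dvd_prime_pow hp).1 (Dvd.intro _ hk)
      exact ⟨j, hj⟩⟩, ⟨N.1.comap (AddMonoidHom.inr B C), by
      obtain ⟨k, hk⟩ := N.2
      rw [index_prod_eq_mul] at hk
      obtain ⟨j, -, hj⟩ := (Nat.dvd_prime_pow hp).1 (Dvd.intro_left _ hk)
      exact ⟨j, hj⟩⟩), N.1, rfl, rfl⟩
  left_inv := by
    rintro ⟨⟨⟨S, hS⟩, ⟨S', hS'⟩⟩, ⟨N, h1, h2⟩⟩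
    dsimp only at h1 h2
    subst h1 h2
    rfl
  right_inv N := rfl

/-- Adding a coordinate to `ℤ^d` gives `|ℤ : S'|^d` subgroups for each pair of a projection and an
intersection `S'`. The sum over `S'` is the geometric series in `p^d t`. -/
theorem hasSum_powIndex_pi {p : ℕ} (hp : p.Prime) {s : ℂ} (d : ℕ)
    (hs : ∀ i < d, ‖(p : ℂ) ^ i * (p : ℂ) ^ (-s)‖ < 1) :
    HasSum (fun S : PowIndex p (Fin d → ℤ) => (S.1.index : ℂ) ^ (-s))
      (∏ i ∈ Finset.range d, 1 / (1 - (p : ℂ) ^ i * (p : ℂ) ^ (-s))) := by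
  induction d with
  | zero =>
    have huniq : Unique (PowIndex p (Fin 0 → ℤ)) :=
      ⟨⟨⟨⊤, 0, by simp⟩⟩, fun S => Subtype.ext (Subsingleton.elim _ _)⟩
    convert hasSum_unique (fun S : PowIndex p (Fin 0 → ℤ) => (S.1.index : ℂ) ^ (-s)) using 1
    have : (default : PowIndex p (Fin 0 → ℤ)).1 = ⊤ := Subsingleton.elim _ _
    rw [this]
    simp
  | succ d ih =>
    have h1 := HasSum.mul_complex (ih fun i hi => hs i (by omega))
      (hasSum_powIndex_int hp (hs d (by omega)))
    rw [← Finset.prod_range_succ (fun i => 1 / (1 - (p : ℂ) ^ i * (p : ℂ) ^ (-s)))] at h1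
    have hfin := fun x : PowIndex p (Fin d → ℤ) × PowIndex p ℤ => finite_prod_fiber hp x.1 x.2
    have h2 := (hasSum_sigma_const_iff (κ := fun x : PowIndex p (Fin d → ℤ) × PowIndex p ℤ =>
      {N : AddSubgroup ((Fin d → ℤ) × ℤ) // N.map (AddMonoidHom.fst _ _) = x.1.1 ∧
        N.comap (AddMonoidHom.inr _ _) = x.2.1})
      (fun x => (x.1.1.index : ℂ) ^ (-s) * (x.2.1.index : ℂ) ^ (-s)) _).2 (h1.congr_fun fun x => by
        have := x.1.finiteIndex hp
        rw [card_prod_fiber, Module.finrank_fin_fun]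
        push_cast
        ring)
    rw [← ((powIndexProdEquiv hp (Fin d → ℤ) ℤ).trans
      (PowIndex.congr p (snocAddEquiv fun _ : Fin (d + 1) => ℤ))).hasSum_iff]
    refine h2.congr_fun fun y => ?_
    rw [Function.comp_apply, Equiv.trans_apply, PowIndex.index_congr]
    change ((y.2.1.index : ℕ) : ℂ) ^ (-s) = _
    rw [index_prod_eq_mul, y.2.2.1, y.2.2.2, Nat.cast_mul, Complex.natCast_mul_natCast_cpow]

end HeisenbergZeta
end

noncomputable section
namespace HeisenbergZeta

/-! ### Sublattices of `ℤ^n` and the products `∏ p^{ℓ_i} ℤ` they contain -/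

/-- Reduction modulo `p^{ℓ_i}` in the `i`-th coordinate. -/
def reduction (p : ℕ) {n : ℕ} (l : Fin n → ℕ) : (Fin n → ℤ) →+ ∀ i, ZMod (p ^ l i) :=
  AddMonoidHom.pi fun i => (Int.castAddHom _).comp (Pi.evalAddMonoidHom _ i)

theorem reduction_surjective (p : ℕ) {n : ℕ} (l : Fin n → ℕ) :
    Function.Surjective (reduction p l) := fun y => by
  choose x hx using fun i => ZMod.intCast_surjective (y i)
  exact ⟨x, funext hx⟩

theorem mem_ker_reduction {p n : ℕ} {l : Fin n → ℕ} {x : Fin n → ℤ} :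
    x ∈ (reduction p l).ker ↔ ∀ i, (p : ℤ) ^ l i ∣ x i := by
  rw [AddMonoidHom.mem_ker, funext_iff]
  refine forall_congr' fun i => ?_
  exact (ZMod.intCast_zmod_eq_zero_iff_dvd (x i) (p ^ l i)).trans (by rw [Nat.cast_pow])

theorem index_ker_reduction (p : ℕ) {n : ℕ} (l : Fin n → ℕ) :
    (reduction p l).ker.index = p ^ ∑ i, l i := by
  rw [AddSubgroup.index_ker, AddMonoidHom.range_eq_top.2 (reduction_surjective p l),
    AddSubgroup.card_top, card_pi_zmod_pow]

theorem exists_core {p : ℕ} (hp : p.Prime) {n : ℕ} (S : PowIndex p (Fin n → ℤ)) :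
    ∃ c : Fin n → ℕ, ∀ i a, Pi.single i a ∈ S.1 ↔ (p : ℤ) ^ c i ∣ a := by
  obtain ⟨S, k, hk⟩ := S
  have h : ∀ i : Fin n, ∃ c, ∀ a, Pi.single i a ∈ S ↔ (p : ℤ) ^ c ∣ a := fun i => by
    have h1 : (S.comap (AddMonoidHom.single (fun _ : Fin n => ℤ) i)).index ∣ p ^ k := by
      rw [AddSubgroup.index_comap, ← hk]
      exact AddSubgroup.relIndex_dvd_index_of_normal _ _
    obtain ⟨c, -, hc⟩ := (Nat.dvd_prime_pow hp).1 h1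
    refine ⟨c, fun a => ?_⟩
    rw [← Int.mem_zmultiples_iff, ← eq_zmultiples_of_index_eq hc]
    rfl
  choose c hc using h
  exact ⟨c, hc⟩

/-- The exponents `c` for which `∏ p^{c_i} ℤ` is the largest product contained in `S`. -/
def core {p : ℕ} (hp : p.Prime) {n : ℕ} (S : PowIndex p (Fin n → ℤ)) : Fin n → ℕ :=
  (exists_core hp S).choose

theorem single_mem_iff {p : ℕ} (hp : p.Prime) {n : ℕ} (S : PowIndex p (Fin n → ℤ)) (i : Fin n)
    (a : ℤ) : Pi.single i a ∈ S.1 ↔ (p : ℤ) ^ core hp S i ∣ a :=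
  (exists_core hp S).choose_spec i a

/-- A vector is the sum of its coordinate vectors, and those in `S` are described by `core`. So the
core is the least `ℓ` with `∏ p^{ℓ_i} ℤ ⊆ S`. -/
theorem ker_reduction_le_iff {p : ℕ} (hp : p.Prime) {n : ℕ} (S : PowIndex p (Fin n → ℤ))
    (l : Fin n → ℕ) : (reduction p l).ker ≤ S.1 ↔ core hp S ≤ l := by
  have hdvd : ∀ i, core hp S i ≤ l i ↔ (p : ℤ) ^ core hp S i ∣ (p : ℤ) ^ l i := fun i =>
    (Nat.pow_dvd_pow_iff_le_right hp.one_lt).symm.trans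
      (by rw [← Int.natCast_dvd_natCast, Nat.cast_pow, Nat.cast_pow])
  constructor
  · intro h i
    rw [hdvd, ← single_mem_iff]
    refine h (mem_ker_reduction.2 fun j => ?_)
    by_cases hij : j = i
    · subst hij
      rw [Pi.single_eq_same]
    · rw [Pi.single_eq_of_ne hij]
      exact dvd_zero _
  · intro h x hx
    rw [← Finset.univ_sum_single x]
    exact sum_mem fun i _ => (single_mem_iff hp S i _).2
      (((hdvd i).1 (h i)).trans (mem_ker_reduction.1 hx i))

/-- A sublattice of `p`-power index containing `∏ p^{ℓ_i} ℤ`, with `ℓ` measured from the core of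
the sublattice. -/
def latticePair {p : ℕ} (hp : p.Prime) {n : ℕ} (y : TorsionSubgroups n p) :
    PowIndex p (Fin n → ℤ) × (Fin n → ℕ) :=
  let S : PowIndex p (Fin n → ℤ) := ⟨y.2.comap (reduction p y.1), by
    rw [AddSubgroup.index_comap_of_surjective _ (reduction_surjective p y.1)]
    obtain ⟨k, -, hk⟩ := (Nat.dvd_prime_pow hp).1
      ((card_pi_zmod_pow p y.1) ▸ AddSubgroup.index_dvd_card y.2)
    exact ⟨k, hk⟩⟩
  (S, y.1 - core hp S)

theorem core_latticePair_le {p : ℕ} (hp : p.Prime) {n : ℕ} (y : TorsionSubgroups n p) :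
    core hp (latticePair hp y).1 ≤ y.1 :=
  (ker_reduction_le_iff hp _ _).1 (AddSubgroup.ker_le_comap _ _)

theorem core_add_latticePair {p : ℕ} (hp : p.Prime) {n : ℕ} (y : TorsionSubgroups n p) :
    core hp (latticePair hp y).1 + (latticePair hp y).2 = y.1 :=
  add_tsub_cancel_of_le (core_latticePair_le hp y)

theorem index_latticePair {p : ℕ} (hp : p.Prime) {n : ℕ} (y : TorsionSubgroups n p) :
    (latticePair hp y).1.1.index = y.2.index :=
  AddSubgroup.index_comap_of_surjective _ (reduction_surjective p y.1)

theorem bijective_latticePair {p : ℕ} (hp : p.Prime) {n : ℕ} :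
    Function.Bijective (latticePair hp (n := n)) := by
  constructor
  · intro y y' h
    have h1 : y.1 = y'.1 := by rw [← core_add_latticePair hp y, h, core_add_latticePair]
    obtain ⟨l, H⟩ := y
    obtain ⟨l', H'⟩ := y'
    obtain rfl : l = l' := h1
    have h2 : H.comap (reduction p l) = H'.comap (reduction p l) :=
      congrArg (fun z : PowIndex p (Fin n → ℤ) × (Fin n → ℕ) => z.1.1) h
    rw [AddSubgroup.comap_injective (reduction_surjective p l) h2]
  · rintro ⟨S, d⟩
    have h1 : (S.1.map (reduction p (core hp S + d))).comap (reduction p (core hp S + d)) = S.1 :=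
      AddSubgroup.comap_map_eq_self ((ker_reduction_le_iff hp S _).2 le_self_add)
    have h2 : (latticePair hp ⟨core hp S + d, S.1.map (reduction p (core hp S + d))⟩).1 = S :=
      Subtype.ext h1
    refine ⟨⟨core hp S + d, S.1.map (reduction p (core hp S + d))⟩, Prod.ext h2 ?_⟩
    have h3 := core_add_latticePair hp ⟨core hp S + d, S.1.map (reduction p (core hp S + d))⟩
    rw [h2] at h3
    exact add_left_cancel h3

/-- The sum over `TorsionSubgroups` runs over lattices and excesses `d = ℓ - core`. The excesses
contribute the factor `(1 - t²)^{-n}` independently of the lattice, and this is divided out. -/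
theorem hasSum_powIndex_core {n : ℕ} (hn : 1 ≤ n) {r : DyckWords n → ℕ}
    {L M : DyckWords n → ℕ → ℕ} (hblock : ∀ w, IsBlockForm n w.1 (r w) (L w) (M w)) {p : ℕ}
    (hp : p.Prime) {s : ℂ} (hs : 2 * (n : ℝ) / 3 < s.re) :
    HasSum (fun S : PowIndex p (Fin n → ℤ) => (S.1.index : ℂ) ^ (2 * n) * (S.1.index : ℂ) ^ (-s) *
        ((p : ℂ) ^ (-s)) ^ (2 * ∑ i, core hp S i))
      ((1 - ((p : ℂ) ^ (-s)) ^ 2) ^ n *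
        ∑ w, splitProduct n (r w) (L w) (M w) (p : ℂ) ((p : ℂ) ^ (-s))) := by
  set t := (p : ℂ) ^ (-s) with ht
  set a : PowIndex p (Fin n → ℤ) → ℂ := fun S => (S.1.index : ℂ) ^ (2 * n) *
    (S.1.index : ℂ) ^ (-s) * t ^ (2 * ∑ i, core hp S i) with ha
  have ht1 : ‖t ^ 2‖ < 1 := by
    rw [norm_pow]
    refine pow_lt_one₀ (norm_nonneg _) ?_ two_ne_zero
    rw [ht, Complex.norm_natCast_cpow_of_pos hp.pos]
    refine Real.rpow_lt_one_of_one_lt_of_neg (by exact_mod_cast hp.one_lt) ?_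
    rw [Complex.neg_re, neg_lt_zero]
    exact lt_of_le_of_lt (by positivity) hs
  have h1 : HasSum (fun z : PowIndex p (Fin n → ℤ) × (Fin n → ℕ) => a z.1 * ∏ i, (t ^ 2) ^ z.2 i)
      (∑ w, splitProduct n (r w) (L w) (M w) (p : ℂ) t) := by
    rw [← (Equiv.ofBijective _ (bijective_latticePair hp)).hasSum_iff]
    refine (hasSum_torsionSubgroups_index hn hblock hp hs).congr_fun fun y => ?_
    rw [Function.comp_apply, Equiv.ofBijective_apply, ha]
    dsimp only
    rw [index_latticePair, mul_assoc, Finset.prod_pow_eq_pow_sum, ← pow_mul, ← pow_add, ← mul_add,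
      ← Finset.sum_add_distrib]
    simp only [← Pi.add_apply, core_add_latticePair, ht]
  have h2 : HasSum (fun d : Fin n → ℕ => ∏ i, (t ^ 2) ^ d i) (∏ _i : Fin n, (1 - t ^ 2)⁻¹) :=
    hasSum_pi_prod fun _ => hasSum_geometric_of_norm_lt_one ht1
  -- The terms with excess `d = 0` form a subfamily of a summable family.
  have h3 : Summable a := by
    have := h1.summable.comp_injective
      (i := fun S : PowIndex p (Fin n → ℤ) => (S, (0 : Fin n → ℕ)))
      fun S S' h => congrArg Prod.fst h
    simpa [Function.comp_def] using this
  have h4 := (HasSum.mul_complex h3.hasSum h2).unique h1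
  have hne : 1 - t ^ 2 ≠ 0 := fun h => by
    rw [← sub_eq_zero.1 h, norm_one] at ht1
    exact lt_irrefl _ ht1
  rw [← h4, Finset.prod_const, Finset.card_univ, Fintype.card_fin, mul_left_comm, ← mul_pow,
    mul_inv_cancel₀ hne, one_pow, mul_one]
  exact h3.hasSum

/-! ### The ideals of the Heisenberg Lie ring -/

/-- The subgroups of `R × R × R` that correspond to the normal subgroups of the Heisenberg group
of `R`. -/
def IsHeisIdeal {R : Type*} [CommRing R] (N : AddSubgroup ((R × R) × R)) : Prop :=
  ∀ x ∈ N, ∀ c : R, ((0, 0), x.1.1 * c) ∈ N ∧ ((0, 0), x.1.2 * c) ∈ N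

/-- The ideal generated by `a` in `ℤ^n` is spanned by the vectors with single entry `a_i` at `i`, by
multiplication with the idempotents. It lies in `S'` exactly when each `a_i` is divisible by `p` to
the core exponent. -/
theorem isHeisIdeal_iff {p : ℕ} (hp : p.Prime) {n : ℕ}
    (N : AddSubgroup (((Fin n → ℤ) × (Fin n → ℤ)) × (Fin n → ℤ))) (S' : PowIndex p (Fin n → ℤ))
    (hS' : N.comap (AddMonoidHom.inr _ _) = S'.1) :
    IsHeisIdeal N ↔ N.map (AddMonoidHom.fst _ _) ≤
      (reduction p (core hp S')).ker.prod (reduction p (core hp S')).ker := by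
  have key : ∀ a : Fin n → ℤ, (∀ c, ((0, 0), a * c) ∈ N) ↔ a ∈ (reduction p (core hp S')).ker := by
    intro a
    have h1 : ∀ b, ((0, 0), b) ∈ N ↔ b ∈ S'.1 := fun b => by
      rw [← hS']
      rfl
    simp only [h1, mem_ker_reduction]
    constructor
    · intro h i
      rw [← single_mem_iff]
      convert h (Pi.single i 1) using 1
      funext j
      by_cases hij : j = i
      · subst hij
        simp
      · simp [hij]
    · intro h c
      rw [← Finset.univ_sum_single (a * c)]
      exact sum_mem fun i _ => (single_mem_iff hp S' i _).2 ((h i).mul_right _)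
  constructor
  · rintro h _ ⟨x, hx, rfl⟩
    exact ⟨(key _).1 fun c => (h x hx c).1, (key _).1 fun c => (h x hx c).2⟩
  · intro h x hx c
    have h1 := h ⟨x, hx, rfl⟩
    exact ⟨(key _).2 h1.1 c, (key _).2 h1.2 c⟩

/-- `K` is itself free of rank `d`, and the index in `B` is the index in `K` times that of `K`. -/
theorem exists_equiv_powIndex_le {p : ℕ} (hp : p.Prime) {B : Type*} [AddCommGroup B]
    [Module.Free ℤ B] [Module.Finite ℤ B] {d : ℕ} (hd : Module.finrank ℤ B = d)
    (K : PowIndex p B) : ∃ E : PowIndex p (Fin d → ℤ) ≃ {S : PowIndex p B // S.1 ≤ K.1},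
      ∀ x, (E x).1.1.index = x.1.index * K.1.index := by
  have hfin := K.finiteIndex hp
  have hr : Module.finrank ℤ (AddSubgroup.toIntSubmodule K.1) = d := by
    have : Finite (B ⧸ AddSubgroup.toIntSubmodule K.1) := inferInstanceAs (Finite (B ⧸ K.1))
    exact ((Submodule.finiteQuotient_iff (AddSubgroup.toIntSubmodule K.1)).1 this).trans hd
  let e : (Fin d → ℤ) ≃+ K.1 :=
    (Module.finBasisOfFinrankEq ℤ (AddSubgroup.toIntSubmodule K.1) hr).equivFun.symm.toAddEquiv
  have hidx : ∀ S : AddSubgroup K.1, (S.map K.1.subtype).index = S.index * K.1.index := fun S => by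
    rw [AddSubgroup.index_map, AddSubgroup.ker_subtype, sup_bot_eq, AddSubgroup.range_subtype]
  obtain ⟨k, hk⟩ := K.2
  let E : PowIndex p K.1 ≃ {S : PowIndex p B // S.1 ≤ K.1} :=
    { toFun := fun S => ⟨⟨S.1.map K.1.subtype, by
        obtain ⟨j, hj⟩ := S.2
        exact ⟨j + k, by rw [hidx, hj, hk, pow_add]⟩⟩, AddSubgroup.map_subtype_le _⟩
      invFun := fun S => ⟨S.1.1.addSubgroupOf K.1, by
        obtain ⟨j, hj⟩ := S.1.2
        have h1 := hidx (S.1.1.addSubgroupOf K.1)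
        rw [AddSubgroup.addSubgroupOf_map_subtype, inf_eq_left.2 S.2, hj] at h1
        obtain ⟨i, -, hi⟩ := (Nat.dvd_prime_pow hp).1 (Dvd.intro _ h1.symm)
        exact ⟨i, hi⟩⟩
      left_inv := fun S => Subtype.ext
        (AddSubgroup.comap_map_eq_self_of_injective K.1.subtype_injective S.1)
      right_inv := fun S => Subtype.ext (Subtype.ext (by
        change (S.1.1.addSubgroupOf K.1).map K.1.subtype = S.1.1
        rw [AddSubgroup.addSubgroupOf_map_subtype, inf_eq_left.2 S.2])) }
  refine ⟨(PowIndex.congr p e).trans E, fun x => ?_⟩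
  rw [← PowIndex.index_congr p e x]
  exact hidx _

/-- An ideal is a lattice `S'`, a sublattice of `K S'`, and one of `|ℤ^n : S'|^{2n}` homomorphisms.
The sublattices of `K S'` are parametrized by those of `ℤ^{2n}`, so the sum splits into two
independent series; the one over `ℤ^{2n}` needs `Re(s) > 2n - 1`. -/
theorem hasSum_heisIdeal {n : ℕ} (hn : 1 ≤ n) {r : DyckWords n → ℕ}
    {L M : DyckWords n → ℕ → ℕ} (hblock : ∀ w, IsBlockForm n w.1 (r w) (L w) (M w)) {p : ℕ}
    (hp : p.Prime) {s : ℂ} (hs : 2 * (n : ℝ) - 1 < s.re) :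
    HasSum (fun N : {N : AddSubgroup (((Fin n → ℤ) × (Fin n → ℤ)) × (Fin n → ℤ)) //
      (∃ k, N.index = p ^ k) ∧ IsHeisIdeal N} => (N.1.index : ℂ) ^ (-s))
      (normalW n r L M (p : ℂ) ((p : ℂ) ^ (-s))) := by
  have hn' : (1 : ℝ) ≤ n := by exact_mod_cast hn
  have h1 := hasSum_powIndex_core hn hblock hp (s := s) (by linarith)
  have h2 : HasSum (fun S : PowIndex p (Fin (2 * n) → ℤ) => (S.1.index : ℂ) ^ (-s)) _ :=
    hasSum_powIndex_pi hp (2 * n) fun i hi => by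
      have hi' : (i : ℝ) ≤ 2 * n - 1 := by
        have : ((i + 1 : ℕ) : ℝ) ≤ (2 * n : ℕ) := by exact_mod_cast hi
        push_cast at this
        linarith
      have hp1 : (1 : ℝ) < p := by exact_mod_cast hp.one_lt
      rw [norm_mul, norm_pow, Complex.norm_natCast, Complex.norm_natCast_cpow_of_pos hp.pos,
        ← Real.rpow_natCast, ← Real.rpow_add (by linarith)]
      refine Real.rpow_lt_one_of_one_lt_of_neg hp1 ?_
      rw [Complex.neg_re]
      linarith
  have hrank : Module.finrank ℤ ((Fin n → ℤ) × (Fin n → ℤ)) = 2 * n := by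
    rw [Module.finrank_prod, Module.finrank_fin_fun, two_mul]
  let K : PowIndex p (Fin n → ℤ) → PowIndex p ((Fin n → ℤ) × (Fin n → ℤ)) := fun S =>
    ⟨(reduction p (core hp S)).ker.prod (reduction p (core hp S)).ker, 2 * ∑ i, core hp S i, by
      rw [AddSubgroup.index_prod, index_ker_reduction, two_mul, pow_add]⟩
  have hK : ∀ S, (K S).1.index = p ^ (2 * ∑ i, core hp S i) := fun S => by
    change ((reduction p (core hp S)).ker.prod (reduction p (core hp S)).ker).index = _
    rw [AddSubgroup.index_prod, index_ker_reduction, two_mul, pow_add]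
  choose E hE using fun S => exists_equiv_powIndex_le hp hrank (K S)
  let X := PowIndex p (Fin n → ℤ) × PowIndex p (Fin (2 * n) → ℤ)
  let κ : X → Type := fun x =>
    {N : AddSubgroup (((Fin n → ℤ) × (Fin n → ℤ)) × (Fin n → ℤ)) //
      N.map (AddMonoidHom.fst _ _) = (E x.1 x.2).1.1 ∧ N.comap (AddMonoidHom.inr _ _) = x.1.1}
  have hfin : ∀ x, Finite (κ x) := fun x => finite_prod_fiber hp (E x.1 x.2).1 x.1
  have hcard : ∀ x, Nat.card (κ x) = x.1.1.index ^ (2 * n) := fun x => by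
    have := (E x.1 x.2).1.finiteIndex hp
    exact (card_prod_fiber (E x.1 x.2).1.1 x.1.1).trans (by rw [hrank])
  have hidx : ∀ (x : X) (N : κ x), (N.1.index : ℂ) ^ (-s) = (x.1.1.index : ℂ) ^ (-s) *
      ((p : ℂ) ^ (-s)) ^ (2 * ∑ i, core hp x.1 i) * (x.2.1.index : ℂ) ^ (-s) := fun x N => by
    rw [index_prod_eq_mul, N.2.1, N.2.2, hE, hK, Nat.cast_mul, Complex.natCast_mul_natCast_cpow,
      Nat.cast_mul, Complex.natCast_mul_natCast_cpow, natCast_pow_cpow]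
    ring
  have h3 := (hasSum_sigma_const_iff (κ := κ) (fun x => (x.1.1.index : ℂ) ^ (-s) *
    ((p : ℂ) ^ (-s)) ^ (2 * ∑ i, core hp x.1 i) * (x.2.1.index : ℂ) ^ (-s)) _).2
    ((HasSum.mul_complex h1 h2).congr_fun fun x => by
      rw [hcard]
      push_cast
      ring)
  let F : (Σ x, κ x) → {N : AddSubgroup (((Fin n → ℤ) × (Fin n → ℤ)) × (Fin n → ℤ)) //
      (∃ k, N.index = p ^ k) ∧ IsHeisIdeal N} := fun y => ⟨y.2.1, by
    obtain ⟨j, hj⟩ := (E y.1.1 y.1.2).1.2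
    obtain ⟨k, hk⟩ := y.1.1.2
    exact ⟨j + k, by rw [index_prod_eq_mul, y.2.2.1, y.2.2.2, hj, hk, pow_add]⟩, by
    rw [isHeisIdeal_iff hp y.2.1 y.1.1 y.2.2.2, y.2.2.1]
    exact (E y.1.1 y.1.2).2⟩
  have hF : Function.Bijective F := by
    constructor
    · rintro ⟨⟨S, x⟩, ⟨N, hN⟩⟩ ⟨⟨S', x'⟩, ⟨N', hN'⟩⟩ h
      obtain rfl : N = N' := congrArg Subtype.val h
      obtain rfl : S = S' := Subtype.ext (hN.2.symm.trans hN'.2)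
      obtain rfl : x = x' := (E S).injective (Subtype.ext (Subtype.ext (hN.1.symm.trans hN'.1)))
      rfl
    · rintro ⟨N, ⟨k, hk⟩, hN⟩
      rw [index_prod_eq_mul] at hk
      obtain ⟨i, -, hi⟩ := (Nat.dvd_prime_pow hp).1 (Dvd.intro _ hk)
      obtain ⟨j, -, hj⟩ := (Nat.dvd_prime_pow hp).1 (Dvd.intro_left _ hk)
      let S : PowIndex p (Fin n → ℤ) := ⟨_, j, hj⟩
      let y : {T : PowIndex p ((Fin n → ℤ) × (Fin n → ℤ)) // T.1 ≤ (K S).1} :=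
        ⟨⟨_, i, hi⟩, (isHeisIdeal_iff hp N S rfl).1 hN⟩
      refine ⟨⟨(S, (E S).symm y), N, ?_, rfl⟩, rfl⟩
      rw [Equiv.apply_symm_apply]
  rw [← (Equiv.ofBijective F hF).hasSum_iff, normalW]
  have hval : (1 - ((p : ℂ) ^ (-s)) ^ 2) ^ n *
      (1 / ∏ i ∈ Finset.range (2 * n), (1 - (p : ℂ) ^ i * (p : ℂ) ^ (-s))) *
      ∑ w, splitProduct n (r w) (L w) (M w) (p : ℂ) ((p : ℂ) ^ (-s)) =
      (1 - ((p : ℂ) ^ (-s)) ^ 2) ^ n *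
      (∑ w, splitProduct n (r w) (L w) (M w) (p : ℂ) ((p : ℂ) ^ (-s))) *
      ∏ i ∈ Finset.range (2 * n), 1 / (1 - (p : ℂ) ^ i * (p : ℂ) ^ (-s)) := by
    rw [Finset.prod_div_distrib, Finset.prod_const_one]
    ring
  rw [hval]
  exact h3.congr_fun fun y => hidx y.1 y.2

/-- The number of subgroups of index `m` of `R × R × R` that correspond to normal subgroups of
the Heisenberg group of `R`. -/
def heisCount (R : Type*) [CommRing R] (m : ℕ) : ℕ :=
  Nat.card {N : AddSubgroup ((R × R) × R) // IsHeisIdeal N ∧ N.index = m}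

theorem hasSum_heisCount {n : ℕ} (hn : 1 ≤ n) {r : DyckWords n → ℕ}
    {L M : DyckWords n → ℕ → ℕ} (hblock : ∀ w, IsBlockForm n w.1 (r w) (L w) (M w)) {p : ℕ}
    (hp : p.Prime) {s : ℂ} (hs : 2 * (n : ℝ) - 1 < s.re) :
    HasSum (fun k : ℕ => (heisCount (Fin n → ℤ) (p ^ k) : ℂ) * ((p ^ k : ℕ) : ℂ) ^ (-s))
      (normalW n r L M (p : ℂ) ((p : ℂ) ^ (-s))) := by
  let κ : ℕ → Type := fun k => {N : AddSubgroup (((Fin n → ℤ) × (Fin n → ℤ)) × (Fin n → ℤ)) //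
    IsHeisIdeal N ∧ N.index = p ^ k}
  let e : (Σ k, κ k) ≃ {N : AddSubgroup (((Fin n → ℤ) × (Fin n → ℤ)) × (Fin n → ℤ)) //
      (∃ k, N.index = p ^ k) ∧ IsHeisIdeal N} :=
    Equiv.ofBijective (fun y => ⟨y.2.1, ⟨y.1, y.2.2.2⟩, y.2.2.1⟩) ⟨by
      rintro ⟨k, N, hN⟩ ⟨k', N', hN'⟩ h
      obtain rfl : N = N' := congrArg Subtype.val h
      obtain rfl : k = k' := Nat.pow_right_injective hp.two_le (hN.2.symm.trans hN'.2)
      rfl, fun ⟨N, ⟨k, hk⟩, hN⟩ => ⟨⟨k, N, hN, hk⟩, rfl⟩⟩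
  have h1 : HasSum (fun y : Σ k, κ k => ((p ^ y.1 : ℕ) : ℂ) ^ (-s)) _ :=
    (e.hasSum_iff.2 (hasSum_heisIdeal hn hblock hp hs)).congr_fun fun y => by
      rw [← y.2.2.2]
      rfl
  -- A nonzero constant is summable only over a finite set.
  have hfin : ∀ k, Finite (κ k) := fun k => by
    have h2 := h1.summable.comp_injective (sigma_mk_injective (i := k))
    have h3 : ((p ^ k : ℕ) : ℂ) ^ (-s) ≠ 0 := by
      rw [natCast_pow_cpow]
      exact pow_ne_zero _ fun h =>
        hp.ne_zero (by exact_mod_cast ((Complex.cpow_eq_zero_iff _ _).1 h).1)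
    by_contra hinf
    rw [not_finite_iff_infinite] at hinf
    exact h3 ((summable_const_iff _).1 h2)
  exact (hasSum_sigma_const_iff (κ := κ) (fun k => ((p ^ k : ℕ) : ℂ) ^ (-s)) _).1 h1

end HeisenbergZeta
end

noncomputable section
namespace HeisenbergZeta

/-! ### Normal subgroups of Heisenberg groups -/

/-- Coordinates on a group that identify it with the Heisenberg group of `R`. -/
structure HeisCoord (G R : Type*) [Group G] [CommRing R] where
  /-- The coordinates of an element. -/
  toEquiv : G ≃ (R × R) × R
  map_mul : ∀ g h, toEquiv (g * h) =
    toEquiv g + toEquiv h + ((0, 0), (toEquiv g).1.1 * (toEquiv h).1.2)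

namespace HeisCoord

variable {G R : Type*} [Group G] [CommRing R] (φ : HeisCoord G R)

theorem map_one : φ.toEquiv 1 = 0 := by
  have h := φ.map_mul 1 1
  rw [mul_one] at h
  have h1 : (φ.toEquiv 1).1.1 = 0 := by
    have := congrArg (fun x => x.1.1) h
    simpa using this
  rw [h1, zero_mul] at h
  have h2 : (((0 : R), (0 : R)), (0 : R)) = 0 := rfl
  rw [h2, add_zero] at h
  simpa using h

/-- The central element with given last coordinate. -/
def central (z : R) : G := φ.toEquiv.symm ((0, 0), z)

theorem map_central_mul (z : R) (g : G) :
    φ.toEquiv (φ.central z * g) = φ.toEquiv g + ((0, 0), z) := by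
  rw [φ.map_mul, central, Equiv.apply_symm_apply]
  ext <;> simp [add_comm]

theorem map_inv (g : G) :
    φ.toEquiv g⁻¹ = -φ.toEquiv g + ((0, 0), (φ.toEquiv g).1.1 * (φ.toEquiv g).1.2) := by
  rw [← φ.toEquiv.eq_symm_apply]
  refine inv_eq_of_mul_eq_one_right (φ.toEquiv.injective ?_)
  rw [φ.map_one, φ.map_mul, Equiv.apply_symm_apply]
  ext <;> simp

/-- The commutator is the central element given by the determinant of the first two coordinates;
normality therefore forces these elements into a normal subgroup. -/
theorem mul_eq_central_mul (g h : G) : g * h = φ.central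
    ((φ.toEquiv g).1.1 * (φ.toEquiv h).1.2 - (φ.toEquiv h).1.1 * (φ.toEquiv g).1.2) * (h * g) := by
  apply φ.toEquiv.injective
  rw [map_central_mul, map_mul, map_mul]
  ext
  · simp [add_comm]
  · simp [add_comm]
  · simp only [Prod.snd_add]
    ring

theorem central_mem (N : Subgroup G) [N.Normal] {g : G} (hg : g ∈ N) (h : G) : φ.central
    ((φ.toEquiv g).1.1 * (φ.toEquiv h).1.2 - (φ.toEquiv h).1.1 * (φ.toEquiv g).1.2) ∈ N := by
  rw [eq_mul_inv_of_mul_eq (φ.mul_eq_central_mul g h).symm, mul_inv_rev, mul_assoc, ← mul_assoc h]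
  exact N.mul_mem hg (Subgroup.Normal.conj_mem ‹_› _ (N.inv_mem hg) h)

theorem central_fst_mul_mem (N : Subgroup G) [N.Normal] {g : G} (hg : g ∈ N) (c : R) :
    φ.central ((φ.toEquiv g).1.1 * c) ∈ N := by
  have := φ.central_mem N hg (φ.toEquiv.symm ((0, c), 0))
  rwa [Equiv.apply_symm_apply, zero_mul, sub_zero] at this

theorem central_snd_mul_mem (N : Subgroup G) [N.Normal] {g : G} (hg : g ∈ N) (c : R) :
    φ.central ((φ.toEquiv g).1.2 * c) ∈ N := by
  have := φ.central_mem N hg (φ.toEquiv.symm ((-c, 0), 0))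
  rw [Equiv.apply_symm_apply, mul_zero, zero_sub] at this
  convert this using 2
  ring

/-- The additive subgroup with the same underlying set as a normal subgroup. -/
def idealOf (N : Subgroup G) [N.Normal] : AddSubgroup ((R × R) × R) where
  carrier := {x | φ.toEquiv.symm x ∈ N}
  zero_mem' := by
    rw [Set.mem_ofPred_eq, ← φ.map_one, Equiv.symm_apply_apply]
    exact N.one_mem
  add_mem' := by
    intro x y hx hy
    -- Sum and product differ by the central element `x₁ y₂`, which lies in `N` by normality.
    have h1 := N.mul_mem (φ.central_fst_mul_mem N hx (-y.1.2)) (N.mul_mem hx hy)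
    rw [Set.mem_ofPred_eq]
    convert h1
    rw [Equiv.symm_apply_eq, map_central_mul, map_mul, Equiv.apply_symm_apply,
      Equiv.apply_symm_apply]
    ext <;> simp
  neg_mem' := by
    intro x hx
    have h1 := N.mul_mem (φ.central_fst_mul_mem N hx (-x.1.2)) (N.inv_mem hx)
    rw [Set.mem_ofPred_eq]
    convert h1
    rw [Equiv.symm_apply_eq, map_central_mul, map_inv, Equiv.apply_symm_apply]
    ext <;> simp

theorem isHeisIdeal_idealOf (N : Subgroup G) [N.Normal] : IsHeisIdeal (φ.idealOf N) := by
  intro x hx c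
  have h1 := φ.central_fst_mul_mem N hx c
  have h2 := φ.central_snd_mul_mem N hx c
  rw [Equiv.apply_symm_apply] at h1 h2
  exact ⟨h1, h2⟩

/-- The subgroup with the same underlying set as an ideal. -/
def subgroupOf (I : AddSubgroup ((R × R) × R)) (hI : IsHeisIdeal I) : Subgroup G where
  carrier := {g | φ.toEquiv g ∈ I}
  one_mem' := by
    rw [Set.mem_ofPred_eq, φ.map_one]
    exact I.zero_mem
  mul_mem' := by
    intro g h hg hh
    rw [Set.mem_ofPred_eq, φ.map_mul]
    exact I.add_mem (I.add_mem hg hh) (hI _ hg _).1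
  inv_mem' := by
    intro g hg
    rw [Set.mem_ofPred_eq, φ.map_inv]
    exact I.add_mem (I.neg_mem hg) (hI _ hg _).1

theorem normal_subgroupOf (I : AddSubgroup ((R × R) × R)) (hI : IsHeisIdeal I) :
    (φ.subgroupOf I hI).Normal := ⟨fun g hg h => by
  rw [mul_inv_eq_of_eq_mul ((φ.mul_eq_central_mul h g).trans (mul_assoc _ _ _).symm)]
  change φ.toEquiv _ ∈ I
  rw [map_central_mul]
  refine I.add_mem hg ?_
  have h2 := I.sub_mem (hI _ hg (φ.toEquiv h).1.1).2 (hI _ hg (φ.toEquiv h).1.2).1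
  convert h2 using 1
  ext
  · simp
  · simp
  · simp only [Prod.snd_sub]
    ring⟩

/-- The two elements differ by a central multiple of the second coordinate of the difference, which
the ideal condition absorbs. Hence group cosets and additive cosets coincide and the indices agree.
-/
theorem inv_mul_mem_iff (I : AddSubgroup ((R × R) × R)) (hI : IsHeisIdeal I) (g h : G) :
    φ.toEquiv (g⁻¹ * h) ∈ I ↔ -φ.toEquiv g + φ.toEquiv h ∈ I := by
  have h1 : φ.toEquiv (g⁻¹ * h) = -φ.toEquiv g + φ.toEquiv h +
      ((0, 0), (-φ.toEquiv g + φ.toEquiv h).1.2 * -(φ.toEquiv g).1.1) := by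
    rw [map_mul, map_inv]
    ext
    · simp
    · simp
    · simp only [Prod.snd_add, Prod.fst_add, Prod.fst_neg, Prod.snd_neg]
      ring
  constructor
  · intro h2
    have h3 := I.sub_mem h2 (hI _ h2 (-(φ.toEquiv g).1.1)).2
    rw [h1] at h3
    convert h3 using 1
    ext <;> simp
  · intro h2
    rw [h1]
    exact I.add_mem h2 (hI _ h2 _).2

theorem index_subgroupOf (I : AddSubgroup ((R × R) × R)) (hI : IsHeisIdeal I) :
    (φ.subgroupOf I hI).index = I.index :=
  Nat.card_congr (Quotient.congr φ.toEquiv fun g h =>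
    (QuotientGroup.leftRel_apply (s := φ.subgroupOf I hI)).trans
      ((φ.inv_mul_mem_iff I hI g h).trans QuotientAddGroup.leftRel_apply.symm))

theorem subgroupOf_idealOf (N : Subgroup G) [N.Normal] :
    φ.subgroupOf (φ.idealOf N) (φ.isHeisIdeal_idealOf N) = N := by
  ext g
  change φ.toEquiv.symm (φ.toEquiv g) ∈ N ↔ _
  rw [Equiv.symm_apply_apply]

theorem normalCount_eq {G R : Type*} [Group G] [CommRing R] (φ : HeisCoord G R) (m : ℕ) : normalCount G m = heisCount R m := by
  refine Nat.card_congr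
    { toFun := fun N => have := N.2.1; ⟨φ.idealOf N.1, φ.isHeisIdeal_idealOf N.1, by
        rw [← φ.index_subgroupOf _ (φ.isHeisIdeal_idealOf N.1), subgroupOf_idealOf, N.2.2]⟩
      invFun := fun I => ⟨φ.subgroupOf I.1 I.2.1, φ.normal_subgroupOf I.1 I.2.1, by
        rw [index_subgroupOf, I.2.2]⟩
      left_inv := fun N => have := N.2.1; Subtype.ext (φ.subgroupOf_idealOf N.1)
      right_inv := fun I => Subtype.ext (AddSubgroup.ext fun x => ?_) }
  change φ.toEquiv (φ.toEquiv.symm x) ∈ I.1 ↔ _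
  rw [Equiv.apply_symm_apply]

end HeisCoord

/-- The matrix entries of an element of the Heisenberg group. -/
def heisenbergCoord (R : Type*) [CommRing R] : HeisCoord (heisenberg R) R where
  toEquiv := Equiv.ofBijective (fun A => ((A.1.1 0 1, A.1.1 1 2), A.1.1 0 2)) ⟨by
    rintro ⟨A, a, b, c, hA⟩ ⟨A', a', b', c', hA'⟩ h
    simp only [hA, hA', Prod.mk.injEq] at h
    simp at h
    obtain ⟨⟨rfl, rfl⟩, rfl⟩ := h
    exact Subtype.ext (Units.ext (hA.trans hA'.symm)), by
    rintro ⟨⟨a, b⟩, c⟩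
    refine ⟨⟨⟨!![1, a, c; 0, 1, b; 0, 0, 1], !![1, -a, a * b - c; 0, 1, -b; 0, 0, 1], ?_, ?_⟩,
      a, b, c, rfl⟩, ?_⟩
    · ext i j
      fin_cases i <;> fin_cases j <;> simp [Matrix.mul_apply, Fin.sum_univ_three]
      ring
    · ext i j
      fin_cases i <;> fin_cases j <;> simp [Matrix.mul_apply, Fin.sum_univ_three]
      ring
    · simp⟩
  map_mul := by
    rintro ⟨A, a, b, c, hA⟩ ⟨A', a', b', c', hA'⟩
    change (((A.val * A'.val) 0 1, (A.val * A'.val) 1 2), (A.val * A'.val) 0 2) =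
      ((A.val 0 1, A.val 1 2), A.val 0 2) + ((A'.val 0 1, A'.val 1 2), A'.val 0 2) +
        ((0, 0), A.val 0 1 * A'.val 1 2)
    rw [hA, hA']
    refine Prod.ext (Prod.ext ?_ ?_) ?_
    · simp [Matrix.mul_apply, Fin.sum_univ_three, add_comm]
    · simp [Matrix.mul_apply, Fin.sum_univ_three, add_comm]
    · simp [Matrix.mul_apply, Fin.sum_univ_three]
      ring

/-- Coordinates on a power of the Heisenberg group. -/
def HeisCoord.pi {G R : Type*} [Group G] [CommRing R] (φ : HeisCoord G R) (ι : Type*) :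
    HeisCoord (ι → G) (ι → R) where
  toEquiv :=
    { toFun := fun g => ((fun i => (φ.toEquiv (g i)).1.1, fun i => (φ.toEquiv (g i)).1.2),
        fun i => (φ.toEquiv (g i)).2)
      invFun := fun x i => φ.toEquiv.symm ((x.1.1 i, x.1.2 i), x.2 i)
      left_inv := fun g => funext fun i => φ.toEquiv.symm_apply_apply (g i)
      right_inv := fun x => by simp }
  map_mul g h := by
    ext i <;> simp [φ.map_mul]

/-! ### Reduction to finite rings -/

/-- A subgroup of index `m` contains all `m`-th multiples, hence the kernel of the map, and is
therefore the preimage of its image. -/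
theorem heisCount_congr_of_surjective {R R' : Type*} [CommRing R] [CommRing R'] (f : R →+* R')
    (hf : Function.Surjective f) {m : ℕ} (hker : ∀ x, f x = 0 → ∃ y, x = m • y) :
    heisCount R m = heisCount R' m := by
  let g : (R × R) × R →+ (R' × R') × R' :=
    ((f : R →+ R').prodMap (f : R →+ R')).prodMap (f : R →+ R')
  have hg : Function.Surjective g := (hf.prodMap hf).prodMap hf
  have hgk : ∀ x, g x = 0 → ∃ y, x = m • y := by
    rintro ⟨⟨a, b⟩, c⟩ h
    simp only [g, AddMonoidHom.prodMap_def] at h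
    obtain ⟨⟨h1, h2⟩, h3⟩ : (f a = 0 ∧ f b = 0) ∧ f c = 0 := by
      simpa [Prod.ext_iff] using h
    obtain ⟨a, rfl⟩ := hker a h1
    obtain ⟨b, rfl⟩ := hker b h2
    obtain ⟨c, rfl⟩ := hker c h3
    exact ⟨((a, b), c), rfl⟩
  have hideal : ∀ I : AddSubgroup ((R' × R') × R'), IsHeisIdeal (I.comap g) ↔ IsHeisIdeal I := by
    intro I
    constructor
    · intro h x hx c
      obtain ⟨x, rfl⟩ := hg x
      obtain ⟨c, rfl⟩ := hf c
      have h1 := h x hx c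
      simpa [g, AddSubgroup.mem_comap] using h1
    · intro h x hx c
      have h1 := h (g x) hx (f c)
      simpa [g, AddSubgroup.mem_comap] using h1
  refine (Nat.card_congr (Equiv.ofBijective (fun I => ⟨I.1.comap g, (hideal I.1).2 I.2.1, by
    rw [AddSubgroup.index_comap_of_surjective _ hg, I.2.2]⟩) ⟨fun I J h => ?_, fun N => ?_⟩)).symm
  · exact Subtype.ext (AddSubgroup.comap_injective hg (congrArg Subtype.val h))
  · have h1 : (N.1.map g).comap g = N.1 := AddSubgroup.comap_map_eq_self fun x hx => by
      obtain ⟨y, rfl⟩ := hgk x hx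
      have h2 := N.1.nsmul_index_mem y
      rwa [N.2.2] at h2
    refine ⟨⟨N.1.map g, (hideal _).1 (h1.symm ▸ N.2.1), ?_⟩, Subtype.ext h1⟩
    rw [← AddSubgroup.index_comap_of_surjective _ hg, h1, N.2.2]

theorem heisCount_pi_int (n m : ℕ) :
    heisCount (Fin n → ℤ) m = heisCount (Fin n → ZMod m) m := by
  refine heisCount_congr_of_surjective (RingHom.pi fun i =>
    (Int.castRingHom (ZMod m)).comp (Pi.evalRingHom (fun _ : Fin n => ℤ) i)) (fun y => ?_)
    fun x hx => ?_
  · choose x hx using fun i => ZMod.intCast_surjective (y i)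
    exact ⟨x, funext hx⟩
  · have h1 : ∀ i, ∃ c, x i = m * c := fun i =>
      (ZMod.intCast_zmod_eq_zero_iff_dvd (x i) m).1 (congrFun hx i)
    choose y hy using h1
    exact ⟨y, funext fun i => by rw [hy, Pi.smul_apply, nsmul_eq_mul]⟩

end HeisenbergZeta
end

noncomputable section
namespace HeisenbergZeta

/-! ### Totally split primes -/

open NumberField

/-! ### Quotients by powers of the primes above `p` -/

section Split

variable {O : Type*} [CommRing O] [IsDedekindDomain O]

theorem not_pow_dvd_prod_pow {n : ℕ} {P : Fin n → Ideal O} (hinj : Function.Injective P)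
    (hprime : ∀ i, Prime (P i)) (i : Fin n) {j m : ℕ} (hjm : j < m) :
    ¬ P i ^ m ∣ (∏ k, P k) ^ j := by
  intro h
  rw [← Finset.mul_prod_erase _ _ (Finset.mem_univ i), mul_pow] at h
  have h1 := (pow_dvd_pow (P i) hjm).trans h
  rw [Nat.succ_eq_add_one, pow_succ] at h1
  have h2 := (hprime i).dvd_of_dvd_pow
    ((mul_dvd_mul_iff_left (pow_ne_zero j (hprime i).ne_zero)).1 h1)
  obtain ⟨k, hk, hk'⟩ := (hprime i).exists_mem_finset_dvd h2
  have h3 := ((hprime i).associated_of_dvd (hprime k) hk')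
  exact (Finset.mem_erase.1 hk).1 (hinj (associated_iff_eq.1 h3).symm)

/-- As `(p)` is a product of distinct primes, `P i` divides it exactly once, so `p^j` vanishes
modulo `P i ^ m` only for `j ≥ m`. -/
theorem charP_quotient_pow {p : ℕ} (hp : p.Prime) {n : ℕ} {P : Fin n → Ideal O}
    (hinj : Function.Injective P) (hprime : ∀ i, Prime (P i))
    (hprod : Ideal.span {(p : O)} = ∏ k, P k) (i : Fin n) (m : ℕ) :
    CharP (O ⧸ P i ^ m) (p ^ m) := by
  have hmem : ∀ j, ((p ^ j : ℕ) : O ⧸ P i ^ m) = 0 ↔ P i ^ m ∣ (∏ k, P k) ^ j := fun j => by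
    rw [← map_natCast (Ideal.Quotient.mk (P i ^ m)), Ideal.Quotient.eq_zero_iff_mem, ← hprod,
      Ideal.span_singleton_pow, Ideal.dvd_span_singleton, Nat.cast_pow]
  have h1 : ringChar (O ⧸ P i ^ m) ∣ p ^ m := (ringChar.spec _ _).1
    ((hmem m).2 (pow_dvd_pow_of_dvd (Finset.dvd_prod_of_mem P (Finset.mem_univ i)) m))
  obtain ⟨j, hj, hj'⟩ := (Nat.dvd_prime_pow hp).1 h1
  refine ringChar.of_eq ?_
  rcases hj.lt_or_eq with hlt | rfl
  · refine (not_pow_dvd_prod_pow hinj hprime i hlt ((hmem j).1 ?_)).elim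
    rw [← hj']
    exact ringChar.Nat.cast_ringChar
  · exact hj'

end Split

/-- By the Chinese remainder theorem `𝓞 K / p^m` is the product of the quotients by `P i ^ m`. Each
has order `p^m`, because the residue degree is `1`, and characteristic `p^m`, so it is `ℤ/p^m`. -/
theorem heisCount_ringOfIntegers {K : Type*} [Field K] [NumberField K] {p : ℕ} (hp : p.Prime)
    {n : ℕ} (h : HasDecompositionType K p (fun _ : Fin n => 1) (fun _ => 1)) (m : ℕ) :
    heisCount (𝓞 K) (p ^ m) = heisCount (Fin n → ZMod (p ^ m)) (p ^ m) := by
  obtain ⟨P, hinj, hP, hprod, hdeg⟩ := h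
  simp only [pow_one] at hprod
  have hp0 : (p : 𝓞 K) ≠ 0 := Nat.cast_ne_zero.2 hp.ne_zero
  have hbot : ∀ i, P i ≠ ⊥ := fun i h0 => hp0 <| by
    rw [← Ideal.span_singleton_eq_bot, hprod]
    exact Finset.prod_eq_zero (Finset.mem_univ i) h0
  have hprime : ∀ i, Prime (P i) := fun i => Ideal.prime_of_isPrime (hbot i) (hP i)
  have hmax : ∀ i, (P i).IsMaximal := fun i => (hP i).isMaximal (hbot i)
  have hpm : (Ideal.span {(p : ℤ)}).IsMaximal :=
    PrincipalIdealRing.isMaximal_of_irreducible (Nat.prime_iff_prime_int.1 hp).irreducible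
  have hnorm : ∀ i, Ideal.absNorm (P i) = p := fun i => by
    have hmem : (p : 𝓞 K) ∈ P i := by
      have h1 : P i ∣ Ideal.span {(p : 𝓞 K)} := by
        rw [hprod]
        exact Finset.dvd_prod_of_mem P (Finset.mem_univ i)
      exact Ideal.dvd_span_singleton.1 h1
    have hover : (P i).LiesOver (Ideal.span {(p : ℤ)}) := ⟨by
      refine hpm.eq_of_le (Ideal.comap_ne_top _ (hP i).ne_top) ?_
      rw [Ideal.span_singleton_le_iff_mem, Ideal.mem_comap, map_natCast]
      exact hmem⟩
    have := hmax i
    rw [Ideal.absNorm_eq_pow_inertiaDeg' (P i) hp, Ideal.inertiaDeg'_eq_inertiaDeg, hdeg, pow_one]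
  have hequiv : ∀ i, Nonempty (ZMod (p ^ m) ≃+* 𝓞 K ⧸ P i ^ m) := fun i => by
    have := charP_quotient_pow hp hinj hprime hprod i m
    have hc : Nat.card (𝓞 K ⧸ P i ^ m) = p ^ m := by
      rw [← Submodule.cardQuot_apply, ← Ideal.absNorm_apply, map_pow, hnorm]
    have hfin : Finite (𝓞 K ⧸ P i ^ m) :=
      Nat.finite_of_card_ne_zero (by rw [hc]; exact pow_ne_zero _ hp.ne_zero)
    have := Fintype.ofFinite (𝓞 K ⧸ P i ^ m)
    exact ⟨ZMod.ringEquiv _ (Nat.card_eq_fintype_card.symm.trans hc)⟩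
  let e : 𝓞 K ⧸ Ideal.span {(p : 𝓞 K)} ^ m ≃+* ∀ i, 𝓞 K ⧸ P i ^ m :=
    IsDedekindDomain.quotientEquivPiOfProdEq _ P (fun _ => m) hprime
      (fun i j hij => hinj.ne hij) (by rw [hprod, Finset.prod_pow])
  let e' : 𝓞 K ⧸ Ideal.span {(p : 𝓞 K)} ^ m ≃+* (Fin n → ZMod (p ^ m)) :=
    e.trans (RingEquiv.piCongrRight fun i => (hequiv i).some.symm)
  refine heisCount_congr_of_surjective (e'.toRingHom.comp
    (Ideal.Quotient.mk (Ideal.span {(p : 𝓞 K)} ^ m)))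
    (e'.surjective.comp Ideal.Quotient.mk_surjective) fun x hx => ?_
  have h1 : Ideal.Quotient.mk (Ideal.span {(p : 𝓞 K)} ^ m) x = 0 :=
    (map_eq_zero_iff e' e'.injective).1 hx
  rw [Ideal.Quotient.eq_zero_iff_mem, Ideal.span_singleton_pow, Ideal.mem_span_singleton] at h1
  obtain ⟨y, rfl⟩ := h1
  exact ⟨y, by rw [nsmul_eq_mul, Nat.cast_pow]⟩

end HeisenbergZeta
end

/-! ### The main theorem -/

theorem mainTheorem4 (n : ℕ) (hn : 1 ≤ n)
    (r : HeisenbergZeta.DyckWords n → ℕ) (L M : HeisenbergZeta.DyckWords n → ℕ → ℕ)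
    (hblock : ∀ w, HeisenbergZeta.IsBlockForm n w.1 (r w) (L w) (M w))
    (p : ℕ) (hp : p.Prime) :
    (∀ s : ℂ, 2 * (n : ℝ) / 3 < s.re → ∀ w : HeisenbergZeta.DyckWords n,
      Summable (fun x : HeisenbergZeta.overlapPairs n w.1 =>
        HeisenbergZeta.dyckTerm (fun _ : Fin n => 1) (fun _ => 1) p ((p : ℂ) ^ (-s)) x.1) ∧
      HeisenbergZeta.dyckSum n (fun _ : Fin n => 1) (fun _ => 1) w.1 p ((p : ℂ) ^ (-s)) =
        HeisenbergZeta.splitProduct n (r w) (L w) (M w) (p : ℂ) ((p : ℂ) ^ (-s))) ∧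
    (∀ s : ℂ, 2 * (n : ℝ) - 1 < s.re →
      (∀ (K : Type*) [Field K] [NumberField K], Module.finrank ℚ K = n →
        HeisenbergZeta.HasDecompositionType K p (fun _ : Fin n => 1) (fun _ => 1) →
        HeisenbergZeta.HasLocalNormalZeta
          (HeisenbergZeta.heisenberg (NumberField.RingOfIntegers K)) p s
          (HeisenbergZeta.normalW n r L M (p : ℂ) ((p : ℂ) ^ (-s)))) ∧
      HeisenbergZeta.HasLocalNormalZeta (Fin n → HeisenbergZeta.heisenberg ℤ) p s
        (HeisenbergZeta.normalW n r L M (p : ℂ) ((p : ℂ) ^ (-s)))) := by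
  refine ⟨fun s hs w => ?_, fun s hs => ⟨fun K _ _ _ hK => ?_, ?_⟩⟩
  · have h := HeisenbergZeta.hasSum_overlapPairs hn (hblock w) hp hs
    exact ⟨h.summable, h.tsum_eq⟩
  · refine (HeisenbergZeta.hasSum_heisCount hn hblock hp hs).congr_fun fun k => ?_
    rw [(HeisenbergZeta.heisenbergCoord _).normalCount_eq,
      HeisenbergZeta.heisCount_ringOfIntegers hp hK, HeisenbergZeta.heisCount_pi_int]
  · refine (HeisenbergZeta.hasSum_heisCount hn hblock hp hs).congr_fun fun k => ?_
    rw [((HeisenbergZeta.heisenbergCoord ℤ).pi (Fin n)).normalCount_eq]
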